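/- Let $\mathcal O\subset\mathbb R^d$, $\mathcal O\neq\mathbb R^d$, be a (nonempty, open, connected) $C^{1,\alpha}$-domain, $0<\alpha<1$, with outward unit normal $\mathbf n$ and surface measure $\mathrm s$ on $\partial\mathcal O$, and put $\rho(x)=\mathrm{dist}(x,\partial\mathcal O)$, $m_t(y)=\min\{1,\rho(y)/\sqrt t\}$, $g_t(z)=(2\pi t)^{-d/2}e^{-|z|^2/(2t)}$. Let $$\mathcal A\phi=\sum_{i,j}\partial_{x_i}\big(a_{ij}\,\partial_{x_j}\phi\big)+\sum_i\mu^i\,\partial_{x_i}\phi ,$$ where $a=(a_{ij})$ is bounded on $\mathcal O$, continuous on $\overline{\mathcal O}$, and $\kappa|h|^2\le\langle a(x)a^T(x)h,h\rangle\le\kappa^{-1}|h|^2$ for some $\kappa>0$ and all $x\in\mathcal O$, $h\in\mathbb R^d$, and where $\mu$ is measurable and locally square integrable in $\mathcal O$. Let $\mathbf n^a=\big(\sum_j a_{ij}\mathbf n^j\big)_{i}$ be the conormal vector on $\partial\mathcal O$. Let $S=(S(t))_{t\ge0}$ be a $C_0$-semigroup on the real space $L^2(\mathcal O)$ whose generator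 $A$ realizes $\mathcal A$ with homogeneous Dirichlet conditions: $D(A)\subset H^1_0(\mathcal O)$ and $Au=\mathcal Au$ in the sense of distributions for $u\in D(A)$. Let $A^*$ be the adjoint of $A$, i.e. the generator of the adjoint semigroup $S^*$. Assume that $S$ is given by a measurable Green kernel, $$S(t)\psi(x)=\int_{\mathcal O}G(t,x,y)\psi(y)\,dy,\qquad t>0,\ \psi\in L^2(\mathcal O),\ \text{a.e. }x\in\mathcal O,$$ that for $t>0$, $x\in\mathcal O$ the function $G(t,x,\cdot)$ is of class $C^1$ up to the boundary, that with some $C,c>0$ $$|G(t,x,y)|\le C\,m_t(y)\,g_{ct}(x-y),\qquad |\nabla_xG(t,x,y)|\le C\,\frac{m_t(y)}{\sqrt t}\,g_{ct}(x-y),\qquad 0<t\le1,\ x,y\in\mathcal O,$$ and that for every $T>0$ there are $C,c>0$ with $|\nabla_yG(t,x,y)|\le \frac{C}{\sqrt t}\,g_{ct}(x-y)$ for $0<t\le T$, $x,y\in\mathcal O$. Let $\lambda$ be a real number larger than the growth bound of $S$ (so that $\lambda$ is in the resolvent set of $A$), and let $$\mathcal G_\lambda(x,y)=\int_0^{\infty}e^{-\lambda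 t}G(t,x,y)\,dt .$$ For a continuous compactly supported $\gamma:\partial\mathcal O\to\mathbb R$ let $D_\lambda\gamma$ be the weak solution of $\mathcal Au=\lambda u$ in $\mathcal O$, $u=\gamma$ on $\partial\mathcal O$, that is, the element $u\in L^2(\mathcal O)$ with $$\int_{\mathcal O}u\,(A^*-\lambda)\psi\,dx=\int_{\partial\mathcal O}\gamma\,\frac{\partial\psi}{\partial\mathbf n^a}\,d\mathrm s$$ for all $\psi\in D(A^*)$ that are $C^1$ up to the boundary, vanish on $\partial\mathcal O$, and have $(A^*-\lambda)\psi$ bounded. Then $D_\lambda\gamma$ exists and is unique. For a.e. $x\in\mathcal O$ the integral defining $\mathcal G_\lambda(x,y)$ converges absolutely for all $y\in\overline{\mathcal O}\setminus\{x\}$, the function $\mathcal G_\lambda(x,\cdot)$ is differentiable (within $\overline{\mathcal O}$) at every point of $\partial\mathcal O$, and $$D_\lambda\gamma(x)=-\int_{\partial\mathcal O}\gamma(y)\,\frac{\partial}{\partial\mathbf n^a(y)}\mathcal G_\lambda(x,y)\,d\mathrm s(y).$$ Moreover, for every $t>0$, $S(t)D_\lambda\gamma\in D(A)$ and, for a.e.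 $x\in\mathcal O$, $$(\lambda-A)S(t)D_\lambda\gamma(x)=-\int_{\partial\mathcal O}\gamma(y)\,\frac{\partial}{\partial\mathbf n^a(y)}G(t,x,y)\,d\mathrm s(y).$$ Both boundary integrals converge absolutely. -/

import Mathlib

open MeasureTheory Filter Topology Set
open scoped NNReal ENNReal RealInnerProductSpace Matrix

noncomputable section

namespace BoundaryNoise

/-- Euclidean space `ℝ^d`. -/
abbrev Sp (d : ℕ) : Type := EuclideanSpace ℝ (Fin d)

/-- The Hilbert space `L²(O, dx)` of real functions. -/
abbrev L2 {d : ℕ} (O : Set (Sp d)) : Type := Lp ℝ 2 (volume.restrict O)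

/-! ### The domain, its normal vector and its surface measure -/

/-- `O` is a `C^{1,α}` domain: a nonempty open connected set, different from the whole space, which
near each of its boundary points `z` is, for some unit vector `ν`, the region below the graph over
the hyperplane `ν^⊥` of a `C^1` function whose derivative is Hölder continuous of exponent `α`. -/
structure IsC1HolderDomain {d : ℕ} (α : ℝ≥0) (O : Set (Sp d)) : Prop where
  isOpen : IsOpen O
  isConnected : IsConnected O
  ne_univ : O ≠ univ
  graph : ∀ z ∈ frontier O, ∃ (ν : Sp d) (r : ℝ) (φ : (ℝ ∙ ν)ᗮ → ℝ),
    ‖ν‖ = 1 ∧ 0 < r ∧ ContDiff ℝ 1 φ ∧ (∃ C : ℝ≥0, HolderWith C α (fderiv ℝ φ)) ∧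
    ∀ x ∈ Metric.ball z r,
      (x ∈ O ↔ ⟪ν, x - z⟫ < φ ((ℝ ∙ ν)ᗮ.orthogonalProjectionOnto (x - z)))

/-- `n` is the outward unit normal vector to `O` at the boundary point `z`: up to an error
`o(‖x - z‖)`, the points `x` of `O` near `z` satisfy `⟪n, x - z⟫ ≤ 0`, and the points `x` outside `O`
satisfy `0 ≤ ⟪n, x - z⟫`. For a `C^1` domain there is exactly one such vector. -/
def IsOutwardUnitNormal {d : ℕ} (O : Set (Sp d)) (z n : Sp d) : Prop :=
  ‖n‖ = 1 ∧ ∀ ε > 0, ∃ r > 0, ∀ x ∈ Metric.ball z r,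
    (x ∈ O → ⟪n, x - z⟫ ≤ ε * ‖x - z‖) ∧ (x ∉ O → -(ε * ‖x - z‖) ≤ ⟪n, x - z⟫)

/-- The outward unit normal vector field on the boundary of `O`. -/
def outwardNormal {d : ℕ} (O : Set (Sp d)) (z : Sp d) : Sp d :=
  Classical.epsilon (IsOutwardUnitNormal O z)

/-- The surface measure on `∂O`, that is, the `(d-1)`-dimensional Hausdorff measure, normalized so as
to agree with Lebesgue measure on `(d-1)`-dimensional planes, restricted to `∂O`. -/
def surfaceMeasure {d : ℕ} (O : Set (Sp d)) : Measure (Sp d) :=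
  (Measure.euclideanHausdorffMeasure (d - 1)).restrict (frontier O)

/-- The conormal vector field `n^a = a n`, with components `(n^a)_i = ∑ j, a i j * n j`. -/
def conormal {d : ℕ} (a : Sp d → Matrix (Fin d) (Fin d) ℝ) (O : Set (Sp d)) (y : Sp d) : Sp d :=
  Matrix.toEuclideanCLM (𝕜 := ℝ) (a y) (outwardNormal O y)

/-- The conormal derivative `∂f/∂n^a (y)` at a boundary point `y` of a function `f` on the closure
of `O`; the derivative at `y` is taken within the closure. -/
def conormalDeriv {d : ℕ} (a : Sp d → Matrix (Fin d) (Fin d) ℝ) (O : Set (Sp d)) (f : Sp d → ℝ)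
    (y : Sp d) : ℝ :=
  fderivWithin ℝ f (closure O) y (conormal a O y)

/-! ### Semigroups on `L²(O)` and the realization of the elliptic operator -/

/-- `(S t)`, `t ≥ 0`, is a `C₀`-semigroup (values of `S` at negative times are irrelevant). -/
structure IsC0Semigroup {H : Type*} [NormedAddCommGroup H] [NormedSpace ℝ H]
    (S : ℝ → H →L[ℝ] H) : Prop where
  zero : S 0 = ContinuousLinearMap.id ℝ H
  add : ∀ s t : ℝ, 0 ≤ s → 0 ≤ t → S (s + t) = (S s).comp (S t)
  tendsto : ∀ u : H, Tendsto (fun t => S t u) (𝓝[>] 0) (𝓝 u)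

/-- `u` belongs to the domain of the generator `A` of `S`, and `A u = v`. -/
def GeneratorEq {H : Type*} [NormedAddCommGroup H] [NormedSpace ℝ H]
    (S : ℝ → H →L[ℝ] H) (u v : H) : Prop :=
  Tendsto (fun t : ℝ => t⁻¹ • (S t u - u)) (𝓝[>] 0) (𝓝 v)

/-- The adjoint semigroup `S^*`; its generator is the adjoint `A^*` of the generator `A` of `S`. -/
def adjointSemigroup {d : ℕ} {O : Set (Sp d)} (S : ℝ → L2 O →L[ℝ] L2 O) :
    ℝ → L2 O →L[ℝ] L2 O :=
  fun t => ContinuousLinearMap.adjoint (S t)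

/-- `u` belongs to `H^1_0(O)`, with weak gradient `g`: the pair `(u, ∇u = g)` is a limit in `L²(O)`
of pairs `(φ, ∇φ)` with `φ` smooth and compactly supported in `O`. -/
def IsH10WithGradient {d : ℕ} (O : Set (Sp d)) (u : Sp d → ℝ) (g : Sp d → Sp d) : Prop :=
  MemLp u 2 (volume.restrict O) ∧ MemLp g 2 (volume.restrict O) ∧
  ∀ ε : ℝ≥0∞, 0 < ε → ∃ φ : Sp d → ℝ, ContDiff ℝ (⊤ : ℕ∞) φ ∧ HasCompactSupport φ ∧
    tsupport φ ⊆ O ∧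
    eLpNorm (fun x => φ x - u x) 2 (volume.restrict O) < ε ∧
    eLpNorm (fun x => gradient φ x - g x) 2 (volume.restrict O) < ε

/-- The generator of `S` is a realization on `L²(O)`, with homogeneous Dirichlet boundary
conditions, of the differential operator
`∑ i j, ∂_i (a i j * ∂_j u) + ∑ i, μ i * ∂_i u`:
if `A u = f`, then `u` is in `H^1_0(O)` and the operator maps `u` to `f` in the sense of
distributions on `O`. -/
def IsDirichletRealization {d : ℕ} (a : Sp d → Matrix (Fin d) (Fin d) ℝ) (μ : Sp d → Sp d)
    (O : Set (Sp d)) (S : ℝ → L2 O →L[ℝ] L2 O) : Prop :=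
  ∀ u f : L2 O, GeneratorEq S u f → ∃ g : Sp d → Sp d, IsH10WithGradient O u g ∧
    ∀ φ : Sp d → ℝ, ContDiff ℝ (⊤ : ℕ∞) φ → HasCompactSupport φ → tsupport φ ⊆ O →
      ∫ x in O, (-⟪Matrix.toEuclideanCLM (𝕜 := ℝ) (a x) (g x), gradient φ x⟫
        + ⟪μ x, g x⟫ * φ x) = ∫ x in O, f x * φ x

/-- Standing assumptions on the coefficients of the operator: the matrix `a` is continuous up to
the boundary, bounded, and uniformly elliptic,
`κ |h|² ≤ ⟨a(x) a(x)ᵀ h, h⟩ ≤ κ⁻¹ |h|²`; the drift `μ` is measurable and locally square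
integrable in `O`. -/
structure CoefficientAssumption {d : ℕ} (a : Sp d → Matrix (Fin d) (Fin d) ℝ) (μ : Sp d → Sp d)
    (O : Set (Sp d)) : Prop where
  continuousOn : ContinuousOn a (closure O)
  bounded : ∃ K : ℝ, ∀ x ∈ O, ∀ i j, |a x i j| ≤ K
  elliptic : ∃ κ : ℝ, 0 < κ ∧ ∀ x ∈ O, ∀ h : Sp d,
    κ * ‖h‖ ^ 2 ≤ ⟪Matrix.toEuclideanCLM (𝕜 := ℝ) (a x * (a x)ᵀ) h, h⟫ ∧
    ⟪Matrix.toEuclideanCLM (𝕜 := ℝ) (a x * (a x)ᵀ) h, h⟫ ≤ κ⁻¹ * ‖h‖ ^ 2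
  drift : ∀ K : Set (Sp d), IsCompact K → K ⊆ O → MemLp μ 2 (volume.restrict K)

/-! ### The Green kernel -/

/-- The Gaussian density `g_t(z) = (2πt)^{-d/2} exp(-|z|²/(2t))`. -/
def gauss {d : ℕ} (t : ℝ) (z : Sp d) : ℝ :=
  (2 * Real.pi * t) ^ (-((d : ℝ) / 2)) * Real.exp (-(‖z‖ ^ 2 / (2 * t)))

/-- `m_t(z) = min {1, ρ(z)/√t}`, where `ρ(z)` is the distance from `z` to `∂O`. -/
def boundaryFactor {d : ℕ} (O : Set (Sp d)) (t : ℝ) (z : Sp d) : ℝ :=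
  min 1 (Metric.infDist z (frontier O) / Real.sqrt t)

/-- `G` is a Green kernel of the semigroup `S`:
`(S t ψ)(x) = ∫_O G(t,x,y) ψ(y) dy` for all `t > 0`, `ψ ∈ L²(O)` and almost all `x ∈ O`. The kernel
is a measurable function, and for `t > 0` and `x ∈ O` the function `G(t,x,·)` is of class `C^1` up to
the boundary. -/
structure IsGreenKernel {d : ℕ} (O : Set (Sp d)) (S : ℝ → L2 O →L[ℝ] L2 O)
    (G : ℝ → Sp d → Sp d → ℝ) : Prop where
  measurable : Measurable (fun p : ℝ × Sp d × Sp d => G p.1 p.2.1 p.2.2)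
  contDiffOn : ∀ t : ℝ, 0 < t → ∀ x ∈ O, ContDiffOn ℝ 1 (G t x) (closure O)
  apply_eq : ∀ t : ℝ, 0 < t → ∀ ψ : L2 O, ∀ᵐ x ∂(volume.restrict O),
    IntegrableOn (fun y => G t x y * ψ y) O ∧ S t ψ x = ∫ y in O, G t x y * ψ y

/-- Gaussian bounds for the Green kernel and for its gradient in `x`, for `t ≤ 1`. -/
def GreenBounds {d : ℕ} (O : Set (Sp d)) (G : ℝ → Sp d → Sp d → ℝ) : Prop :=
  ∃ C c : ℝ, 0 < C ∧ 0 < c ∧ ∀ t : ℝ, 0 < t → t ≤ 1 → ∀ x ∈ O, ∀ y ∈ O,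
    |G t x y| ≤ C * boundaryFactor O t y * gauss (c * t) (x - y) ∧
    DifferentiableAt ℝ (fun z => G t z y) x ∧
    ‖gradient (fun z => G t z y) x‖
      ≤ C * (boundaryFactor O t y / Real.sqrt t) * gauss (c * t) (x - y)

/-- Gaussian bound for the gradient of the Green kernel in `y`, on every bounded time interval. -/
def GreenGradientBound {d : ℕ} (O : Set (Sp d)) (G : ℝ → Sp d → Sp d → ℝ) : Prop :=
  ∀ T : ℝ, 0 < T → ∃ C c : ℝ, 0 < C ∧ 0 < c ∧ ∀ t : ℝ, 0 < t → t ≤ T → ∀ x ∈ O, ∀ y ∈ O,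
    ‖gradient (fun z => G t x z) y‖ ≤ C / Real.sqrt t * gauss (c * t) (x - y)

/-- The Laplace transform in time `∫_0^∞ exp(-lam * t) G(t,x,y) dt` of the Green kernel. -/
def laplaceKernel {d : ℕ} (G : ℝ → Sp d → Sp d → ℝ) (lam : ℝ) (x y : Sp d) : ℝ :=
  ∫ t in Ioi (0 : ℝ), Real.exp (-(lam * t)) * G t x y

/-! ### The Dirichlet map -/

/-- `ψ` is a test function, with `(A^* - lam) ψ = f`: it is of class `C^1` up to the boundary,
vanishes on `∂O`, its class in `L²(O)` is in the domain of `A^*`, and `f` is bounded. -/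
def IsTestFunction {d : ℕ} (O : Set (Sp d)) (S : ℝ → L2 O →L[ℝ] L2 O) (lam : ℝ)
    (ψ : Sp d → ℝ) (f : L2 O) : Prop :=
  ContDiffOn ℝ 1 ψ (closure O) ∧ (∀ y ∈ frontier O, ψ y = 0) ∧
  MemLp f ∞ (volume.restrict O) ∧
  ∃ p q : L2 O, p =ᵐ[volume.restrict O] ψ ∧ GeneratorEq (adjointSemigroup S) p q ∧
    f = q - lam • p

/-- `u = D_lam γ`, that is, `u` is the weak solution, in the sense of transposition, of the Poisson
problem `𝒜 u = lam u` in `O`, `u = γ` on `∂O`: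
`∫_O u (A^* - lam) ψ dx = ∫_{∂O} γ ∂ψ/∂n^a ds` for all test functions `ψ`. -/
def IsDirichletMapValue {d : ℕ} (a : Sp d → Matrix (Fin d) (Fin d) ℝ) (O : Set (Sp d))
    (S : ℝ → L2 O →L[ℝ] L2 O) (lam : ℝ) (γ : Sp d → ℝ) (u : L2 O) : Prop :=
  ∀ (ψ : Sp d → ℝ) (f : L2 O), IsTestFunction O S lam ψ f →
    ∫ x in O, u x * f x = ∫ y, γ y * conormalDeriv a O ψ y ∂(surfaceMeasure O)

end BoundaryNoise

end

noncomputable section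

namespace BoundaryNoise

variable {d : ℕ} {O : Set (Sp d)}

/-! ### The outward normal -/

/-! The proof represents the boundary datum by an orbit of the semigroup that is singular at time 0.
For t > 0 consider the functional sending f in L²(O) to minus the integral over ∂O of γ ∂(S^*(t)
f)/∂n^a. It makes sense because S^*(t) f is given by integrating G(t,x,y) f(x) in x
(`kernelAdjoint_ae_eq`), hence is C^1 up to the boundary. The gradient bound costs t^(-1/2). A
Gaussian density integrated over a compact part of the boundary, a set of codimension one, is of
order t^(-1/2), and Cauchy-Schwarz takes the square root of this. So the functional has norm
O(t^(-3/4)) (`exists_abs_boundaryPairing_kernelAdjoint_le`). Riesz representation gives H(t) in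
L²(O) with S(r) H(t) = H(r + t), and as 3/4 < 1 the Laplace transform u₀ = ∫ exp(-lam t) H(t) dt
converges. Writing R for the resolvent of A at lam, S(ε) u₀ = R H(ε). Hence S(ε) u₀ is in D(A) and
(lam - A) S(ε) u₀ = H(ε).

Existence. If f = (A^* - lam) p is bounded, duality gives ⟪S(ε) u₀, f⟫ = -⟪H(ε), p⟫, the boundary
pairing of γ with S^*(ε) p. To let ε → 0, the gradient of S^*(ε) p must converge uniformly up to the
boundary. Indeed p - exp(-lam ε) S^*(ε) p is minus the integral of exp(-lam t) S^*(t) f over (0, ε),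
whose gradient is O(√ε) since that of S^*(t) f is O(t^(-1/2))
(`norm_fderivWithin_sub_kernelAdjoint_le`).

Uniqueness. For every f in L²(O), R^* S^*(ε) f = S^*(ε) R^* f is C^1 up to the boundary and vanishes
there, while S^*(ε) f is bounded. It is therefore a test function, so the difference w of two
solutions satisfies S(ε) w = 0 for all ε > 0, and w = 0.

Kernel formulas. For almost every x, G(s + r,x,·) = S^*(r) G(s,x,·) (`kernel_add_ae_eq`). So H(t)(x)
= ⟪G(s,x,·), H(t - s)⟫ is minus the boundary pairing with G(t,x,·). For the Laplace transform the
times are split at ε. The times t > ε contribute exp(-lam ε) S^*(s) R^* G(s,x,·), with s = ε/2,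
whose boundary pairing is -exp(-lam ε) S(ε) u₀(x) (`laplaceTail_properties`). The times t ≤ ε
contribute a boundary derivative O(ε), because x is at positive distance from ∂O and the Gaussian
bounds are bounded off the diagonal. Along a sequence with S(ε) u₀ → u₀ almost everywhere the
formula for u₀ follows. -/

theorem IsOutwardUnitNormal.eventually_mem {z n w : Sp d} (h : IsOutwardUnitNormal O z n)
    (hw : ⟪n, w⟫ < 0) : ∀ᶠ s : ℝ in 𝓝[>] 0, z + s • w ∈ O := by
  have hw0 : 0 < ‖w‖ := by
    rw [norm_pos_iff]; rintro rfl; simp at hw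
  obtain ⟨r, hr, H⟩ := h.2 (-⟪n, w⟫ / (2 * ‖w‖)) (div_pos (by linarith) (by positivity))
  have h1 : ∀ᶠ s : ℝ in 𝓝[>] 0, s < r / ‖w‖ :=
    mem_nhdsWithin_of_mem_nhds (Iio_mem_nhds (by positivity))
  filter_upwards [h1, self_mem_nhdsWithin] with s hs hs0
  have hs0 : 0 < s := hs0
  by_contra hcon
  have hn : ‖s • w‖ = s * ‖w‖ := by rw [norm_smul, Real.norm_of_nonneg hs0.le]
  have := (H (z + s • w) (by
    rw [mem_ball_iff_norm, add_sub_cancel_left, hn]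
    rwa [lt_div_iff₀ hw0] at hs)).2 hcon
  rw [add_sub_cancel_left, hn, inner_smul_right] at this
  have e : -⟪n, w⟫ / (2 * ‖w‖) * (s * ‖w‖) = s * (-⟪n, w⟫ / 2) := by
    field_simp
  rw [e] at this
  nlinarith

/-- If n ≠ n', the direction n' - n has negative inner product with n and positive inner product
with n'. Small steps along it therefore enter O according to n, which contradicts the estimate for
n' at points of O. -/
theorem IsOutwardUnitNormal.unique {z n n' : Sp d} (h : IsOutwardUnitNormal O z n)
    (h' : IsOutwardUnitNormal O z n') : n = n' := by
  by_contra hne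
  have hlt : ⟪n, n'⟫ < 1 := by
    have := (inner_lt_one_iff_real_of_norm_eq_one h.1 h'.1).2 hne
    exact this
  have h1 : ⟪n, n' - n⟫ < 0 := by
    rw [inner_sub_right, real_inner_self_eq_norm_sq, h.1]; linarith
  have h2 : ⟪n', n' - n⟫ > 0 := by
    rw [inner_sub_right, real_inner_self_eq_norm_sq, h'.1, real_inner_comm]; linarith
  have hw0 : 0 < ‖n' - n‖ := by
    rw [norm_pos_iff, sub_ne_zero]; exact fun e => hne e.symm
  obtain ⟨r, hr, H⟩ := h'.2 (⟪n', n' - n⟫ / (2 * ‖n' - n‖)) (by positivity)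
  have hr1 : ∀ᶠ s : ℝ in 𝓝[>] 0, s < r / ‖n' - n‖ :=
    mem_nhdsWithin_of_mem_nhds (Iio_mem_nhds (by positivity))
  obtain ⟨s, ⟨hs, hsr⟩, hs0⟩ :=
    ((h.eventually_mem h1).and hr1 |>.and self_mem_nhdsWithin).exists
  have hs0 : 0 < s := hs0
  have hn : ‖s • (n' - n)‖ = s * ‖n' - n‖ := by rw [norm_smul, Real.norm_of_nonneg hs0.le]
  have := (H (z + s • (n' - n)) (by
    rw [mem_ball_iff_norm, add_sub_cancel_left, hn]
    rwa [lt_div_iff₀ hw0] at hsr)).1 hs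
  rw [add_sub_cancel_left, hn, inner_smul_right] at this
  have e : ⟪n', n' - n⟫ / (2 * ‖n' - n‖) * (s * ‖n' - n‖) = s * (⟪n', n' - n⟫ / 2) := by
    field_simp
  rw [e] at this
  nlinarith

theorem frontier_chart_eq {z ν : Sp d} {r : ℝ} {φ : (ℝ ∙ ν)ᗮ → ℝ}
    (hO : IsOpen O) (hφ : Continuous φ)
    (hgr : ∀ x ∈ Metric.ball z r,
      (x ∈ O ↔ ⟪ν, x - z⟫ < φ ((ℝ ∙ ν)ᗮ.orthogonalProjectionOnto (x - z))))
    {y : Sp d} (hy : y ∈ frontier O) (hyr : y ∈ Metric.ball z r) :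
    ⟪ν, y - z⟫ = φ ((ℝ ∙ ν)ᗮ.orthogonalProjectionOnto (y - z)) := by
  apply le_antisymm
  · have hcl : y ∈ closure (Metric.ball z r ∩ O) :=
      Metric.isOpen_ball.inter_closure ⟨hyr, frontier_subset_closure hy⟩
    have hcont : Continuous fun x : Sp d => ⟪ν, x - z⟫ := by fun_prop
    have hcont' : Continuous fun x : Sp d =>
        φ ((ℝ ∙ ν)ᗮ.orthogonalProjectionOnto (x - z)) := by fun_prop
    have hclosed : IsClosed {x : Sp d |
        ⟪ν, x - z⟫ ≤ φ ((ℝ ∙ ν)ᗮ.orthogonalProjectionOnto (x - z))} :=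
      isClosed_le hcont hcont'
    exact closure_minimal (fun x hx => ((hgr x hx.1).1 hx.2).le) hclosed hcl
  · have hyO : y ∉ O := by
      have := hy.2; rwa [hO.interior_eq] at this
    by_contra! hlt
    exact hyO ((hgr y hyr).2 hlt)

/-- The normal is the normalized gradient of the defining function ⟪ν, x - z⟫ - φ(P(x - z)), which
is negative exactly on O and vanishes on the frontier near z. This gradient has inner product 1 with
ν, hence norm at least 1, so normalizing it does not enlarge the o(‖x - y‖) error. -/
theorem exists_continuousOn_normal {α : ℝ≥0} (hO : IsC1HolderDomain α O) {z : Sp d}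
    (hz : z ∈ frontier O) : ∃ r > 0, ∃ N : Sp d → Sp d, Continuous N ∧
      ∀ y ∈ frontier O ∩ Metric.ball z r, IsOutwardUnitNormal O y (N y) := by
  obtain ⟨ν, r, φ, hν, hr, hφ, -, hgr⟩ := hO.graph z hz
  set P : Sp d →L[ℝ] (ℝ ∙ ν)ᗮ := (ℝ ∙ ν)ᗮ.orthogonalProjectionOnto with hP
  have hPν : P ν = 0 := by
    exact Submodule.orthogonalProjectionOnto_orthogonalComplement_singleton_eq_zero ν
  set ℓ : Sp d → (Sp d →L[ℝ] ℝ) := fun y => innerSL ℝ ν - (fderiv ℝ φ (P (y - z))).comp P with hℓ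
  set M : Sp d → Sp d := fun y => (InnerProductSpace.toDual ℝ (Sp d)).symm (ℓ y) with hM
  have hMinner : ∀ y w, ⟪M y, w⟫ = ⟪ν, w⟫ - fderiv ℝ φ (P (y - z)) (P w) := by
    intro y w
    rw [hM, InnerProductSpace.toDual_symm_apply]
    simp [hℓ]
  have hM1 : ∀ y, 1 ≤ ‖M y‖ := by
    intro y
    have h1 : ⟪M y, ν⟫ = 1 := by
      rw [hMinner, hPν, real_inner_self_eq_norm_sq, hν]; simp
    calc (1 : ℝ) = ⟪M y, ν⟫ := h1.symm
      _ ≤ ‖M y‖ * ‖ν‖ := real_inner_le_norm _ _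
      _ = ‖M y‖ := by rw [hν, mul_one]
  have hMc : Continuous M := by
    have h1 : Continuous (fderiv ℝ φ) := hφ.continuous_fderiv one_ne_zero
    have h2 : Continuous ℓ := by
      refine continuous_const.sub ?_
      exact (h1.comp (P.continuous.comp (by fun_prop))).clm_comp continuous_const
    exact (LinearIsometryEquiv.continuous _).comp h2
  refine ⟨r, hr, fun y => ‖M y‖⁻¹ • M y, ?_, ?_⟩
  · refine Continuous.smul (hMc.norm.inv₀ fun y => ?_) hMc
    have := hM1 y; positivity
  · rintro y ⟨hy, hyr⟩
    have hpos : 0 < ‖M y‖ := lt_of_lt_of_le one_pos (hM1 y)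
    refine ⟨by rw [norm_smul, norm_inv, norm_norm, inv_mul_cancel₀ hpos.ne'], ?_⟩
    intro ε hε
    have hd : HasFDerivAt (fun x : Sp d => ⟪ν, x - z⟫ - φ (P (x - z))) (ℓ y) y := by
      have h1 : HasFDerivAt (fun x : Sp d => ⟪ν, x - z⟫) (innerSL ℝ ν) y := by
        have := ((innerSL ℝ ν).hasFDerivAt (x := y - z)).comp y ((hasFDerivAt_id y).sub_const z)
        exact this
      have h2 : HasFDerivAt (fun x : Sp d => φ (P (x - z)))
          ((fderiv ℝ φ (P (y - z))).comp P) y := by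
        have h3 : HasFDerivAt (fun x : Sp d => P (x - z)) P y := by
          have := (P.hasFDerivAt (x := y - z)).comp y ((hasFDerivAt_id y).sub_const z)
          exact this
        exact ((hφ.differentiable one_ne_zero).differentiableAt.hasFDerivAt).comp y h3
      exact h1.sub h2
    have hlo := hd.isLittleO.def hε
    have h0 : ⟪ν, y - z⟫ - φ (P (y - z)) = 0 := by
      rw [frontier_chart_eq hO.isOpen hφ.continuous hgr hy hyr]; simp [hP]
    obtain ⟨δ, hδ, hball⟩ := Metric.eventually_nhds_iff_ball.1
      (hlo.and (Metric.isOpen_ball.mem_nhds hyr))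
    refine ⟨δ, hδ, fun x hx => ?_⟩
    obtain ⟨h1, hxr⟩ := hball x hx
    have h2 : ℓ y (x - y) = ⟪M y, x - y⟫ := by
      rw [hM, InnerProductSpace.toDual_symm_apply]
    rw [h0, sub_zero, h2, Real.norm_eq_abs] at h1
    have h3 := abs_le.1 h1
    have hinv : ‖M y‖⁻¹ ≤ 1 := inv_le_one_of_one_le₀ (hM1 y)
    have hipos : 0 < ‖M y‖⁻¹ := by positivity
    have hnn : 0 ≤ ε * ‖x - y‖ := by positivity
    rw [inner_smul_left]
    simp only [conj_trivial]
    constructor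
    · intro hxO
      have := (hgr x hxr).1 hxO
      have h4 : ⟪M y, x - y⟫ ≤ ε * ‖x - y‖ := by linarith [h3.1]
      calc ‖M y‖⁻¹ * ⟪M y, x - y⟫ ≤ ‖M y‖⁻¹ * (ε * ‖x - y‖) := by gcongr
        _ ≤ 1 * (ε * ‖x - y‖) := by gcongr
        _ = _ := one_mul _
    · intro hxO
      have h5 : ¬ (⟪ν, x - z⟫ < φ (P (x - z))) := fun h => hxO ((hgr x hxr).2 h)
      have h4 : -(ε * ‖x - y‖) ≤ ⟪M y, x - y⟫ := by linarith [h3.2]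
      calc -(ε * ‖x - y‖) = 1 * -(ε * ‖x - y‖) := (one_mul _).symm
        _ ≤ ‖M y‖⁻¹ * -(ε * ‖x - y‖) := by nlinarith
        _ ≤ ‖M y‖⁻¹ * ⟪M y, x - y⟫ := by gcongr

theorem isOutwardUnitNormal_outwardNormal {α : ℝ≥0} (hO : IsC1HolderDomain α O) {z : Sp d}
    (hz : z ∈ frontier O) : IsOutwardUnitNormal O z (outwardNormal O z) := by
  obtain ⟨r, hr, N, -, hN⟩ := exists_continuousOn_normal hO hz
  exact Classical.epsilon_spec ⟨N z, hN z ⟨hz, Metric.mem_ball_self hr⟩⟩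

theorem continuousOn_outwardNormal {α : ℝ≥0} (hO : IsC1HolderDomain α O) :
    ContinuousOn (outwardNormal O) (frontier O) := by
  intro z hz
  obtain ⟨r, hr, N, hNc, hN⟩ := exists_continuousOn_normal hO hz
  refine (hNc.continuousWithinAt).congr_of_eventuallyEq (s := frontier O) ?_ ?_
  · filter_upwards [inter_mem_nhdsWithin (frontier O) (Metric.ball_mem_nhds z hr)] with y hy
    exact (isOutwardUnitNormal_outwardNormal hO hy.1).unique (hN y hy)
  · exact (isOutwardUnitNormal_outwardNormal hO hz).unique (hN z ⟨hz, Metric.mem_ball_self hr⟩)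

theorem mem_or_mem_frontier (hO : IsOpen O) {y : Sp d} (hy : y ∈ closure O) :
    y ∈ O ∨ y ∈ frontier O := by
  by_cases h : y ∈ O
  · exact Or.inl h
  · exact Or.inr (by rw [hO.frontier_eq]; exact ⟨hy, h⟩)

/-- At a boundary point the tangent cone contains the open half-space of directions w with ⟪n, w⟫ <
0, and a half-space spans. Derivatives within the closure, and so conormal derivatives, are thus
determined by the function. -/
theorem uniqueDiffOn_closure {α : ℝ≥0} (hO : IsC1HolderDomain α O) :
    UniqueDiffOn ℝ (closure O) := by
  intro z hz
  rcases mem_or_mem_frontier hO.isOpen hz with h | h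
  · exact (uniqueDiffWithinAt_of_mem_nhds (hO.isOpen.mem_nhds h)).mono subset_closure
  · have hn := isOutwardUnitNormal_outwardNormal hO h
    set n := outwardNormal O z
    have hcone : ∀ w : Sp d, ⟪n, w⟫ < 0 → w ∈ tangentConeAt ℝ (closure O) z := by
      intro w hw
      refine mem_tangentConeAt_of_add_smul_mem (l := 𝓝[>] (0 : ℝ)) (c := id) ?_ ?_
      · exact tendsto_id.mono_left
          (nhdsWithin_mono _ fun x (hx : 0 < x) => ne_of_gt hx)
      · filter_upwards [hn.eventually_mem hw] with s hs using subset_closure hs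
    refine ⟨?_, subset_closure hz⟩
    have htop : Submodule.span ℝ (tangentConeAt ℝ (closure O) z) = ⊤ := by
      rw [eq_top_iff]
      intro w _
      have hneg : ⟪n, -n⟫ < 0 := by
        rw [inner_neg_right, real_inner_self_eq_norm_sq, hn.1]; norm_num
      -- Subtracting k • n pushes any w into the open half-space, so w is a difference of two
      -- tangent directions.
      set k : ℝ := |⟪n, w⟫| + 1
      have h1 : ⟪n, w + k • (-n)⟫ < 0 := by
        rw [inner_add_right, inner_smul_right, inner_neg_right, real_inner_self_eq_norm_sq, hn.1]
        have := le_abs_self ⟪n, w⟫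
        simp only [k]; linarith
      have : w = (w + k • (-n)) - k • (-n) := by abel
      rw [this]
      exact Submodule.sub_mem _ (Submodule.subset_span (hcone _ h1))
        (Submodule.smul_mem _ _ (Submodule.subset_span (hcone _ hneg)))
    rw [htop]
    exact dense_univ

/-! ### Lipschitz bounds up to the boundary -/

theorem le_on_closure_inter_ball {F : Sp d → ℝ} (hF : ContinuousOn F (closure O)) {z : Sp d}
    {δ K : ℝ}
    (h : ∀ y ∈ O ∩ Metric.ball z δ, ∀ y' ∈ O ∩ Metric.ball z δ, |F y - F y'| ≤ K * ‖y - y'‖) :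
    ∀ y ∈ closure O ∩ Metric.ball z δ, ∀ y' ∈ closure O ∩ Metric.ball z δ,
      |F y - F y'| ≤ K * ‖y - y'‖ := by
  have hcl : ∀ y ∈ closure O ∩ Metric.ball z δ, y ∈ closure (O ∩ Metric.ball z δ) := by
    intro y hy
    rw [inter_comm]
    exact Metric.isOpen_ball.inter_closure ⟨hy.2, hy.1⟩
  have hsub : O ∩ Metric.ball z δ ⊆ closure O := inter_subset_left.trans subset_closure
  have h1 : ∀ y ∈ O ∩ Metric.ball z δ, ∀ y' ∈ closure O ∩ Metric.ball z δ,
      |F y - F y'| ≤ K * ‖y - y'‖ := by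
    intro y hy y' hy'
    refine ContinuousWithinAt.closure_le (f := fun y' => |F y - F y'|)
      (g := fun y' => K * ‖y - y'‖) (hcl y' hy') ?_ ?_ (fun w hw => h y hy w hw)
    · exact ((continuousWithinAt_const.sub ((hF y' hy'.1).mono hsub)).abs)
    · exact Continuous.continuousWithinAt (by fun_prop)
  intro y hy y' hy'
  refine ContinuousWithinAt.closure_le (f := fun y => |F y - F y'|)
    (g := fun y => K * ‖y - y'‖) (hcl y hy) ?_ ?_ (fun w hw => h1 w hw y' hy')
  · exact ((((hF y hy.1).mono hsub).sub continuousWithinAt_const).abs)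
  · exact Continuous.continuousWithinAt (by fun_prop)

/-- The defect is at most 2ab L ‖v - v'‖, and 2ab ≤ 1. This controls how far the chord of a graph
can rise above the graph. -/
theorem _root_.LipschitzOnWith.combo_le {E : Type*} [NormedAddCommGroup E] [NormedSpace ℝ E]
    {φ : E → ℝ} {L : ℝ≥0} {t : Set E} (hL : LipschitzOnWith L φ t) (ht : Convex ℝ t) {v v' : E}
    (hv : v ∈ t) (hv' : v' ∈ t) {a b : ℝ} (ha : 0 ≤ a) (hb : 0 ≤ b) (hab : a + b = 1) :
    a * φ v + b * φ v' ≤ φ (a • v + b • v') + L * ‖v - v'‖ := by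
  have hmid := ht hv hv' ha hb hab
  have l1 := hL.norm_sub_le hv hmid
  have l2 := hL.norm_sub_le hv' hmid
  have ha' : a = 1 - b := by linarith
  have n1 : ‖v - (a • v + b • v')‖ = b * ‖v - v'‖ := by
    have : v - (a • v + b • v') = b • (v - v') := by rw [ha']; module
    rw [this, norm_smul, Real.norm_of_nonneg hb]
  have n2 : ‖v' - (a • v + b • v')‖ = a * ‖v - v'‖ := by
    have : v' - (a • v + b • v') = -(a • (v - v')) := by rw [ha']; module
    rw [this, norm_neg, norm_smul, Real.norm_of_nonneg ha]
  rw [n1, Real.norm_eq_abs] at l1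
  rw [n2, Real.norm_eq_abs] at l2
  have i1 := mul_le_mul_of_nonneg_left ((le_abs_self _).trans l1) ha
  have i2 := mul_le_mul_of_nonneg_left ((le_abs_self _).trans l2) hb
  have h0 : 0 ≤ L * ‖v - v'‖ := by positivity
  have h1 : a * (L * (b * ‖v - v'‖)) + b * (L * (a * ‖v - v'‖)) ≤ L * ‖v - v'‖ := by
    have : 2 * (a * b) ≤ 1 := by rw [ha']; nlinarith [sq_nonneg (b - 1/2)]
    nlinarith
  have hsum : a * φ (a • v + b • v') + b * φ (a • v + b • v') = φ (a • v + b • v') := by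
    rw [← add_mul, hab, one_mul]
  linarith

/-- Near the boundary O need not be convex, so the mean value inequality is applied along a detour.
Both points are lowered by s = L ‖y - y'‖ in the direction -ν, after which the segment joining them
stays below the graph. The detour has length (1 + 2L) ‖y - y'‖. The radius and the constant do not
depend on F, as is needed to dominate a whole family of kernels. -/
theorem exists_lipschitz_of_fderiv_bound {α : ℝ≥0} (hO : IsC1HolderDomain α O) {z : Sp d}
    (hz : z ∈ closure O) {R : ℝ} (hR : 0 < R) :
    ∃ δ > 0, δ ≤ R ∧ ∃ K : ℝ, 0 ≤ K ∧ ∀ F : Sp d → ℝ, ContinuousOn F (closure O) →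
      DifferentiableOn ℝ F O → ∀ B : ℝ, (∀ y ∈ O ∩ Metric.ball z R, ‖fderiv ℝ F y‖ ≤ B) →
      ∀ y ∈ closure O ∩ Metric.ball z δ, ∀ y' ∈ closure O ∩ Metric.ball z δ,
        |F y - F y'| ≤ K * B * ‖y - y'‖ := by
  rcases mem_or_mem_frontier hO.isOpen hz with h | h
  · obtain ⟨r, hr, hrO⟩ := Metric.isOpen_iff.1 hO.isOpen z h
    refine ⟨min r R, by positivity, min_le_right _ _, 1, zero_le_one, fun F hF hFd B hB => ?_⟩
    refine le_on_closure_inter_ball hF fun y hy y' hy' => ?_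
    have hsub : Metric.ball z (min r R) ⊆ O ∩ Metric.ball z R := fun w hw =>
      ⟨hrO (Metric.ball_subset_ball (min_le_left _ _) hw),
        Metric.ball_subset_ball (min_le_right _ _) hw⟩
    have := (convex_ball z (min r R)).norm_image_sub_le_of_norm_fderiv_le (𝕜 := ℝ) (f := F)
      (fun w hw => hFd.differentiableAt (hO.isOpen.mem_nhds (hsub hw).1))
      (fun w hw => hB w (hsub hw)) hy'.2 hy.2
    rwa [one_mul]
  · obtain ⟨ν, r, φ, hν, hr, hφ, -, hgr⟩ := hO.graph z h
    set P : Sp d →L[ℝ] (ℝ ∙ ν)ᗮ := (ℝ ∙ ν)ᗮ.orthogonalProjectionOnto with hP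
    have hPν : P ν = 0 :=
      Submodule.orthogonalProjectionOnto_orthogonalComplement_singleton_eq_zero ν
    have hPle : ∀ w, ‖P w‖ ≤ ‖w‖ := fun w =>
      Submodule.norm_orthogonalProjectionOnto_apply_le _ w
    obtain ⟨L, t, ht, hL⟩ := (hφ.contDiffAt (x := 0)).exists_lipschitzOnWith
    obtain ⟨ρ, hρ, hρt⟩ := Metric.mem_nhds_iff.1 ht
    set m : ℝ := min (min r R) ρ with hm
    have hm0 : 0 < m := by positivity
    have hL0 : (0 : ℝ) ≤ L := L.2
    -- Two points of the ball of radius δ are less than 2δ apart, so the lowering is at most 2Lδ.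
    -- The choice δ + 2Lδ = m keeps the detour in the ball of radius m, where both the chart and the
    -- gradient bound are available.
    refine ⟨m / (1 + 2 * L), by positivity, ?_, 1 + 2 * L, by positivity,
      fun F hF hFd B hB => ?_⟩
    · refine (div_le_self hm0.le (by linarith)).trans ?_
      exact (min_le_left _ _).trans (min_le_right _ _)
    refine le_on_closure_inter_ball hF fun y hy y' hy' => ?_
    have hy1 := mem_ball_iff_norm.1 hy.2
    have hy1' := mem_ball_iff_norm.1 hy'.2
    set δ : ℝ := m / (1 + 2 * L) with hδ
    have hδ0 : 0 < δ := by positivity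
    have hδm : δ + 2 * L * δ = m := by rw [hδ]; field_simp
    have hδm' : δ ≤ m := by nlinarith
    have hyy : ‖y - y'‖ < 2 * δ := by
      calc ‖y - y'‖ = ‖(y - z) - (y' - z)‖ := by congr 1; abel
        _ ≤ ‖y - z‖ + ‖y' - z‖ := norm_sub_le _ _
        _ < 2 * δ := by linarith
    set s : ℝ := L * ‖y - y'‖ with hs
    have hs0 : 0 ≤ s := by positivity
    have hsδ : s ≤ 2 * L * δ := by rw [hs]; nlinarith
    have hball : ∀ w : Sp d, ‖w - z‖ < δ → ∀ a : ℝ, 0 ≤ a → a ≤ s →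
        w - a • ν ∈ Metric.ball z m := by
      intro w hw a ha has
      rw [mem_ball_iff_norm]
      calc ‖w - a • ν - z‖ = ‖(w - z) - a • ν‖ := by congr 1; abel
        _ ≤ ‖w - z‖ + ‖a • ν‖ := norm_sub_le _ _
        _ = ‖w - z‖ + a := by rw [norm_smul, hν, mul_one, Real.norm_of_nonneg ha]
        _ < m := by linarith
    have hmr : Metric.ball z m ⊆ Metric.ball z r :=
      Metric.ball_subset_ball ((min_le_left _ _).trans (min_le_left _ _))
    have hmR : Metric.ball z m ⊆ Metric.ball z R :=
      Metric.ball_subset_ball ((min_le_left _ _).trans (min_le_right _ _))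
    have hseg : ∀ p q : Sp d, segment ℝ p q ⊆ O ∩ Metric.ball z m →
        |F p - F q| ≤ B * ‖p - q‖ := by
      intro p q hpq
      exact (convex_segment p q).norm_image_sub_le_of_norm_fderiv_le (𝕜 := ℝ) (f := F)
        (fun w hw => hFd.differentiableAt (hO.isOpen.mem_nhds (hpq hw).1))
        (fun w hw => hB w ⟨(hpq hw).1, hmR (hpq hw).2⟩) (right_mem_segment ℝ p q)
        (left_mem_segment ℝ p q)
    have hvert : ∀ w ∈ O ∩ Metric.ball z δ,
        segment ℝ w (w - s • ν) ⊆ O ∩ Metric.ball z m := by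
      rintro w ⟨hwO, hwδ⟩ q ⟨a, b, ha, hb, hab, rfl⟩
      have e : a • w + b • (w - s • ν) = w - (b * s) • ν := by
        have : a = 1 - b := by linarith
        rw [this]; module
      rw [e]
      have hq := hball w (mem_ball_iff_norm.1 hwδ) (b * s) (by positivity)
        (by nlinarith)
      refine ⟨(hgr _ (hmr hq)).2 ?_, hq⟩
      have hw := (hgr w (hmr (Metric.ball_subset_ball hδm' hwδ))).1 hwO
      have e2 : w - (b * s) • ν - z = (w - z) - (b * s) • ν := by abel
      rw [e2, map_sub, map_smul]
      change _ < φ (P (w - z) - (b * s) • P ν)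
      rw [hPν, smul_zero, sub_zero, inner_sub_right, inner_smul_right,
        real_inner_self_eq_norm_sq, hν]
      have : 0 ≤ b * s := by positivity
      change _ < φ (P (w - z)) at hw
      linarith
    have hhor : segment ℝ (y - s • ν) (y' - s • ν) ⊆ O ∩ Metric.ball z m := by
      rintro q ⟨a, b, ha, hb, hab, rfl⟩
      have hq : a • (y - s • ν) + b • (y' - s • ν) ∈ Metric.ball z m :=
        convex_ball z m (hball y hy1 s hs0 le_rfl) (hball y' hy1' s hs0 le_rfl) ha hb hab
      refine ⟨(hgr _ (hmr hq)).2 ?_, hq⟩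
      have hw := (hgr y (hmr (Metric.ball_subset_ball hδm' hy.2))).1 hy.1
      have hw' := (hgr y' (hmr (Metric.ball_subset_ball hδm' hy'.2))).1 hy'.1
      change _ < φ (P (y - z)) at hw
      change _ < φ (P (y' - z)) at hw'
      have e : a • (y - s • ν) + b • (y' - s • ν) - z
          = a • (y - z) + b • (y' - z) - s • ν := by
        have : a = 1 - b := by linarith
        rw [this]; module
      rw [e]
      change _ < φ (P _)
      have e3 : P (a • (y - z) + b • (y' - z) - s • ν)
          = a • P (y - z) + b • P (y' - z) := by
        rw [map_sub, map_add, map_smul, map_smul, map_smul, hPν, smul_zero, sub_zero]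
      rw [e3, inner_sub_right, inner_add_right, inner_smul_right, inner_smul_right,
        inner_smul_right, real_inner_self_eq_norm_sq, hν]
      set v := P (y - z)
      set v' := P (y' - z)
      have hv : v ∈ Metric.ball (0 : (ℝ ∙ ν)ᗮ) ρ := by
        rw [mem_ball_zero_iff]
        exact lt_of_le_of_lt (hPle _) (lt_of_lt_of_le hy1 (hδm'.trans (min_le_right _ _)))
      have hv' : v' ∈ Metric.ball (0 : (ℝ ∙ ν)ᗮ) ρ := by
        rw [mem_ball_zero_iff]
        exact lt_of_le_of_lt (hPle _) (lt_of_lt_of_le hy1' (hδm'.trans (min_le_right _ _)))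
      have hvv : ‖v - v'‖ ≤ ‖y - y'‖ := by
        have : v - v' = P (y - y') := by
          simp only [v, v']; rw [← map_sub]; congr 1; abel
        rw [this]; exact hPle _
      have k1 : a * φ v + b * φ v' ≤ φ (a • v + b • v') + s :=
        ((hL.mono hρt).combo_le (convex_ball _ _) hv hv' ha hb hab).trans (by rw [hs]; gcongr)
      have k2 : a * ⟪ν, y - z⟫ + b * ⟪ν, y' - z⟫ < a * φ v + b * φ v' := by
        rcases ha.eq_or_lt with h0 | h0
        · have hb1 : b = 1 := by linarith
          rw [← h0, hb1]; linarith
        · have := mul_lt_mul_of_pos_left hw h0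
          have := mul_le_mul_of_nonneg_left hw'.le hb
          linarith
      linarith
    have s1 := hseg _ _ (hvert y hy)
    have s2 := hseg _ _ hhor
    have s3 := hseg _ _ (hvert y' hy')
    have e1 : ∀ w : Sp d, ‖w - (w - s • ν)‖ = s := by
      intro w
      rw [sub_sub_cancel, norm_smul, hν, mul_one, Real.norm_of_nonneg hs0]
    have e2 : ‖y - s • ν - (y' - s • ν)‖ = ‖y - y'‖ := by rw [sub_sub_sub_cancel_right]
    rw [e1] at s1 s3
    rw [e2] at s2
    calc |F y - F y'| = |(F y - F (y - s • ν)) + (F (y - s • ν) - F (y' - s • ν))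
          - (F y' - F (y' - s • ν))| := by congr 1; ring
      _ ≤ |F y - F (y - s • ν)| + |F (y - s • ν) - F (y' - s • ν)|
          + |F y' - F (y' - s • ν)| := (abs_sub _ _).trans (by gcongr; exact abs_add_le _ _)
      _ ≤ B * s + B * ‖y - y'‖ + B * s := by gcongr
      _ = (1 + 2 * L) * B * ‖y - y'‖ := by rw [hs]; ring

/-! ### The Gaussian density -/

theorem gauss_nonneg (t : ℝ) (ht : 0 ≤ t) (z : Sp d) : 0 ≤ gauss t z := by
  unfold gauss; positivity

theorem gauss_neg (t : ℝ) (z : Sp d) : gauss t (-z) = gauss t z := by simp [gauss]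

theorem gauss_sub_comm (t : ℝ) (x y : Sp d) : gauss t (x - y) = gauss t (y - x) := by
  rw [← gauss_neg, neg_sub]

@[fun_prop]
theorem continuous_gauss (t : ℝ) : Continuous (gauss t : Sp d → ℝ) := by
  unfold gauss; fun_prop

theorem gauss_le (t : ℝ) (ht : 0 < t) (z : Sp d) :
    gauss t z ≤ (2 * Real.pi * t) ^ (-((d : ℝ) / 2)) := by
  unfold gauss
  refine mul_le_of_le_one_right (by positivity) ?_
  rw [Real.exp_le_one_iff]
  have : 0 ≤ ‖z‖ ^ 2 / (2 * t) := by positivity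
  linarith

theorem integral_exp_neg_norm_sq {V : Type*} [NormedAddCommGroup V] [InnerProductSpace ℝ V]
    [FiniteDimensional ℝ V] [MeasurableSpace V] [BorelSpace V] {t : ℝ} (ht : 0 < t) :
    ∫ v : V, Real.exp (-(‖v‖ ^ 2 / (2 * t))) =
      (2 * Real.pi * t) ^ ((Module.finrank ℝ V : ℝ) / 2) := by
  have h := GaussianFourier.integral_rexp_neg_mul_sq_norm (V := V) (b := 1 / (2 * t))
    (by positivity)
  have e : Real.pi / (1 / (2 * t)) = 2 * Real.pi * t := by field_simp
  rw [e] at h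
  rw [← h]
  congr 1; ext v; congr 1; field_simp

theorem integrable_exp_neg_norm_sq {V : Type*} [NormedAddCommGroup V] [InnerProductSpace ℝ V]
    [FiniteDimensional ℝ V] [MeasurableSpace V] [BorelSpace V] {t : ℝ} (ht : 0 < t) :
    Integrable fun v : V => Real.exp (-(‖v‖ ^ 2 / (2 * t))) := by
  -- A nonintegrable function has integral 0 by convention, whereas the computed value is positive.
  by_contra h
  have h1 := integral_exp_neg_norm_sq (V := V) ht
  rw [integral_undef h] at h1
  have : 0 < (2 * Real.pi * t) ^ ((Module.finrank ℝ V : ℝ) / 2) := by positivity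
  linarith

theorem integrable_gauss {t : ℝ} (ht : 0 < t) : Integrable (gauss t : Sp d → ℝ) := by
  unfold gauss
  exact (integrable_exp_neg_norm_sq ht).const_mul _

theorem integral_gauss {t : ℝ} (ht : 0 < t) : ∫ z : Sp d, gauss t z = 1 := by
  unfold gauss
  rw [integral_const_mul, integral_exp_neg_norm_sq ht, finrank_euclideanSpace_fin,
    ← Real.rpow_add (by positivity)]
  simp

theorem integrable_gauss_sub {t : ℝ} (ht : 0 < t) (y : Sp d) :
    Integrable (fun x => gauss t (x - y)) := (integrable_gauss ht).comp_sub_right y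

theorem integral_gauss_sub {t : ℝ} (ht : 0 < t) (y : Sp d) : ∫ x, gauss t (x - y) = 1 := by
  rw [integral_sub_right_eq_self (fun x => gauss t x), integral_gauss ht]

theorem lintegral_gauss_sub {t : ℝ} (ht : 0 < t) (y : Sp d) :
    ∫⁻ x, ENNReal.ofReal (gauss t (x - y)) = 1 := by
  rw [← ofReal_integral_eq_lintegral_ofReal (integrable_gauss_sub ht y)
    (Eventually.of_forall fun x => gauss_nonneg t ht.le _), integral_gauss_sub ht, ENNReal.ofReal_one]

theorem memLp_gauss_sub {t : ℝ} (ht : 0 < t) (y : Sp d) :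
    MemLp (fun x => gauss t (x - y)) 2 (volume.restrict O) := by
  refine MemLp.restrict O ?_
  refine (memLp_two_iff_integrable_sq (by fun_prop)).2 ?_
  refine ((integrable_gauss_sub ht y).const_mul
    ((2 * Real.pi * t) ^ (-((d : ℝ) / 2)))).mono' (by fun_prop)
    (Eventually.of_forall fun x => ?_)
  have := gauss_nonneg t ht.le (x - y)
  rw [Real.norm_of_nonneg (by positivity), sq]
  exact mul_le_mul_of_nonneg_right (gauss_le t ht _) this

/-- The Gaussian density at nearby points is dominated by a wider Gaussian density. -/
theorem gauss_le_gauss_two_mul {t : ℝ} (ht : 0 < t) {ε : ℝ} :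
    ∃ C : ℝ, 0 < C ∧ ∀ x y y' : Sp d, ‖y - y'‖ ≤ ε →
      gauss t (x - y') ≤ C * gauss (2 * t) (x - y) := by
  refine ⟨(2 * Real.pi * t) ^ (-((d : ℝ) / 2)) / (2 * Real.pi * (2 * t)) ^ (-((d : ℝ) / 2))
    * Real.exp (ε ^ 2 / (2 * t)), by positivity, fun x y y' h => ?_⟩
  unfold gauss
  have h1 : ‖x - y‖ ^ 2 ≤ 2 * ‖x - y'‖ ^ 2 + 2 * ε ^ 2 := by
    have h2 : ‖x - y‖ ≤ ‖x - y'‖ + ε := by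
      calc ‖x - y‖ = ‖(x - y') - (y - y')‖ := by congr 1; abel
        _ ≤ ‖x - y'‖ + ‖y - y'‖ := norm_sub_le _ _
        _ ≤ _ := by gcongr
    have h3 := norm_nonneg (x - y)
    nlinarith [sq_nonneg (‖x - y'‖ - ε)]
  have h4 : Real.exp (-(‖x - y'‖ ^ 2 / (2 * t)))
      ≤ Real.exp (ε ^ 2 / (2 * t)) * Real.exp (-(‖x - y‖ ^ 2 / (2 * (2 * t)))) := by
    rw [← Real.exp_add]
    apply Real.exp_le_exp.2
    have : ‖x - y‖ ^ 2 / (2 * (2 * t)) ≤ (2 * ‖x - y'‖ ^ 2 + 2 * ε ^ 2) / (2 * (2 * t)) := by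
      gcongr
    have e : (2 * ‖x - y'‖ ^ 2 + 2 * ε ^ 2) / (2 * (2 * t))
        = ‖x - y'‖ ^ 2 / (2 * t) + ε ^ 2 / (2 * t) := by field_simp
    linarith
  have h5 : 0 < (2 * Real.pi * (2 * t)) ^ (-((d : ℝ) / 2)) := by positivity
  calc (2 * Real.pi * t) ^ (-((d : ℝ) / 2)) * Real.exp (-(‖x - y'‖ ^ 2 / (2 * t)))
      ≤ (2 * Real.pi * t) ^ (-((d : ℝ) / 2)) * (Real.exp (ε ^ 2 / (2 * t))
        * Real.exp (-(‖x - y‖ ^ 2 / (2 * (2 * t))))) := by gcongr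
    _ = _ := by field_simp

/-- Away from the origin the Gaussian density stays bounded as `t → 0`, even after division
by `√t`. -/
theorem gauss_div_sqrt_le {c ρ : ℝ} (hc : 0 < c) (hρ : 0 < ρ) :
    ∃ C : ℝ, 0 < C ∧ ∀ t : ℝ, 0 < t → t ≤ 1 → ∀ z : Sp d, ρ ≤ ‖z‖ →
      gauss (c * t) z / Real.sqrt t ≤ C := by
  -- The inequality exp(-u) ≤ n! / u^n gains a factor t^n. With n = d + 1 it absorbs both t^(-d/2)
  -- and t^(-1/2).
  set n : ℕ := d + 1
  refine ⟨(2 * Real.pi * c) ^ (-((d : ℝ) / 2)) * (n.factorial * (2 * c / ρ ^ 2) ^ n),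
    by positivity, fun t ht ht1 z hz => ?_⟩
  unfold gauss
  set u : ℝ := ‖z‖ ^ 2 / (2 * (c * t)) with hu
  have hu0 : 0 < u := by
    have : 0 < ‖z‖ := lt_of_lt_of_le hρ hz
    positivity
  have h1 : Real.exp (-u) ≤ n.factorial * (1 / u) ^ n := by
    rw [Real.exp_neg]
    have := Real.pow_div_factorial_le_exp u hu0.le n
    calc (Real.exp u)⁻¹ ≤ (u ^ n / n.factorial)⁻¹ := by gcongr
      _ = _ := by rw [inv_div, div_eq_mul_inv, one_div, inv_pow]
  have h2 : 1 / u ≤ 2 * c / ρ ^ 2 * t := by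
    rw [hu, one_div_div, div_mul_eq_mul_div, mul_assoc]
    gcongr
  have h3 : Real.exp (-u) ≤ n.factorial * ((2 * c / ρ ^ 2) ^ n * t ^ n) := by
    refine h1.trans ?_
    rw [← mul_pow]
    gcongr
  have h4 : (2 * Real.pi * (c * t)) ^ (-((d : ℝ) / 2))
      = (2 * Real.pi * c) ^ (-((d : ℝ) / 2)) * t ^ (-((d : ℝ) / 2)) := by
    rw [← mul_assoc, Real.mul_rpow (by positivity) ht.le]
  have h5 : t ^ (-((d : ℝ) / 2)) * t ^ n / Real.sqrt t ≤ 1 := by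
    rw [Real.sqrt_eq_rpow, ← Real.rpow_natCast t n, ← Real.rpow_add ht, ← Real.rpow_sub ht]
    refine Real.rpow_le_one ht.le ht1 ?_
    simp only [n]; push_cast
    have : (0 : ℝ) ≤ d := by positivity
    linarith
  calc (2 * Real.pi * (c * t)) ^ (-((d : ℝ) / 2)) * Real.exp (-u) / Real.sqrt t
      ≤ (2 * Real.pi * (c * t)) ^ (-((d : ℝ) / 2))
        * (n.factorial * ((2 * c / ρ ^ 2) ^ n * t ^ n)) / Real.sqrt t := by gcongr
    _ = (2 * Real.pi * c) ^ (-((d : ℝ) / 2)) * (n.factorial * (2 * c / ρ ^ 2) ^ n)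
        * (t ^ (-((d : ℝ) / 2)) * t ^ n / Real.sqrt t) := by rw [h4]; ring
    _ ≤ _ := mul_le_of_le_one_right (by positivity) h5

/-! ### The surface measure -/

theorem euclideanHausdorffMeasure_image_le {X Y : Type*} [EMetricSpace X] [MeasurableSpace X]
    [BorelSpace X] [EMetricSpace Y] [MeasurableSpace Y] [BorelSpace Y] {K : ℝ≥0} {f : X → Y}
    {s : Set X} (h : LipschitzOnWith K f s) (n : ℕ) :
    (Measure.euclideanHausdorffMeasure n : Measure Y) (f '' s)
      ≤ (K : ℝ≥0∞) ^ n * (Measure.euclideanHausdorffMeasure n : Measure X) s := by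
  simp_rw [Measure.euclideanHausdorffMeasure_def, Measure.smul_apply]
  rw [ENNReal.smul_def, smul_eq_mul, ENNReal.smul_def, smul_eq_mul, mul_left_comm]
  gcongr
  simpa using h.hausdorffMeasure_image_le (d := (n : ℝ)) (by positivity)

/-- Near a boundary point, the projection of the surface measure along the vertical direction is
bounded by Lebesgue measure. -/
theorem exists_map_surfaceMeasure_le {α : ℝ≥0} (hO : IsC1HolderDomain α O) {z : Sp d}
    (hz : z ∈ frontier O) : ∃ (ν : Sp d) (δ ρ : ℝ) (C : ℝ≥0), ‖ν‖ = 1 ∧ 0 < δ ∧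
      ((surfaceMeasure O).restrict (Metric.ball z δ)).map
        (fun y => (ℝ ∙ ν)ᗮ.orthogonalProjectionOnto (y - z)) ≤
      C • (volume : Measure (ℝ ∙ ν)ᗮ).restrict (Metric.ball 0 ρ) := by
  obtain ⟨ν, r, φ, hν, hr, hφ, -, hgr⟩ := hO.graph z hz
  set P : Sp d →L[ℝ] (ℝ ∙ ν)ᗮ := (ℝ ∙ ν)ᗮ.orthogonalProjectionOnto with hP
  have hPle : ∀ w, ‖P w‖ ≤ ‖w‖ := fun w =>
    Submodule.norm_orthogonalProjectionOnto_apply_le _ w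
  obtain ⟨L, t, ht, hL⟩ := (hφ.contDiffAt (x := 0)).exists_lipschitzOnWith
  obtain ⟨ρ, hρ, hρt⟩ := Metric.mem_nhds_iff.1 ht
  have hd : Module.finrank ℝ (ℝ ∙ ν)ᗮ = d - 1 := by
    have hd0 : 0 < d := by
      rcases Nat.eq_zero_or_pos d with h | h
      · subst h
        have : ν = 0 := Subsingleton.elim _ _
        rw [this] at hν; simp at hν
      · exact h
    have : Fact (Module.finrank ℝ (Sp d) = (d - 1) + 1) := ⟨by simp; omega⟩
    exact Submodule.finrank_orthogonal_span_singleton (by rintro rfl; simp at hν)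
  have hvol : (Measure.euclideanHausdorffMeasure (d - 1) : Measure (ℝ ∙ ν)ᗮ) = volume := by
    rw [← hd, InnerProductSpace.euclideanHausdorffMeasure_eq_volume]
  -- The frontier near z lies in the image of a ball of the hyperplane under the graph map, which is
  -- Lipschitz with constant 1 + L. The surface measure is thus at most (1 + L)^(d-1) times Lebesgue
  -- measure on the hyperplane.
  set Γ : (ℝ ∙ ν)ᗮ → Sp d := fun w => z + (w : Sp d) + φ w • ν with hΓ
  have hΓL : LipschitzOnWith (1 + L) Γ (Metric.ball 0 ρ) := by
    refine LipschitzOnWith.of_dist_le_mul fun w hw w' hw' => ?_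
    rw [dist_eq_norm, dist_eq_norm]
    have e : Γ w - Γ w' = ((w - w' : (ℝ ∙ ν)ᗮ) : Sp d) + (φ w - φ w') • ν := by
      simp only [hΓ, Submodule.coe_sub]; module
    rw [e]
    refine (norm_add_le _ _).trans ?_
    rw [norm_smul, hν, mul_one, Submodule.coe_norm, NNReal.coe_add, NNReal.coe_one, add_mul,
      one_mul]
    gcongr
    exact hL.norm_sub_le (hρt hw) (hρt hw')
  have hmeasP : Measurable fun y : Sp d => P (y - z) := by fun_prop
  refine ⟨ν, min r ρ, ρ, (1 + L) ^ (d - 1), hν, by positivity, ?_⟩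
  rw [Measure.le_iff]
  intro A hA
  rw [Measure.map_apply hmeasP hA, Measure.restrict_apply (hmeasP hA), surfaceMeasure,
    Measure.restrict_apply ((hmeasP hA).inter measurableSet_ball), Measure.smul_apply,
    Measure.restrict_apply hA, ENNReal.smul_def, smul_eq_mul]
  have hsub : (fun y : Sp d => P (y - z)) ⁻¹' A ∩ Metric.ball z (min r ρ) ∩ frontier O
      ⊆ Γ '' (A ∩ Metric.ball 0 ρ) := by
    rintro y ⟨⟨hyA, hyb⟩, hyO⟩
    have hyr : y ∈ Metric.ball z r := Metric.ball_subset_ball (min_le_left _ _) hyb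
    have hyρ := Metric.ball_subset_ball (min_le_right _ _) hyb
    refine ⟨P (y - z), ⟨hyA, ?_⟩, ?_⟩
    · rw [mem_ball_zero_iff]
      exact lt_of_le_of_lt (hPle _) (mem_ball_iff_norm.1 hyρ)
    · have h1 := frontier_chart_eq hO.isOpen hφ.continuous hgr hyO hyr
      simp only [hΓ]
      rw [← h1]
      have h2 : ((P (y - z) : (ℝ ∙ ν)ᗮ) : Sp d) = (y - z) - ⟪ν, y - z⟫ • ν := by
        have h3 := Submodule.starProjection_add_starProjection_orthogonal (y - z) (K := ℝ ∙ ν)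
        rw [Submodule.starProjection_unit_singleton ℝ hν] at h3
        rw [eq_sub_iff_add_eq, add_comm]
        exact h3
      rw [h2]; abel
  calc _ ≤ (Measure.euclideanHausdorffMeasure (d - 1) : Measure (Sp d))
        (Γ '' (A ∩ Metric.ball 0 ρ)) := measure_mono hsub
    _ ≤ _ := by
      refine (euclideanHausdorffMeasure_image_le (hΓL.mono inter_subset_right) (d - 1)).trans ?_
      rw [hvol]; push_cast; rfl

theorem isLocallyFiniteMeasure_surfaceMeasure {α : ℝ≥0} (hO : IsC1HolderDomain α O) :
    IsLocallyFiniteMeasure (surfaceMeasure O) := by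
  refine ⟨fun z => ?_⟩
  by_cases hz : z ∈ frontier O
  · obtain ⟨ν, δ, ρ, C, hν, hδ, hle⟩ := exists_map_surfaceMeasure_le hO hz
    refine ⟨Metric.ball z δ, Metric.ball_mem_nhds z hδ, ?_⟩
    have h := hle univ
    rw [Measure.map_apply (by fun_prop) MeasurableSet.univ, preimage_univ,
      Measure.restrict_apply_univ, Measure.smul_apply, Measure.restrict_apply_univ] at h
    refine lt_of_le_of_lt h ?_
    rw [ENNReal.smul_def, smul_eq_mul]
    exact ENNReal.mul_lt_top ENNReal.coe_lt_top measure_ball_lt_top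
  · refine ⟨(frontier O)ᶜ, isClosed_frontier.isOpen_compl.mem_nhds hz, ?_⟩
    rw [surfaceMeasure, Measure.restrict_apply isClosed_frontier.measurableSet.compl]
    simp

/-- Gaussian densities have integrals of order `t ^ (-1/2)` over compact parts of the boundary. -/
theorem exists_lintegral_gauss_surfaceMeasure_le {α : ℝ≥0} (hO : IsC1HolderDomain α O)
    {K : Set (Sp d)} (hK : IsCompact K) : ∃ C : ℝ≥0, ∀ t : ℝ, 0 < t → ∀ x : Sp d,
      ∫⁻ y in K, ENNReal.ofReal (gauss t (x - y)) ∂(surfaceMeasure O)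
        ≤ C * ENNReal.ofReal ((2 * Real.pi * t) ^ (-(1 / 2 : ℝ))) := by
  refine hK.induction_on (p := fun K => ∃ C : ℝ≥0, ∀ t : ℝ, 0 < t → ∀ x : Sp d,
      ∫⁻ y in K, ENNReal.ofReal (gauss t (x - y)) ∂(surfaceMeasure O)
        ≤ C * ENNReal.ofReal ((2 * Real.pi * t) ^ (-(1 / 2 : ℝ)))) ?_ ?_ ?_ ?_
  · exact ⟨0, fun t ht x => by simp⟩
  · rintro s s' hss ⟨C, hC⟩
    exact ⟨C, fun t ht x => (lintegral_mono_set hss).trans (hC t ht x)⟩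
  · rintro s s' ⟨C, hC⟩ ⟨C', hC'⟩
    refine ⟨C + C', fun t ht x => (lintegral_union_le _ _ _).trans ?_⟩
    rw [ENNReal.coe_add, add_mul]
    exact add_le_add (hC t ht x) (hC' t ht x)
  · intro z _
    by_cases hz : z ∈ frontier O
    · obtain ⟨ν, δ, ρ, C, hν, hδ, hle⟩ := exists_map_surfaceMeasure_le hO hz
      refine ⟨Metric.ball z δ, mem_nhdsWithin_of_mem_nhds (Metric.ball_mem_nhds z hδ), C,
        fun t ht x => ?_⟩
      set P : Sp d →L[ℝ] (ℝ ∙ ν)ᗮ := (ℝ ∙ ν)ᗮ.orthogonalProjectionOnto with hP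
      have hd : (d : ℝ) = Module.finrank ℝ (ℝ ∙ ν)ᗮ + 1 := by
        have hd0 : 0 < d := by
          rcases Nat.eq_zero_or_pos d with h | h
          · subst h
            have : ν = 0 := Subsingleton.elim _ _
            rw [this] at hν; simp at hν
          · exact h
        have : Fact (Module.finrank ℝ (Sp d) = (d - 1) + 1) := ⟨by simp; omega⟩
        rw [Submodule.finrank_orthogonal_span_singleton (n := d - 1) (by rintro rfl; simp at hν)]
        rw [Nat.cast_sub hd0]; simp
      -- Replacing x - y by its component orthogonal to ν only increases the Gaussian. Integrating
      -- the result over d - 1 dimensions produces t^((d-1)/2) against the normalization t^(-d/2),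
      -- which leaves t^(-1/2).
      set h : (ℝ ∙ ν)ᗮ → ℝ≥0∞ := fun w => ENNReal.ofReal
        ((2 * Real.pi * t) ^ (-((d : ℝ) / 2))
          * Real.exp (-(‖w - P (x - z)‖ ^ 2 / (2 * t)))) with hh
      have hmeas : Measurable h := by fun_prop
      have hpt : ∀ y : Sp d, ENNReal.ofReal (gauss t (x - y)) ≤ h (P (y - z)) := by
        intro y
        simp only [hh, gauss]
        gcongr
        have : P (y - z) - P (x - z) = -P (x - y) := by
          rw [← map_sub, ← map_neg]; congr 1; abel
        rw [this, norm_neg]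
        exact Submodule.norm_orthogonalProjectionOnto_apply_le _ _
      have hint : ∫⁻ w, h w = ENNReal.ofReal ((2 * Real.pi * t) ^ (-(1 / 2 : ℝ))) := by
        have h1 : Integrable fun w : (ℝ ∙ ν)ᗮ => (2 * Real.pi * t) ^ (-((d : ℝ) / 2))
            * Real.exp (-(‖w - P (x - z)‖ ^ 2 / (2 * t))) :=
          ((integrable_exp_neg_norm_sq ht).comp_sub_right (P (x - z))).const_mul _
        rw [hh, ← ofReal_integral_eq_lintegral_ofReal h1
          (Eventually.of_forall fun w => by positivity), integral_const_mul,
          integral_sub_right_eq_self (fun w : (ℝ ∙ ν)ᗮ => Real.exp (-(‖w‖ ^ 2 / (2 * t)))),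
          integral_exp_neg_norm_sq ht, ← Real.rpow_add (by positivity)]
        congr 2
        rw [hd]; ring
      calc ∫⁻ y in Metric.ball z δ, ENNReal.ofReal (gauss t (x - y)) ∂(surfaceMeasure O)
          ≤ ∫⁻ y in Metric.ball z δ, h (P (y - z)) ∂(surfaceMeasure O) :=
            lintegral_mono fun y => hpt y
        _ = ∫⁻ w, h w ∂(((surfaceMeasure O).restrict (Metric.ball z δ)).map
              (fun y => P (y - z))) := by
            rw [lintegral_map hmeas (by fun_prop)]
        _ ≤ ∫⁻ w, h w ∂(C • (volume : Measure (ℝ ∙ ν)ᗮ).restrict (Metric.ball 0 ρ)) :=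
            lintegral_mono' hle le_rfl
        _ = C * ∫⁻ w in Metric.ball 0 ρ, h w := by
            rw [lintegral_smul_measure, ENNReal.smul_def, smul_eq_mul]
        _ ≤ C * ∫⁻ w, h w := by gcongr; exact Measure.restrict_le_self
        _ = _ := by rw [hint]
    · refine ⟨(frontier O)ᶜ, mem_nhdsWithin_of_mem_nhds
        (isClosed_frontier.isOpen_compl.mem_nhds hz), 0, fun t ht x => ?_⟩
      rw [surfaceMeasure, Measure.restrict_restrict isClosed_frontier.measurableSet.compl]
      simp

/-! ### Differentiation of parametric integrals within a set -/

section Parametric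

variable {X : Type*} [MeasurableSpace X] {ν : Measure X} {s : Set (Sp d)} {z : Sp d}
  {F : X → Sp d → ℝ}

/-- Along a tangent direction the derivative is a limit of difference quotients taken at points of s
that do not depend on the parameter, hence is measurable. Tangent directions span the space, and the
derivative is linear in the direction. -/
theorem aestronglyMeasurable_fderivWithin {F' : X → Sp d →L[ℝ] ℝ} (hs : UniqueDiffWithinAt ℝ s z)
    (hz : z ∈ s) (hF : ∀ y ∈ s, AEStronglyMeasurable (fun x => F x y) ν)
    (hF' : ∀ᵐ x ∂ν, HasFDerivWithinAt (F x) (F' x) s z) : AEStronglyMeasurable F' ν := by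
  have hcone : ∀ w ∈ tangentConeAt ℝ s z, AEStronglyMeasurable (fun x => F' x w) ν := by
    intro w hw
    obtain ⟨c, e, he, hes, hce⟩ := mem_tangentConeAt_iff_exists_seq.1 hw
    obtain ⟨N, hN⟩ := eventually_atTop.1 hes
    refine aestronglyMeasurable_of_tendsto_ae atTop
      (f := fun n x => c (n + N) • (F x (z + e (n + N)) - F x z)) (fun n => ?_) ?_
    · exact ((hF _ (hN _ (Nat.le_add_left _ _))).sub (hF z hz)).const_smul (c (n + N))
    · filter_upwards [hF'] with x hx
      have := HasFDerivWithinAt.lim hx he hes hce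
      exact (tendsto_add_atTop_iff_nat N).2 this
  let V : Submodule ℝ (Sp d) :=
    { carrier := {w | AEStronglyMeasurable (fun x => F' x w) ν}
      add_mem' := fun {a b} ha hb => by
        have ha : AEStronglyMeasurable (fun x => F' x a) ν := ha
        have hb : AEStronglyMeasurable (fun x => F' x b) ν := hb
        change AEStronglyMeasurable (fun x => F' x (a + b)) ν
        simp only [map_add]
        exact ha.add hb
      zero_mem' := by
        change AEStronglyMeasurable (fun x => F' x 0) ν
        simp only [map_zero]
        exact aestronglyMeasurable_const
      smul_mem' := fun c a ha => by
        have ha : AEStronglyMeasurable (fun x => F' x a) ν := ha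
        change AEStronglyMeasurable (fun x => F' x (c • a)) ν
        simp only [map_smul]
        exact ha.const_smul c }
  have hV : ∀ w, AEStronglyMeasurable (fun x => F' x w) ν := by
    have h1 : Submodule.span ℝ (tangentConeAt ℝ s z) ≤ V := Submodule.span_le.2 hcone
    have h2 : Submodule.span ℝ (tangentConeAt ℝ s z) = ⊤ := by
      have := hs.dense_tangentConeAt.closure_eq
      rw [(Submodule.closed_of_finiteDimensional _).closure_eq] at this
      exact SetLike.coe_injective this
    intro w
    exact h1 (h2 ▸ Submodule.mem_top)
  have e : F' = fun x => ∑ i, F' x (EuclideanSpace.single i 1) •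
      (EuclideanSpace.proj i : Sp d →L[ℝ] ℝ) := by
    ext x w
    conv_lhs => rw [← (EuclideanSpace.basisFun (Fin d) ℝ).sum_repr w]
    simp [map_sum, mul_comm]
  rw [e]
  exact Finset.aestronglyMeasurable_fun_sum _ fun i _ => (hV _).smul_const _

/-- Dominated convergence applies to the remainder divided by ‖y - z‖. The increments are dominated
by an assumed Lipschitz bound and not by one on the derivative, since s need not be convex. -/
theorem hasFDerivWithinAt_integral {F' : X → Sp d →L[ℝ] ℝ} (hs : UniqueDiffWithinAt ℝ s z)
    (hz : z ∈ s) (hF : ∀ y ∈ s, AEStronglyMeasurable (fun x => F x y) ν)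
    (hFz : Integrable (fun x => F x z) ν)
    (hF' : ∀ᵐ x ∂ν, HasFDerivWithinAt (F x) (F' x) s z)
    {b : X → ℝ} (hb : Integrable b ν) (hb' : ∀ᵐ x ∂ν, ‖F' x‖ ≤ b x) {δ : ℝ} (hδ : 0 < δ)
    (hlip : ∀ᵐ x ∂ν, ∀ y ∈ s ∩ Metric.ball z δ, |F x y - F x z| ≤ b x * ‖y - z‖) :
    Integrable F' ν ∧ HasFDerivWithinAt (fun y => ∫ x, F x y ∂ν) (∫ x, F' x ∂ν) s z := by
  have hm := aestronglyMeasurable_fderivWithin hs hz hF hF'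
  have hI : Integrable F' ν := hb.mono' hm hb'
  refine ⟨hI, ?_⟩
  rw [hasFDerivWithinAt_iff_tendsto]
  have hFy : ∀ y ∈ s ∩ Metric.ball z δ, Integrable (fun x => F x y) ν := by
    intro y hy
    have h1 : Integrable (fun x => F x y - F x z) ν := by
      refine (hb.mul_const ‖y - z‖).mono' ((hF y hy.1).sub hFz.1) ?_
      filter_upwards [hlip] with x hx using hx y hy
    exact (h1.add hFz).congr (Eventually.of_forall fun x => by simp)
  have hnear : ∀ᶠ y in 𝓝[s] z, y ∈ s ∩ Metric.ball z δ :=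
    inter_mem_nhdsWithin s (Metric.ball_mem_nhds z hδ)
  have hlim : Tendsto (fun y => ∫ x, ‖y - z‖⁻¹ * ‖F x y - F x z - F' x (y - z)‖ ∂ν)
      (𝓝[s] z) (𝓝 (∫ _, (0 : ℝ) ∂ν)) := by
    refine tendsto_integral_filter_of_dominated_convergence (fun x => 2 * b x) ?_ ?_
      (hb.const_mul 2) ?_
    · filter_upwards [hnear] with y hy
      exact (((((hF y hy.1).sub hFz.1)).sub (hm.apply_continuousLinearMap _)).norm).const_mul _
    · filter_upwards [hnear] with y hy
      filter_upwards [hlip, hb'] with x hx hx'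
      rw [Real.norm_of_nonneg (by positivity)]
      have h1 : ‖F x y - F x z - F' x (y - z)‖ ≤ 2 * b x * ‖y - z‖ := by
        calc _ ≤ ‖F x y - F x z‖ + ‖F' x (y - z)‖ := norm_sub_le _ _
          _ ≤ b x * ‖y - z‖ + b x * ‖y - z‖ :=
            add_le_add (hx y hy) ((F' x).le_of_opNorm_le hx' _)
          _ = _ := by ring
      rcases (norm_nonneg (y - z)).eq_or_lt with h0 | h0
      · rw [← h0, inv_zero, zero_mul]
        linarith [(norm_nonneg _).trans hx']
      · rw [inv_mul_le_iff₀ h0]; linarith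
    · filter_upwards [hF'] with x hx
      exact hasFDerivWithinAt_iff_tendsto.1 hx
  rw [integral_zero] at hlim
  refine squeeze_zero' (Eventually.of_forall fun y => by positivity) ?_ hlim
  filter_upwards [hnear] with y hy
  have e : ∫ x, F x y ∂ν - ∫ x, F x z ∂ν - (∫ x, F' x ∂ν) (y - z)
      = ∫ x, (F x y - F x z - F' x (y - z)) ∂ν := by
    rw [integral_sub, integral_sub (hFy y hy) hFz, ContinuousLinearMap.integral_apply hI]
    · exact (hFy y hy).sub hFz
    · exact hI.apply_continuousLinearMap _
  rw [e, integral_const_mul]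
  gcongr
  exact norm_integral_le_integral_norm _

theorem contDiffOn_integral (hs : UniqueDiffOn ℝ s)
    (hF : ∀ y ∈ s, Integrable (fun x => F x y) ν)
    (hF1 : ∀ᵐ x ∂ν, ContDiffOn ℝ 1 (F x) s)
    (hb : ∀ z ∈ s, ∃ δ > 0, ∃ b : X → ℝ, Integrable b ν ∧ ∀ᵐ x ∂ν,
      (∀ y ∈ s ∩ Metric.ball z δ, ‖fderivWithin ℝ (F x) s y‖ ≤ b x) ∧
      ∀ y ∈ s ∩ Metric.ball z δ, |F x y - F x z| ≤ b x * ‖y - z‖) :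
    ContDiffOn ℝ 1 (fun y => ∫ x, F x y ∂ν) s ∧
    ∀ z ∈ s, Integrable (fun x => fderivWithin ℝ (F x) s z) ν ∧
      fderivWithin ℝ (fun y => ∫ x, F x y ∂ν) s z = ∫ x, fderivWithin ℝ (F x) s z ∂ν := by
  have key : ∀ z ∈ s, Integrable (fun x => fderivWithin ℝ (F x) s z) ν ∧
      HasFDerivWithinAt (fun y => ∫ x, F x y ∂ν) (∫ x, fderivWithin ℝ (F x) s z ∂ν) s z := by
    intro z hz
    obtain ⟨δ, hδ, b, hbi, h⟩ := hb z hz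
    refine hasFDerivWithinAt_integral (hs z hz) hz (fun y hy => (hF y hy).1) (hF z hz) ?_ hbi ?_ hδ
      (h.mono fun x hx => hx.2)
    · filter_upwards [hF1] with x hx
      exact ((hx.differentiableOn one_ne_zero) z hz).hasFDerivWithinAt
    · filter_upwards [h] with x hx using hx.1 z ⟨hz, Metric.mem_ball_self hδ⟩
  have hfd : ∀ z ∈ s, fderivWithin ℝ (fun y => ∫ x, F x y ∂ν) s z
      = ∫ x, fderivWithin ℝ (F x) s z ∂ν := fun z hz => (key z hz).2.fderivWithin (hs z hz)
  refine ⟨?_, fun z hz => ⟨(key z hz).1, hfd z hz⟩⟩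
  rw [show (1 : WithTop ℕ∞) = 0 + 1 from (zero_add 1).symm, contDiffOn_succ_iff_fderivWithin hs]
  refine ⟨fun z hz => (key z hz).2.differentiableWithinAt, by simp, contDiffOn_zero.2 ?_⟩
  refine ContinuousOn.congr (f := fun z => ∫ x, fderivWithin ℝ (F x) s z ∂ν) ?_ hfd
  intro z hz
  obtain ⟨δ, hδ, b, hbi, h⟩ := hb z hz
  have hnear : ∀ᶠ y in 𝓝[s] z, y ∈ s ∩ Metric.ball z δ :=
    inter_mem_nhdsWithin s (Metric.ball_mem_nhds z hδ)
  refine tendsto_integral_filter_of_dominated_convergence b ?_ ?_ hbi ?_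
  · filter_upwards [hnear] with y hy using (key y hy.1).1.1
  · filter_upwards [hnear] with y hy
    filter_upwards [h] with x hx using hx.1 y hy
  · filter_upwards [hF1] with x hx
    exact hx.continuousOn_fderivWithin hs le_rfl z hz

end Parametric

/-! ### Semigroups and their resolvents -/

theorem setIntegral_Ioi_comp_add_right {E : Type*} [NormedAddCommGroup E] [NormedSpace ℝ E]
    (f : ℝ → E) (τ : ℝ) : ∫ t in Ioi 0, f (t + τ) = ∫ t in Ioi τ, f t := by
  have := (measurePreserving_add_right volume τ).setIntegral_preimage_emb
    (measurableEmbedding_addRight τ) f (Ioi τ)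
  simpa using this

theorem integrableOn_Ioi_comp_add_right {E : Type*} [NormedAddCommGroup E]
    {f : ℝ → E} {τ : ℝ} :
    IntegrableOn (fun t => f (t + τ)) (Ioi 0) ↔ IntegrableOn f (Ioi τ) := by
  have := (measurePreserving_add_right volume τ).integrableOn_comp_preimage
    (measurableEmbedding_addRight τ) (f := f) (s := Ioi τ)
  simpa [Function.comp_def] using this

namespace IsC0Semigroup

section Normed

variable {H : Type*} [NormedAddCommGroup H] [NormedSpace ℝ H] {S : ℝ → H →L[ℝ] H} {M ω lam : ℝ}

theorem add_apply (hS : IsC0Semigroup S) {s t : ℝ} (hs : 0 ≤ s) (ht : 0 ≤ t) (h : H) :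
    S (s + t) h = S s (S t h) := by rw [hS.add s t hs ht]; rfl

theorem bound_nonneg (hM : ∀ t : ℝ, 0 ≤ t → ‖S t‖ ≤ M * Real.exp (ω * t)) : 0 ≤ M := by
  have := (norm_nonneg _).trans (hM 0 le_rfl)
  simpa using this

/-- An increment of the orbit over a time |s - t| is S at the smaller time applied to S(|s - t|) h -
h. The operator norms are locally bounded, so right continuity at 0 gives two-sided continuity. -/
theorem continuousOn (hS : IsC0Semigroup S)
    (hM : ∀ t : ℝ, 0 ≤ t → ‖S t‖ ≤ M * Real.exp (ω * t)) (h : H) :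
    ContinuousOn (fun t => S t h) (Ici 0) := by
  have hM0 := bound_nonneg hM
  have hsmall : Tendsto (fun τ => S τ h - h) (𝓝[≥] 0) (𝓝 0) := by
    have h1 : Tendsto (fun τ => S τ h) (𝓝[≥] 0) (𝓝 h) := by
      rw [← Ioi_insert, nhdsWithin_insert]
      refine tendsto_sup.2 ⟨?_, hS.tendsto h⟩
      rw [tendsto_pure_left]
      intro s hs
      rw [hS.zero]; exact mem_of_mem_nhds hs
    simpa using h1.sub_const h
  intro t ht
  have ht : 0 ≤ t := ht
  rw [ContinuousWithinAt, tendsto_iff_norm_sub_tendsto_zero]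
  have hlim : Tendsto (fun s : ℝ => (M * Real.exp (|ω| * (t + 1))) * ‖S |s - t| h - h‖)
      (𝓝[Ici 0] t) (𝓝 0) := by
    have h1 : Tendsto (fun s : ℝ => |s - t|) (𝓝[Ici 0] t) (𝓝[≥] 0) := by
      refine tendsto_nhdsWithin_iff.2 ⟨?_, Eventually.of_forall fun s => mem_Ici.2 (abs_nonneg _)⟩
      have : ContinuousAt (fun s : ℝ => |s - t|) t := by fun_prop
      simpa using this.tendsto.mono_left nhdsWithin_le_nhds
    have := ((hsmall.comp h1).norm).const_mul (M * Real.exp (|ω| * (t + 1)))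
    simpa using this
  refine squeeze_zero' (Eventually.of_forall fun _ => norm_nonneg _) ?_ hlim
  have hnear : ∀ᶠ s in 𝓝[Ici 0] t, s < t + 1 :=
    mem_nhdsWithin_of_mem_nhds (Iio_mem_nhds (by linarith))
  filter_upwards [hnear, self_mem_nhdsWithin] with s hs hs0
  have hs0 : 0 ≤ s := hs0
  have hbd : ∀ r, 0 ≤ r → r ≤ t + 1 → ‖S r‖ ≤ M * Real.exp (|ω| * (t + 1)) := by
    intro r hr hr1
    refine (hM r hr).trans ?_
    gcongr
    exact le_abs_self ω
  rcases le_total t s with hts | hts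
  · have e : S s h - S t h = S t (S |s - t| h - h) := by
      rw [abs_of_nonneg (by linarith), map_sub, ← hS.add_apply ht (by linarith)]
      congr 2; ring_nf
    rw [e]
    exact (S t).le_of_opNorm_le (hbd t ht (by linarith)) _
  · have e : S s h - S t h = -(S s (S |s - t| h - h)) := by
      rw [abs_of_nonpos (by linarith), map_sub, ← hS.add_apply hs0 (by linarith)]
      rw [neg_sub]
      congr 2; ring_nf
    rw [e, norm_neg]
    exact (S s).le_of_opNorm_le (hbd s hs0 hs.le) _

/-- Clipping the time at 0 gives a continuous function on all of ℝ, since `S` is unconstrained at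
negative times. -/
theorem continuous_max (hS : IsC0Semigroup S)
    (hM : ∀ t : ℝ, 0 ≤ t → ‖S t‖ ≤ M * Real.exp (ω * t)) (h : H) :
    Continuous (fun t => S (max t 0) h) :=
  (hS.continuousOn hM h).comp_continuous (by fun_prop) fun _ => mem_Ici.2 (le_max_right _ _)

theorem integrableOn (hS : IsC0Semigroup S) (hω : ω < lam)
    (hM : ∀ t : ℝ, 0 ≤ t → ‖S t‖ ≤ M * Real.exp (ω * t)) (h : H) :
    IntegrableOn (fun t => Real.exp (-(lam * t)) • S t h) (Ioi 0) := by
  have hdom : IntegrableOn (fun t : ℝ => M * ‖h‖ * Real.exp (-(lam - ω) * t)) (Ioi 0) :=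
    (exp_neg_integrableOn_Ioi 0 (by linarith)).const_mul _
  refine Integrable.mono' hdom ?_ ?_
  · refine ContinuousOn.aestronglyMeasurable ?_ measurableSet_Ioi
    exact (Continuous.continuousOn (by fun_prop)).smul
      ((hS.continuousOn hM h).mono Ioi_subset_Ici_self)
  · refine (ae_restrict_iff' measurableSet_Ioi).2 (Eventually.of_forall fun t ht => ?_)
    have ht : 0 < t := ht
    rw [norm_smul, Real.norm_of_nonneg (Real.exp_pos _).le]
    calc Real.exp (-(lam * t)) * ‖S t h‖
        ≤ Real.exp (-(lam * t)) * (M * Real.exp (ω * t) * ‖h‖) := by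
          gcongr; exact (S t).le_of_opNorm_le (hM t ht.le) _
      _ = M * ‖h‖ * (Real.exp (-(lam * t)) * Real.exp (ω * t)) := by ring
      _ = _ := by rw [← Real.exp_add]; congr 2; ring

/-- The resolvent of the generator of a semigroup is its Laplace transform. -/
theorem exists_resolvent [CompleteSpace H] (hS : IsC0Semigroup S) (hω : ω < lam)
    (hM : ∀ t : ℝ, 0 ≤ t → ‖S t‖ ≤ M * Real.exp (ω * t)) :
    ∃ R : H →L[ℝ] H, ∀ h, R h = ∫ t in Ioi 0, Real.exp (-(lam * t)) • S t h := by
  set C : ℝ := ∫ t in Ioi (0 : ℝ), M * Real.exp (-(lam - ω) * t)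
  refine ⟨LinearMap.mkContinuous
    { toFun := fun h => ∫ t in Ioi 0, Real.exp (-(lam * t)) • S t h
      map_add' := fun x y => ?_
      map_smul' := fun c x => ?_ } C ?_, fun h => rfl⟩
  · simp only [map_add, smul_add]
    exact integral_add (hS.integrableOn hω hM x) (hS.integrableOn hω hM y)
  · simp only [map_smul, RingHom.id_apply]
    rw [← integral_smul]
    congr 1; ext t; rw [smul_comm]
  · intro h
    have hdom : IntegrableOn (fun t : ℝ => M * Real.exp (-(lam - ω) * t)) (Ioi 0) :=
      (exp_neg_integrableOn_Ioi 0 (by linarith)).const_mul _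
    rw [← integral_mul_const]
    refine norm_integral_le_of_norm_le (hdom.mul_const _) ?_
    refine (ae_restrict_iff' measurableSet_Ioi).2 (Eventually.of_forall fun t ht => ?_)
    have ht : 0 < t := ht
    rw [norm_smul, Real.norm_of_nonneg (Real.exp_pos _).le]
    calc Real.exp (-(lam * t)) * ‖S t h‖
        ≤ Real.exp (-(lam * t)) * (M * Real.exp (ω * t) * ‖h‖) := by
          gcongr; exact (S t).le_of_opNorm_le (hM t ht.le) _
      _ = M * (Real.exp (-(lam * t)) * Real.exp (ω * t)) * ‖h‖ := by ring
      _ = _ := by rw [← Real.exp_add]; congr 3; ring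

theorem map_resolvent [CompleteSpace H] (hS : IsC0Semigroup S) (hω : ω < lam)
    (hM : ∀ t : ℝ, 0 ≤ t → ‖S t‖ ≤ M * Real.exp (ω * t)) (h : H) {τ : ℝ} (hτ : 0 ≤ τ) :
    S τ (∫ t in Ioi 0, Real.exp (-(lam * t)) • S t h)
      = ∫ t in Ioi 0, Real.exp (-(lam * t)) • S t (S τ h) := by
  rw [← ContinuousLinearMap.integral_comp_comm _ (hS.integrableOn hω hM h)]
  refine setIntegral_congr_fun measurableSet_Ioi fun t ht => ?_
  have ht : 0 < t := ht
  simp only [map_smul]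
  rw [← hS.add_apply hτ ht.le, ← hS.add_apply ht.le hτ, add_comm]

theorem continuous_exp_smul (hS : IsC0Semigroup S)
    (hM : ∀ t : ℝ, 0 ≤ t → ‖S t‖ ≤ M * Real.exp (ω * t)) (h : H) :
    Continuous (fun t => Real.exp (-(lam * t)) • S (max t 0) h) :=
  Continuous.smul (by fun_prop) (hS.continuous_max hM h)

/-- Applying S(τ) shifts the Laplace integral by τ, which multiplies it by exp(lam τ) and removes
the times in (0, τ). Differentiation at τ = 0 identifies the generator. -/
theorem apply_resolvent_eq [CompleteSpace H] (hS : IsC0Semigroup S) (hω : ω < lam)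
    (hM : ∀ t : ℝ, 0 ≤ t → ‖S t‖ ≤ M * Real.exp (ω * t)) {R : H →L[ℝ] H}
    (hR : ∀ h, R h = ∫ t in Ioi 0, Real.exp (-(lam * t)) • S t h) (h : H) {τ : ℝ} (hτ : 0 < τ) :
    S τ (R h) = Real.exp (lam * τ) •
      (R h - ∫ t in (0 : ℝ)..τ, Real.exp (-(lam * t)) • S (max t 0) h) := by
  set w : ℝ → H := fun t => Real.exp (-(lam * t)) • S (max t 0) h with hw
  have hwi : IntegrableOn w (Ioi 0) := by
    refine (hS.integrableOn hω hM h).congr_fun (fun t ht => ?_) measurableSet_Ioi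
    have ht : 0 < t := ht
    simp only [hw, max_eq_left ht.le]
  have hRw : R h = ∫ t in Ioi 0, w t := by
    rw [hR]
    refine setIntegral_congr_fun measurableSet_Ioi fun t ht => ?_
    have ht : 0 < t := ht
    simp only [hw, max_eq_left ht.le]
  have e : S τ (R h) = ∫ t in Ioi 0, Real.exp (-(lam * t)) • S t (S τ h) := by
    rw [hR, hS.map_resolvent hω hM h hτ.le]
  have hwτ : IntegrableOn w (Ioi τ) := hwi.mono_set (Ioi_subset_Ioi hτ.le)
  rw [e, hRw, ← intervalIntegral.integral_interval_add_Ioi hwi hwτ,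
    add_sub_cancel_left, ← setIntegral_Ioi_comp_add_right w τ, ← integral_smul]
  refine setIntegral_congr_fun measurableSet_Ioi fun t ht => ?_
  have ht : 0 < t := ht
  have htτ : 0 ≤ t + τ := (add_pos ht hτ).le
  simp only [hw, max_eq_left htτ]
  rw [smul_smul, ← Real.exp_add, hS.add_apply ht.le hτ.le]
  congr 2; ring

theorem generatorEq_resolvent [CompleteSpace H] (hS : IsC0Semigroup S) (hω : ω < lam)
    (hM : ∀ t : ℝ, 0 ≤ t → ‖S t‖ ≤ M * Real.exp (ω * t)) {R : H →L[ℝ] H}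
    (hR : ∀ h, R h = ∫ t in Ioi 0, Real.exp (-(lam * t)) • S t h) (h : H) :
    GeneratorEq S (R h) (lam • R h - h) := by
  set w : ℝ → H := fun t => Real.exp (-(lam * t)) • S (max t 0) h with hw
  have hwc : Continuous w := hS.continuous_exp_smul hM h
  have hI : Tendsto (fun τ : ℝ => τ⁻¹ • ∫ t in (0 : ℝ)..τ, w t) (𝓝[>] 0) (𝓝 h) := by
    have h1 := (hwc.integral_hasStrictDerivAt 0 0).hasDerivAt.tendsto_slope_zero_right
    simpa [hw, hS.zero] using h1
  have hE : Tendsto (fun τ : ℝ => τ⁻¹ • (Real.exp (lam * τ) - 1)) (𝓝[>] 0) (𝓝 lam) := by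
    have h1 : HasDerivAt (fun τ : ℝ => Real.exp (lam * τ)) lam 0 := by
      have := ((hasDerivAt_id (0 : ℝ)).const_mul lam).exp
      simpa using this
    simpa using h1.tendsto_slope_zero_right
  have hE1 : Tendsto (fun τ : ℝ => Real.exp (lam * τ)) (𝓝[>] 0) (𝓝 1) := by
    have : ContinuousAt (fun τ : ℝ => Real.exp (lam * τ)) 0 := by fun_prop
    simpa using this.tendsto.mono_left nhdsWithin_le_nhds
  have hlim := (hE.smul_const (R h)).sub (hE1.smul hI)
  rw [one_smul] at hlim
  refine hlim.congr' ?_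
  filter_upwards [self_mem_nhdsWithin] with τ hτ
  rw [hS.apply_resolvent_eq hω hM hR h hτ]
  simp only [smul_eq_mul]
  module

end Normed

section Hilbert

variable {H : Type*} [NormedAddCommGroup H] [InnerProductSpace ℝ H] [CompleteSpace H]
  {S : ℝ → H →L[ℝ] H} {M ω lam : ℝ}

/-- The difference quotients of S and S^* are adjoint to each other; pass to the limit on both
sides. -/
theorem inner_generator_eq {v w p q : H} (hv : GeneratorEq S v w)
    (hp : GeneratorEq (fun t => ContinuousLinearMap.adjoint (S t)) p q) : ⟪w, p⟫ = ⟪v, q⟫ := by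
  have h1 : Tendsto (fun t : ℝ => ⟪t⁻¹ • (S t v - v), p⟫) (𝓝[>] 0) (𝓝 ⟪w, p⟫) :=
    Tendsto.inner hv tendsto_const_nhds
  have h2 : Tendsto (fun t : ℝ => ⟪v, t⁻¹ • (ContinuousLinearMap.adjoint (S t) p - p)⟫)
      (𝓝[>] 0) (𝓝 ⟪v, q⟫) := Tendsto.inner tendsto_const_nhds hp
  refine tendsto_nhds_unique h1 (h2.congr fun t => ?_)
  rw [inner_smul_left, inner_smul_right, inner_sub_left, inner_sub_right,
    ContinuousLinearMap.adjoint_inner_right]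
  simp

/-- Weak form of `p - exp (-lam * ε) S^*(ε) p = -∫_0^ε exp (-lam * t) S^*(t) (A^* - lam) p dt`,
as an inequality. -/
theorem abs_inner_sub_le (hS : IsC0Semigroup S)
    (hM : ∀ t : ℝ, 0 ≤ t → ‖S t‖ ≤ M * Real.exp (ω * t)) {p q κ : H}
    (hp : GeneratorEq (fun t => ContinuousLinearMap.adjoint (S t)) p q) {ε N : ℝ} (hε : 0 < ε)
    (hε1 : ε ≤ 1)
    (hN : ∀ t, 0 < t → t ≤ ε → |⟪q - lam • p, S t κ⟫| ≤ N / Real.sqrt t) :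
    |⟪p, κ⟫ - Real.exp (-(lam * ε)) * ⟪p, S ε κ⟫| ≤ 2 * Real.exp |lam| * N * Real.sqrt ε := by
  set f : ℝ → ℝ := fun t => Real.exp (-(lam * t)) * ⟪p, S t κ⟫ with hf
  have hfc : ContinuousOn f (Ici 0) := by
    refine (Continuous.continuousOn (by fun_prop)).mul ?_
    exact continuousOn_const.inner (hS.continuousOn hM κ)
  -- For s > t write S(s) κ = S(s - t) S(t) κ and move S(s - t) onto p. As p is in the domain of the
  -- adjoint generator, this yields a right derivative with no regularity of κ.
  have hder : ∀ t, 0 ≤ t →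
      HasDerivWithinAt f (Real.exp (-(lam * t)) * ⟪q - lam • p, S t κ⟫) (Ici t) t := by
    intro t ht
    have h1 : HasDerivWithinAt (fun t => ⟪p, S t κ⟫) ⟪q, S t κ⟫ (Ici t) t := by
      rw [← hasDerivWithinAt_Ioi_iff_Ici, hasDerivWithinAt_iff_tendsto_slope' (by simp)]
      have h2 : Tendsto (fun τ : ℝ => ⟪τ⁻¹ • (ContinuousLinearMap.adjoint (S τ) p - p), S t κ⟫)
          (𝓝[>] 0) (𝓝 ⟪q, S t κ⟫) := Tendsto.inner hp tendsto_const_nhds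
      have h3 : Tendsto (fun s : ℝ => s - t) (𝓝[>] t) (𝓝[>] 0) := by
        refine tendsto_nhdsWithin_iff.2 ⟨?_, ?_⟩
        · have : ContinuousAt (fun s : ℝ => s - t) t := by fun_prop
          simpa using this.tendsto.mono_left nhdsWithin_le_nhds
        · filter_upwards [self_mem_nhdsWithin] with s hs
          have hs : t < s := hs
          simpa using hs
      refine (h2.comp h3).congr' ?_
      filter_upwards [self_mem_nhdsWithin] with s hs
      have hs : t < s := hs
      simp only [Function.comp, slope_def_field]
      rw [inner_smul_left, inner_sub_left, ContinuousLinearMap.adjoint_inner_left,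
        ← hS.add_apply (by linarith) ht, sub_add_cancel]
      simp [div_eq_inv_mul]
    have h4 : HasDerivWithinAt (fun t : ℝ => Real.exp (-(lam * t)))
        (-lam * Real.exp (-(lam * t))) (Ici t) t := by
      have := (((hasDerivAt_id t).const_mul lam).neg).exp
      refine HasDerivAt.hasDerivWithinAt ?_
      simpa [mul_comm] using this
    have := h4.mul h1
    convert! this using 1
    rw [inner_sub_left, inner_smul_left]; simp only [conj_trivial]; ring
  have hN0 : 0 ≤ N := by
    have := (abs_nonneg _).trans (hN ε hε le_rfl)
    have hs : 0 < Real.sqrt ε := Real.sqrt_pos.2 hε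
    by_contra! h
    exact absurd this (not_le.2 (div_neg_of_neg_of_pos h hs))
  -- The comparison function is a multiple of √t, not differentiable at 0. The inequality is proved
  -- on [a, ε], and a → 0 at the end.
  have key : ∀ a, 0 < a → a ≤ ε → |f ε - f a| ≤ 2 * Real.exp |lam| * N * Real.sqrt ε := by
    intro a ha haε
    have hB : ∀ x ∈ Icc a ε, HasDerivAt (fun x => 2 * Real.exp |lam| * N * Real.sqrt x)
        (Real.exp |lam| * (N / Real.sqrt x)) x := by
      intro x hx
      have hx0 : 0 < x := lt_of_lt_of_le ha hx.1
      have := (Real.hasDerivAt_sqrt hx0.ne').const_mul (2 * Real.exp |lam| * N)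
      convert! this using 1
      field_simp
    have := image_norm_le_of_norm_deriv_right_le_deriv_boundary' (a := a) (b := ε)
      (f := fun x => f x - f a)
      (f' := fun t => Real.exp (-(lam * t)) * ⟪q - lam • p, S t κ⟫)
      (B := fun x => 2 * Real.exp |lam| * N * Real.sqrt x)
      (B' := fun x => Real.exp |lam| * (N / Real.sqrt x))
      ((hfc.mono fun x hx => ha.le.trans hx.1).sub continuousOn_const)
      (fun x hx => (hder x (ha.le.trans hx.1)).sub_const _)
      (by simp only [sub_self, norm_zero]; positivity)
      (fun x hx => (hB x hx).continuousAt.continuousWithinAt)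
      (fun x hx => (hB x ⟨hx.1, hx.2.le⟩).hasDerivWithinAt)
      (fun x hx => by
        rw [norm_mul, Real.norm_of_nonneg (Real.exp_pos _).le]
        have hx0 : 0 < x := lt_of_lt_of_le ha hx.1
        refine mul_le_mul ?_ (hN x hx0 hx.2.le) (norm_nonneg _) (Real.exp_pos _).le
        apply Real.exp_le_exp.2
        refine (neg_le_abs _).trans ?_
        rw [abs_mul, abs_of_pos hx0]
        exact mul_le_of_le_one_right (abs_nonneg _) (hx.2.le.trans hε1))
      (right_mem_Icc.2 haε)
    simpa using this
  have hf0 : f 0 = ⟪p, κ⟫ := by simp [hf, hS.zero]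
  have hlim : Tendsto (fun a => |f ε - f a|) (𝓝[>] 0) (𝓝 |f ε - f 0|) := by
    have h1 : Tendsto f (𝓝[>] 0) (𝓝 (f 0)) :=
      (hfc 0 self_mem_Ici).mono_left (nhdsWithin_mono _ Ioi_subset_Ici_self)
    exact (tendsto_const_nhds.sub h1).abs
  have := le_of_tendsto hlim (by
    filter_upwards [Ioc_mem_nhdsGT hε] with a ha using key a ha.1 ha.2)
  rw [abs_sub_comm, hf0] at this
  exact this

end Hilbert

end IsC0Semigroup

/-! ### Kernels with Gaussian bounds -/

theorem gauss_le_gauss_of_le {c c' t : ℝ} (hc : 0 < c) (hcc : c ≤ c') (ht : 0 < t) (z : Sp d) :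
    gauss (c * t) z ≤ (c' / c) ^ ((d : ℝ) / 2) * gauss (c' * t) z := by
  unfold gauss
  have hc' : 0 < c' := hc.trans_le hcc
  have h1 : (2 * Real.pi * (c * t)) ^ (-((d : ℝ) / 2))
      = (c' / c) ^ ((d : ℝ) / 2) * (2 * Real.pi * (c' * t)) ^ (-((d : ℝ) / 2)) := by
    have e : 2 * Real.pi * (c * t) = (c' / c)⁻¹ * (2 * Real.pi * (c' * t)) := by field_simp
    rw [e, Real.mul_rpow (by positivity) (by positivity), Real.inv_rpow (by positivity),
      Real.rpow_neg (by positivity), inv_inv]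
  rw [h1, mul_assoc]
  gcongr

theorem fderivWithin_closure_eq (hO : IsOpen O) {F : Sp d → ℝ} {y : Sp d} (hy : y ∈ O) :
    fderivWithin ℝ F (closure O) y = fderiv ℝ F y :=
  fderivWithin_of_mem_nhds (mem_of_superset (hO.mem_nhds hy) subset_closure)

theorem le_on_closure {F g : Sp d → ℝ} (hF : ContinuousOn F (closure O)) (hg : Continuous g)
    (h : ∀ w ∈ O, F w ≤ g w) : ∀ y ∈ closure O, F y ≤ g y := fun y hy =>
  ((hF y hy).mono subset_closure).closure_le hy hg.continuousWithinAt h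

/-- A kernel on a domain which for times in `(0, 1]` is `C^1` up to the boundary in the second space
variable, vanishes on the boundary, and is bounded, along with its gradient, by Gaussian densities. -/
structure KernelBounds (O : Set (Sp d)) (G : ℝ → Sp d → Sp d → ℝ) (C c : ℝ) : Prop where
  C_pos : 0 < C
  c_pos : 0 < c
  measurable : Measurable (fun p : ℝ × Sp d × Sp d => G p.1 p.2.1 p.2.2)
  contDiffOn : ∀ t : ℝ, 0 < t → ∀ x ∈ O, ContDiffOn ℝ 1 (G t x) (closure O)
  abs_le : ∀ t : ℝ, 0 < t → t ≤ 1 → ∀ x ∈ O, ∀ y ∈ closure O,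
    |G t x y| ≤ C * gauss (c * t) (x - y)
  norm_fderivWithin_le : ∀ t : ℝ, 0 < t → t ≤ 1 → ∀ x ∈ O, ∀ y ∈ closure O,
    ‖fderivWithin ℝ (G t x) (closure O) y‖ ≤ C / Real.sqrt t * gauss (c * t) (x - y)
  eq_zero : ∀ t : ℝ, 0 < t → t ≤ 1 → ∀ x ∈ O, ∀ y ∈ frontier O, G t x y = 0

theorem boundaryFactor_le_one (t : ℝ) (z : Sp d) : boundaryFactor O t z ≤ 1 := min_le_left _ _

/-- The interior bounds pass to the closure by continuity, after widening the Gaussians to a common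
variance constant. The vanishing on the frontier comes from the factor ρ(y)/√t in the bound for |G|.
-/
theorem exists_kernelBounds {α : ℝ≥0} (hO : IsC1HolderDomain α O) {S : ℝ → L2 O →L[ℝ] L2 O}
    {G : ℝ → Sp d → Sp d → ℝ} (hG : IsGreenKernel O S G) (hG₁ : GreenBounds O G)
    (hG₂ : GreenGradientBound O G) : ∃ C c : ℝ, KernelBounds O G C c := by
  obtain ⟨C₁, c₁, hC₁, hc₁, h₁⟩ := hG₁
  obtain ⟨C₂, c₂, hC₂, hc₂, h₂⟩ := hG₂ 1 one_pos
  set c := max c₁ c₂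
  have hc : 0 < c := lt_max_of_lt_left hc₁
  set C := max (C₁ * (c / c₁) ^ ((d : ℝ) / 2)) (C₂ * (c / c₂) ^ ((d : ℝ) / 2))
  have hC : 0 < C := lt_max_of_lt_left (by positivity)
  have hfin : ∀ t : ℝ, 0 < t → ∀ z : Sp d, 0 ≤ gauss (c * t) z := fun t ht z =>
    gauss_nonneg _ (by positivity) z
  have g1 : ∀ t : ℝ, 0 < t → ∀ z : Sp d, C₁ * gauss (c₁ * t) z ≤ C * gauss (c * t) z := by
    intro t ht z
    calc _ ≤ C₁ * ((c / c₁) ^ ((d : ℝ) / 2) * gauss (c * t) z) := by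
          gcongr; exact gauss_le_gauss_of_le hc₁ (le_max_left _ _) ht z
      _ = (C₁ * (c / c₁) ^ ((d : ℝ) / 2)) * gauss (c * t) z := by ring
      _ ≤ _ := mul_le_mul_of_nonneg_right (le_max_left _ _) (hfin t ht z)
  have g2 : ∀ t : ℝ, 0 < t → ∀ z : Sp d, C₂ * gauss (c₂ * t) z ≤ C * gauss (c * t) z := by
    intro t ht z
    calc _ ≤ C₂ * ((c / c₂) ^ ((d : ℝ) / 2) * gauss (c * t) z) := by
          gcongr; exact gauss_le_gauss_of_le hc₂ (le_max_right _ _) ht z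
      _ = (C₂ * (c / c₂) ^ ((d : ℝ) / 2)) * gauss (c * t) z := by ring
      _ ≤ _ := mul_le_mul_of_nonneg_right (le_max_right _ _) (hfin t ht z)
  clear_value C c
  have hg0 : ∀ t : ℝ, 0 < t → ∀ z : Sp d, 0 ≤ gauss (c₁ * t) z := fun t ht z =>
    gauss_nonneg _ (by positivity) z
  have habs : ∀ t : ℝ, 0 < t → t ≤ 1 → ∀ x ∈ O, ∀ y ∈ closure O,
      |G t x y| ≤ C₁ * (Metric.infDist y (frontier O) / Real.sqrt t) * gauss (c₁ * t) (x - y) := by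
    intro t ht ht1 x hx
    refine le_on_closure (hG.contDiffOn t ht x hx).continuousOn.abs ?_ fun w hw =>
      ((h₁ t ht ht1 x hx w hw).1).trans ?_
    · exact ((continuous_const.mul ((Metric.continuous_infDist_pt _).div_const _)).mul
            (by fun_prop))
    · exact mul_le_mul_of_nonneg_right (mul_le_mul_of_nonneg_left (min_le_right _ _) hC₁.le)
        (hg0 t ht _)
  have habs' : ∀ t : ℝ, 0 < t → t ≤ 1 → ∀ x ∈ O, ∀ y ∈ closure O,
      |G t x y| ≤ C * gauss (c * t) (x - y) := by
    intro t ht ht1 x hx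
    refine le_on_closure (hG.contDiffOn t ht x hx).continuousOn.abs (by fun_prop) fun w hw =>
      ((h₁ t ht ht1 x hx w hw).1).trans (le_trans ?_ (g1 t ht _))
    exact mul_le_mul_of_nonneg_right
        (mul_le_of_le_one_right hC₁.le (boundaryFactor_le_one _ _)) (hg0 t ht _)
  refine ⟨C, c, hC, hc, hG.measurable, hG.contDiffOn, habs', ?_, ?_⟩
  · intro t ht ht1 x hx
    refine le_on_closure ((hG.contDiffOn t ht x hx).continuousOn_fderivWithin
      (uniqueDiffOn_closure hO) le_rfl).norm (by fun_prop) fun w hw => ?_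
    rw [fderivWithin_closure_eq hO.isOpen hw]
    have h3 := h₂ t ht ht1 x hx w hw
    rw [gradient, LinearIsometryEquiv.norm_map] at h3
    refine h3.trans ?_
    rw [div_mul_eq_mul_div, div_mul_eq_mul_div]
    gcongr ?_ / _
    exact g2 t ht _
  · intro t ht ht1 x hx y hy
    have h3 := habs t ht ht1 x hx y (frontier_subset_closure hy)
    rw [Metric.infDist_zero_of_mem hy] at h3
    simpa using h3

/-! ### Cauchy-Schwarz estimates with Gaussian weights -/

theorem sq_lintegral_le {X : Type*} [MeasurableSpace X] (ν : Measure X) {F : X → ℝ≥0∞}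
    (hF : AEMeasurable F ν) : (∫⁻ x, F x ∂ν) ^ 2 ≤ ν univ * ∫⁻ x, F x ^ 2 ∂ν := by
  have h := ENNReal.lintegral_mul_le_Lp_mul_Lq ν (p := 2) (q := 2)
    (Real.HolderConjugate.two_two) (f := fun _ => 1) (g := F) aemeasurable_const hF
  simp only [Pi.mul_apply, one_mul, ENNReal.one_rpow, lintegral_one] at h
  have h2 := pow_le_pow_left' h 2
  simp only [← ENNReal.rpow_natCast] at h2 ⊢
  refine h2.trans_eq ?_
  rw [ENNReal.mul_rpow_of_nonneg _ _ (by norm_num), ← ENNReal.rpow_mul, ← ENNReal.rpow_mul]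
  norm_num

theorem measurable_gauss_sub (t : ℝ) :
    Measurable fun p : Sp d × Sp d => ENNReal.ofReal (gauss t (p.1 - p.2)) :=
  ENNReal.measurable_ofReal.comp ((continuous_gauss t).comp (by fun_prop)).measurable

theorem lintegral_enorm_sq_eq {X : Type*} [MeasurableSpace X] {ν : Measure X} (f : Lp ℝ 2 ν) :
    ∫⁻ x, ‖f x‖ₑ ^ 2 ∂ν = ENNReal.ofReal (‖f‖ ^ 2) := by
  have h := Lp.enorm_def f
  rw [eLpNorm_eq_lintegral_rpow_enorm_toReal (by norm_num) (by norm_num)] at h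
  rw [← ofReal_norm] at h
  rw [ENNReal.ofReal_pow (norm_nonneg _), h, ← ENNReal.rpow_natCast, ← ENNReal.rpow_mul]
  simp

/-- Cauchy-Schwarz for the measure with Gaussian density on O, whose total mass is at most 1. -/
theorem lintegral_gauss_mul_sq_le {t : ℝ} (ht : 0 < t) (f : L2 O) (y : Sp d) :
    (∫⁻ x in O, ENNReal.ofReal (gauss t (x - y)) * ‖f x‖ₑ) ^ 2
      ≤ ∫⁻ x in O, ENNReal.ofReal (gauss t (x - y)) * ‖f x‖ₑ ^ 2 := by
  have hm : Measurable fun x : Sp d => ENNReal.ofReal (gauss t (x - y)) := by fun_prop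
  have hf : AEMeasurable (fun x => ‖f x‖ₑ) (volume.restrict O) :=
    (Lp.aestronglyMeasurable f).enorm
  set ν := (volume.restrict O).withDensity fun x => ENNReal.ofReal (gauss t (x - y)) with hν
  have h1 : ∀ F : Sp d → ℝ≥0∞, AEMeasurable F (volume.restrict O) →
      ∫⁻ x, F x ∂ν = ∫⁻ x in O, ENNReal.ofReal (gauss t (x - y)) * F x := by
    intro F hF
    rw [hν, lintegral_withDensity_eq_lintegral_mul₀ hm.aemeasurable hF]; rfl
  have h2 := sq_lintegral_le ν (F := fun x => ‖f x‖ₑ)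
    (hf.mono_ac (withDensity_absolutelyContinuous _ _))
  rw [h1 _ hf, h1 _ (hf.pow_const 2)] at h2
  refine h2.trans (mul_le_of_le_one_left' ?_)
  rw [hν, withDensity_apply _ MeasurableSet.univ, Measure.restrict_univ]
  exact (setLIntegral_le_lintegral _ _).trans_eq (lintegral_gauss_sub ht y)

/-- Convolution with a Gaussian density maps `L²` to bounded functions. -/
theorem exists_integral_gauss_mul_le {t : ℝ} (ht : 0 < t) : ∃ A : ℝ, 0 ≤ A ∧
    ∀ (f : L2 O) (y : Sp d), Integrable (fun x => gauss t (x - y) * |f x|) (volume.restrict O) ∧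
      ∫ x in O, gauss t (x - y) * |f x| ≤ A * ‖f‖ := by
  set B : ℝ := (2 * Real.pi * t) ^ (-((d : ℝ) / 2))
  have hB : 0 ≤ B := by positivity
  refine ⟨Real.sqrt B, Real.sqrt_nonneg _, fun f y => ?_⟩
  have hg0 : ∀ x, 0 ≤ gauss t (x - y) := fun x => gauss_nonneg t ht.le _
  have hI : Integrable (fun x => gauss t (x - y) * |f x|) (volume.restrict O) :=
    (memLp_gauss_sub ht y).integrable_mul (Lp.memLp f).abs
  refine ⟨hI, ?_⟩
  have e : ENNReal.ofReal (∫ x in O, gauss t (x - y) * |f x|)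
      = ∫⁻ x in O, ENNReal.ofReal (gauss t (x - y)) * ‖f x‖ₑ := by
    rw [ofReal_integral_eq_lintegral_ofReal hI
      (Eventually.of_forall fun x => mul_nonneg (hg0 x) (abs_nonneg _))]
    refine lintegral_congr fun x => ?_
    rw [ENNReal.ofReal_mul (hg0 x), ← Real.norm_eq_abs, ofReal_norm]
  have h1 := lintegral_gauss_mul_sq_le (O := O) ht f y
  rw [← e, ← ENNReal.ofReal_pow (integral_nonneg fun x => mul_nonneg (hg0 x) (abs_nonneg _))] at h1
  have h2 : ∫⁻ x in O, ENNReal.ofReal (gauss t (x - y)) * ‖f x‖ₑ ^ 2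
      ≤ ENNReal.ofReal (B * ‖f‖ ^ 2) := by
    rw [ENNReal.ofReal_mul hB, ← lintegral_enorm_sq_eq,
      ← lintegral_const_mul'' _ ((Lp.aestronglyMeasurable f).enorm.pow_const 2)]
    refine lintegral_mono fun x => ?_
    gcongr
    exact gauss_le t ht _
  have h3 := (ENNReal.ofReal_le_ofReal_iff (by positivity)).1 (h1.trans h2)
  have h4 := Real.le_sqrt_of_sq_le h3
  rwa [Real.sqrt_mul hB, Real.sqrt_sq (norm_nonneg _)] at h4

theorem inner_L2_eq (f g : L2 O) : ⟪f, g⟫ = ∫ x in O, f x * g x := by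
  rw [L2.inner_def]
  refine integral_congr_ae (Eventually.of_forall fun x => ?_)
  simp [mul_comm]

/-! ### The adjoint integral operator -/

/-- The integral operator with kernel `G t x y` acting on functions of `x`; it represents the
adjoint semigroup. -/
def kernelAdjoint (O : Set (Sp d)) (G : ℝ → Sp d → Sp d → ℝ) (t : ℝ) (f : Sp d → ℝ)
    (y : Sp d) : ℝ := ∫ x in O, G t x y * f x

namespace KernelBounds

variable {α : ℝ≥0} {S : ℝ → L2 O →L[ℝ] L2 O} {G : ℝ → Sp d → Sp d → ℝ} {C c t : ℝ}

theorem measurable_left (kb : KernelBounds O G C c) (t : ℝ) (y : Sp d) :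
    Measurable fun x => G t x y :=
  kb.measurable.comp (measurable_const.prodMk (measurable_id.prodMk measurable_const))

theorem measurable_right (kb : KernelBounds O G C c) (t : ℝ) (x : Sp d) :
    Measurable fun y => G t x y :=
  kb.measurable.comp (measurable_const.prodMk (measurable_const.prodMk measurable_id))

theorem measurable_time (kb : KernelBounds O G C c) (x y : Sp d) :
    Measurable fun t => G t x y :=
  kb.measurable.comp (measurable_id.prodMk (measurable_const (a := (x, y))))

theorem memLp_left (kb : KernelBounds O G C c) (hO : IsOpen O) (ht : 0 < t) (ht1 : t ≤ 1)
    {y : Sp d} (hy : y ∈ closure O) : MemLp (fun x => G t x y) 2 (volume.restrict O) := by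
  have hct : 0 < c * t := mul_pos kb.c_pos ht
  refine MemLp.of_le ((memLp_gauss_sub hct y).const_mul C)
    (kb.measurable_left t y).aestronglyMeasurable ?_
  refine (ae_restrict_iff' hO.measurableSet).2 (Eventually.of_forall fun x hx => ?_)
  refine (kb.abs_le t ht ht1 x hx y hy).trans (le_abs_self _)

theorem memLp_right (kb : KernelBounds O G C c) (hO : IsOpen O) (ht : 0 < t) (ht1 : t ≤ 1)
    {x : Sp d} (hx : x ∈ O) : MemLp (fun y => G t x y) 2 (volume.restrict O) := by
  have hct : 0 < c * t := mul_pos kb.c_pos ht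
  refine MemLp.of_le ((memLp_gauss_sub hct x).const_mul C)
    (kb.measurable_right t x).aestronglyMeasurable ?_
  refine (ae_restrict_iff' hO.measurableSet).2 (Eventually.of_forall fun y hy => ?_)
  rw [gauss_sub_comm]
  exact (kb.abs_le t ht ht1 x hx y (subset_closure hy)).trans (le_abs_self _)

/-- A uniform Lipschitz bound near a given point of the closure, for a fixed positive time. -/
theorem exists_lipschitz (kb : KernelBounds O G C c) (hO : IsC1HolderDomain α O) (ht : 0 < t)
    (ht1 : t ≤ 1) {z : Sp d} (hz : z ∈ closure O) : ∃ δ > 0, ∃ A : ℝ, 0 ≤ A ∧ ∀ x ∈ O,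
      (∀ y ∈ closure O ∩ Metric.ball z δ, ‖fderivWithin ℝ (G t x) (closure O) y‖
        ≤ A * gauss (2 * (c * t)) (x - z)) ∧
      ∀ y ∈ closure O ∩ Metric.ball z δ, |G t x y - G t x z|
        ≤ A * gauss (2 * (c * t)) (x - z) * ‖y - z‖ := by
  have hct : 0 < c * t := mul_pos kb.c_pos ht
  have hC := kb.C_pos
  obtain ⟨δ, hδ, hδ1, K, hK, hlip⟩ := exists_lipschitz_of_fderiv_bound hO hz one_pos
  obtain ⟨A, hA, hgA⟩ := gauss_le_gauss_two_mul (d := d) hct (ε := 1)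
  set B : ℝ := C / Real.sqrt t * A with hB
  have hB0 : 0 ≤ B := by positivity
  refine ⟨δ, hδ, (K + 1) * B, by positivity, fun x hx => ?_⟩
  have hg0 : 0 ≤ gauss (2 * (c * t)) (x - z) := gauss_nonneg _ (by positivity) _
  have h1 : ∀ y ∈ closure O, ‖y - z‖ < 1 → ‖fderivWithin ℝ (G t x) (closure O) y‖
      ≤ B * gauss (2 * (c * t)) (x - z) := by
    intro y hy hyz
    refine (kb.norm_fderivWithin_le t ht ht1 x hx y hy).trans ?_
    rw [hB, mul_assoc]
    gcongr
    exact hgA x z y (by rw [norm_sub_rev]; exact hyz.le)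
  constructor
  · rintro y ⟨hy, hyδ⟩
    refine (h1 y hy ((mem_ball_iff_norm.1 hyδ).trans_le hδ1)).trans ?_
    gcongr
    nlinarith
  · intro y hy
    refine (hlip (G t x) (kb.contDiffOn t ht x hx).continuousOn
      (((kb.contDiffOn t ht x hx).differentiableOn one_ne_zero).mono subset_closure)
      (B * gauss (2 * (c * t)) (x - z)) ?_ y hy z ⟨hz, Metric.mem_ball_self hδ⟩).trans ?_
    · rintro w ⟨hw, hwz⟩
      rw [← fderivWithin_closure_eq hO.isOpen hw]
      exact h1 w (subset_closure hw) (mem_ball_iff_norm.1 hwz)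
    · have : 0 ≤ B * gauss (2 * (c * t)) (x - z) := by positivity
      have h5 : (K + 1) * B * gauss (2 * (c * t)) (x - z)
        = K * (B * gauss (2 * (c * t)) (x - z)) + B * gauss (2 * (c * t)) (x - z) := by ring
      rw [h5]
      gcongr
      linarith

/-- Differentiation under the integral sign: near a point z of the closure, G(t,x,·) and its
increments are controlled by a wider Gaussian centred at z, which is square integrable in x and so
integrable against f. -/
theorem contDiffOn_kernelAdjoint (kb : KernelBounds O G C c) (hO : IsC1HolderDomain α O)
    (ht : 0 < t) (ht1 : t ≤ 1) (f : L2 O) :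
    ContDiffOn ℝ 1 (kernelAdjoint O G t f) (closure O) ∧
    ∀ y ∈ closure O, ‖fderivWithin ℝ (kernelAdjoint O G t f) (closure O) y‖
      ≤ C / Real.sqrt t * ∫ x in O, gauss (c * t) (x - y) * |f x| := by
  have hct : 0 < c * t := mul_pos kb.c_pos ht
  have hC := kb.C_pos
  have hu := uniqueDiffOn_closure hO
  have hdm : ∀ x ∈ O, ∀ y ∈ closure O, fderivWithin ℝ (fun y => G t x y * f x) (closure O) y
      = f x • fderivWithin ℝ (G t x) (closure O) y := by
    intro x hx y hy
    exact fderivWithin_mul_const (hu y hy)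
      ((kb.contDiffOn t ht x hx).differentiableOn one_ne_zero y hy) _
  have haeO : ∀ᵐ x ∂(volume.restrict O), x ∈ O := ae_restrict_mem hO.isOpen.measurableSet
  have main := contDiffOn_integral (ν := volume.restrict O) (s := closure O)
    (F := fun x y => G t x y * f x) hu
    (fun y hy => (kb.memLp_left hO.isOpen ht ht1 hy).integrable_mul (Lp.memLp f))
    (haeO.mono fun x hx => (kb.contDiffOn t ht x hx).mul contDiffOn_const) ?_
  · refine ⟨main.1, fun y hy => ?_⟩
    obtain ⟨A, -, hA⟩ := exists_integral_gauss_mul_le (O := O) hct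
    change ‖fderivWithin ℝ (fun y => ∫ x in O, G t x y * f x) (closure O) y‖ ≤ _
    rw [(main.2 y hy).2, ← integral_const_mul]
    refine norm_integral_le_of_norm_le ((hA f y).1.const_mul _) ?_
    filter_upwards [haeO] with x hx
    rw [hdm x hx y hy, norm_smul, Real.norm_eq_abs]
    have := kb.norm_fderivWithin_le t ht ht1 x hx y hy
    calc |f x| * ‖fderivWithin ℝ (G t x) (closure O) y‖
        ≤ |f x| * (C / Real.sqrt t * gauss (c * t) (x - y)) := by gcongr
      _ = _ := by ring
  · intro z hz
    obtain ⟨δ, hδ, A, hA, h⟩ := kb.exists_lipschitz hO ht ht1 hz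
    refine ⟨δ, hδ, fun x => A * (gauss (2 * (c * t)) (x - z) * |f x|), ?_, ?_⟩
    · exact ((memLp_gauss_sub (by positivity) z).integrable_mul (Lp.memLp f).abs).const_mul A
    · filter_upwards [haeO] with x hx
      constructor
      · intro y hy
        rw [hdm x hx y hy.1, norm_smul, Real.norm_eq_abs]
        calc _ ≤ |f x| * (A * gauss (2 * (c * t)) (x - z)) := by
              gcongr; exact (h x hx).1 y hy
          _ = _ := by ring
      · intro y hy
        rw [← sub_mul, abs_mul]
        calc _ ≤ A * gauss (2 * (c * t)) (x - z) * ‖y - z‖ * |f x| := by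
              gcongr; exact (h x hx).2 y hy
          _ = _ := by ring

theorem kernelAdjoint_eq_zero (kb : KernelBounds O G C c) (hO : IsOpen O)
    (ht : 0 < t) (ht1 : t ≤ 1) (f : Sp d → ℝ) {y : Sp d} (hy : y ∈ frontier O) :
    kernelAdjoint O G t f y = 0 := by
  unfold kernelAdjoint
  rw [setIntegral_congr_fun hO.measurableSet (g := fun _ => 0), integral_zero]
  intro x hx
  simp only
  rw [kb.eq_zero t ht ht1 x hx y hy, zero_mul]

theorem integral_abs_kernel_mul_le (kb : KernelBounds O G C c) (hO : IsOpen O)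
    (ht : 0 < t) (ht1 : t ≤ 1) : ∃ A : ℝ, 0 ≤ A ∧ ∀ (f : L2 O), ∀ y ∈ closure O,
      ∫ x in O, |G t x y * f x| ≤ A * ‖f‖ := by
  have hct : 0 < c * t := mul_pos kb.c_pos ht
  have hC := kb.C_pos
  obtain ⟨A, hA0, hA⟩ := exists_integral_gauss_mul_le (O := O) hct
  refine ⟨C * A, by positivity, fun f y hy => ?_⟩
  rw [mul_assoc]
  refine le_trans ?_ (mul_le_mul_of_nonneg_left (hA f y).2 hC.le)
  rw [← integral_const_mul]
  refine integral_mono_ae ((kb.memLp_left hO ht ht1 hy).integrable_mul (Lp.memLp f)).abs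
    ((hA f y).1.const_mul _) ?_
  filter_upwards [ae_restrict_mem hO.measurableSet] with x hx
  rw [abs_mul, ← mul_assoc]
  gcongr
  exact kb.abs_le t ht ht1 x hx y hy

theorem abs_kernelAdjoint_le (kb : KernelBounds O G C c) (hO : IsOpen O)
    (ht : 0 < t) (ht1 : t ≤ 1) : ∃ A : ℝ, 0 ≤ A ∧ ∀ (f : L2 O), ∀ y ∈ closure O,
      |kernelAdjoint O G t f y| ≤ A * ‖f‖ := by
  obtain ⟨A, hA0, hA⟩ := kb.integral_abs_kernel_mul_le hO ht ht1
  exact ⟨A, hA0, fun f y hy => (abs_integral_le_integral_abs).trans (hA f y hy)⟩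

/-- For bounded f the Gaussian integrates to at most 1, so only t^(-1/2) from the gradient bound
remains. Its integrability at 0 gives the C^1 convergence behind the existence of the Dirichlet map.
-/
theorem fderivWithin_kernelAdjoint_le_of_bounded (kb : KernelBounds O G C c)
    (hO : IsC1HolderDomain α O) (ht : 0 < t) (ht1 : t ≤ 1) (f : L2 O) {B : ℝ}
    (hB : ∀ᵐ x ∂(volume.restrict O), |f x| ≤ B) {y : Sp d} (hy : y ∈ closure O) :
    ‖fderivWithin ℝ (kernelAdjoint O G t f) (closure O) y‖ ≤ C * B / Real.sqrt t := by
  have hct : 0 < c * t := mul_pos kb.c_pos ht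
  have hC := kb.C_pos
  have hB0 : 0 ≤ B := by
    have hne : (ae (volume.restrict O)).NeBot := by
      rw [ae_neBot]
      intro h
      exact (hO.isOpen.measure_pos volume hO.isConnected.nonempty).ne'
        (Measure.restrict_eq_zero.1 h)
    obtain ⟨x, hx⟩ := hB.exists
    exact (abs_nonneg _).trans hx
  refine ((kb.contDiffOn_kernelAdjoint hO ht ht1 f).2 y hy).trans ?_
  have h1 : ∫ x in O, gauss (c * t) (x - y) * |f x| ≤ B := by
    calc ∫ x in O, gauss (c * t) (x - y) * |f x|
        ≤ ∫ x in O, gauss (c * t) (x - y) * B := by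
          obtain ⟨A, -, hA⟩ := exists_integral_gauss_mul_le (O := O) hct
          refine integral_mono_ae (hA f y).1
            ((integrable_gauss_sub hct y).restrict.mul_const B) ?_
          filter_upwards [hB] with x hx
          have := gauss_nonneg (c * t) hct.le (x - y)
          gcongr
      _ ≤ 1 * B := by
          rw [integral_mul_const]
          gcongr
          rw [← integral_gauss_sub hct y]
          exact setIntegral_le_integral (integrable_gauss_sub hct y)
            (Eventually.of_forall fun x => gauss_nonneg _ hct.le _)
      _ = B := one_mul B
  calc _ ≤ C / Real.sqrt t * B := by gcongr
    _ = _ := by ring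

/-- Both sides have the same integral over every set of finite measure: pair S^*(t) f with the
indicator of the set, move S(t) onto the indicator, insert the Green kernel and apply Fubini. -/
theorem kernelAdjoint_ae_eq (kb : KernelBounds O G C c) (hO : IsOpen O)
    (hG : IsGreenKernel O S G) (ht : 0 < t) (ht1 : t ≤ 1) (f : L2 O) :
    ContinuousLinearMap.adjoint (S t) f =ᵐ[volume.restrict O] kernelAdjoint O G t f := by
  set μ := volume.restrict O with hμ
  obtain ⟨A, hA0, hA⟩ := kb.integral_abs_kernel_mul_le hO ht ht1
  have hprod : ∀ s : Set (Sp d), MeasurableSet s → μ s < ∞ →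
      Integrable (fun p : Sp d × Sp d => G t p.1 p.2 * f p.1) (μ.prod (μ.restrict s)) := by
    intro s hs hμs
    have hfin : IsFiniteMeasure (μ.restrict s) := ⟨by simpa using hμs⟩
    have hmG : Measurable fun p : Sp d × Sp d => G t p.1 p.2 :=
      kb.measurable.comp (measurable_const.prodMk measurable_id)
    have hm : AEStronglyMeasurable (fun p : Sp d × Sp d => G t p.1 p.2 * f p.1)
        (μ.prod (μ.restrict s)) :=
      hmG.aestronglyMeasurable.mul (Lp.stronglyMeasurable f).aestronglyMeasurable.comp_fst
    have hae : ∀ᵐ y ∂(μ.restrict s), y ∈ O :=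
      ae_restrict_of_ae (ae_restrict_mem hO.measurableSet)
    rw [integrable_prod_iff' hm]
    constructor
    · filter_upwards [hae] with y hy
      exact (kb.memLp_left hO ht ht1 (subset_closure hy)).integrable_mul (Lp.memLp f)
    · refine Integrable.mono' (integrable_const (A * ‖f‖)) ?_ ?_
      · exact (hm.norm.prod_swap).integral_prod_right'
      · filter_upwards [hae] with y hy
        rw [Real.norm_of_nonneg (integral_nonneg fun x => norm_nonneg _)]
        exact hA f y (subset_closure hy)
  refine ae_eq_of_forall_setIntegral_eq_of_sigmaFinite (fun s hs hμs => ?_) (fun s hs hμs => ?_)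
    fun s hs hμs => ?_
  · have hfin : IsFiniteMeasure (μ.restrict s) := ⟨by simpa using hμs⟩
    exact ((Lp.memLp (ContinuousLinearMap.adjoint (S t) f)).restrict s).integrable
      (by norm_num)
  · exact (hprod s hs hμs).integral_prod_right
  · rw [← L2.inner_indicatorConstLp_one hs hμs.ne, ContinuousLinearMap.adjoint_inner_right,
      inner_L2_eq]
    have h1 := hG.apply_eq t ht (indicatorConstLp 2 hs hμs.ne (1 : ℝ))
    have h2 : ∀ᵐ x ∂μ, S t (indicatorConstLp 2 hs hμs.ne (1 : ℝ)) x * f x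
        = ∫ y in s, G t x y * f x ∂μ := by
      filter_upwards [h1] with x hx
      rw [hx.2, integral_mul_const, ← integral_indicator hs]
      congr 1
      refine integral_congr_ae ?_
      filter_upwards [indicatorConstLp_coeFn (p := 2) (hs := hs) (hμs := hμs.ne) (c := (1 : ℝ))]
        with y hy
      rw [hy]
      by_cases hys : y ∈ s <;> simp [hys]
    rw [integral_congr_ae h2]
    exact integral_integral_swap (hprod s hs hμs)

end KernelBounds

/-! ### Boundary integrals -/

section Boundary

variable {α : ℝ≥0} {a : Sp d → Matrix (Fin d) (Fin d) ℝ} {γ : Sp d → ℝ} {K : Set (Sp d)}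

theorem continuousOn_conormal (hO : IsC1HolderDomain α O) (ha : ContinuousOn a (closure O)) :
    ContinuousOn (conormal a O) (frontier O) := by
  have h1 : Continuous fun p : Matrix (Fin d) (Fin d) ℝ × Sp d =>
      WithLp.toLp 2 (p.1 *ᵥ WithLp.ofLp p.2) :=
    (PiLp.continuous_toLp 2 _).comp
      (continuous_fst.matrix_mulVec ((PiLp.continuous_ofLp 2 _).comp continuous_snd))
  have h2 : ContinuousOn (fun y => (a y, outwardNormal O y)) (frontier O) :=
    (ha.mono frontier_subset_closure).prodMk (continuousOn_outwardNormal hO)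
  refine (h1.comp_continuousOn h2).congr fun y _ => ?_
  ext i
  exact congrFun (Matrix.ofLp_toEuclideanCLM (𝕜 := ℝ) (a y) (outwardNormal O y)) i

theorem ae_surfaceMeasure_mem : ∀ᵐ y ∂(surfaceMeasure O), y ∈ frontier O :=
  ae_restrict_mem isClosed_frontier.measurableSet

theorem integrable_boundary (hO : IsC1HolderDomain α O) {E : Type*} [NormedAddCommGroup E]
    (hK : IsCompact K) {f : Sp d → E} (hf : ContinuousOn f (frontier O))
    (hfK : ∀ y ∈ frontier O, y ∉ K → f y = 0) : Integrable f (surfaceMeasure O) := by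
  have := isLocallyFiniteMeasure_surfaceMeasure hO
  have h1 : IntegrableOn f (K ∩ frontier O) (surfaceMeasure O) :=
    (hf.mono inter_subset_right).integrableOn_compact (hK.inter_right isClosed_frontier)
  refine h1.integrable_of_ae_notMem_eq_zero ?_
  filter_upwards [ae_surfaceMeasure_mem] with y hy hyK
  exact hfK y hy fun h => hyK ⟨h, hy⟩

/-- The integral of `γ` times the conormal derivative of `ψ` over the boundary. -/
def boundaryPairing (a : Sp d → Matrix (Fin d) (Fin d) ℝ) (O : Set (Sp d)) (γ : Sp d → ℝ)
    (ψ : Sp d → ℝ) : ℝ := ∫ y, γ y * conormalDeriv a O ψ y ∂(surfaceMeasure O)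

/-- The conditions on the boundary datum and on the coefficients used for boundary integrals. -/
structure BoundaryDatum (a : Sp d → Matrix (Fin d) (Fin d) ℝ) (O : Set (Sp d)) (γ : Sp d → ℝ)
    (K : Set (Sp d)) : Prop where
  coeff : ContinuousOn a (closure O)
  datum : ContinuousOn γ (frontier O)
  compact : IsCompact K
  support : ∀ y ∈ frontier O, y ∉ K → γ y = 0

namespace BoundaryDatum

theorem integrable_apply (bd : BoundaryDatum a O γ K) (hO : IsC1HolderDomain α O)
    {ℓ : Sp d → Sp d →L[ℝ] ℝ} (hℓ : ContinuousOn ℓ (frontier O)) :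
    Integrable (fun y => γ y * ℓ y (conormal a O y)) (surfaceMeasure O) := by
  refine integrable_boundary hO bd.compact
    (bd.datum.mul (hℓ.clm_apply (continuousOn_conormal hO bd.coeff))) fun y hy hyK => ?_
  rw [bd.support y hy hyK, zero_mul]

theorem integrable_norm (bd : BoundaryDatum a O γ K) (hO : IsC1HolderDomain α O) :
    Integrable (fun y => |γ y| * ‖conormal a O y‖) (surfaceMeasure O) := by
  refine integrable_boundary hO bd.compact
    (bd.datum.abs.mul (continuousOn_conormal hO bd.coeff).norm) fun y hy hyK => ?_
  rw [bd.support y hy hyK, abs_zero, zero_mul]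

theorem integrable_conormalDeriv (bd : BoundaryDatum a O γ K) (hO : IsC1HolderDomain α O)
    {ψ : Sp d → ℝ} (hψ : ContDiffOn ℝ 1 ψ (closure O)) :
    Integrable (fun y => γ y * conormalDeriv a O ψ y) (surfaceMeasure O) :=
  bd.integrable_apply hO ((hψ.continuousOn_fderivWithin (uniqueDiffOn_closure hO) le_rfl).mono
    frontier_subset_closure)

theorem exists_abs_boundaryPairing_le (bd : BoundaryDatum a O γ K)
    (hO : IsC1HolderDomain α O) : ∃ A : ℝ, 0 ≤ A ∧ ∀ (ψ : Sp d → ℝ) (B : ℝ),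
      (∀ y ∈ frontier O, ‖fderivWithin ℝ ψ (closure O) y‖ ≤ B) →
      |boundaryPairing a O γ ψ| ≤ A * B := by
  refine ⟨∫ y, |γ y| * ‖conormal a O y‖ ∂(surfaceMeasure O),
    integral_nonneg fun y => by positivity, fun ψ B hB => ?_⟩
  unfold boundaryPairing
  rw [← integral_mul_const, ← Real.norm_eq_abs]
  refine norm_integral_le_of_norm_le ((bd.integrable_norm hO).mul_const B) ?_
  filter_upwards [ae_surfaceMeasure_mem] with y hy
  rw [norm_mul, Real.norm_eq_abs, mul_assoc]
  gcongr
  rw [mul_comm]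
  exact (fderivWithin ℝ ψ (closure O) y).le_of_opNorm_le (hB y hy) _

end BoundaryDatum

theorem boundaryPairing_congr {ψ ψ' : Sp d → ℝ} (h : EqOn ψ ψ' (closure O)) :
    boundaryPairing a O γ ψ = boundaryPairing a O γ ψ' := by
  refine integral_congr_ae ?_
  filter_upwards [ae_surfaceMeasure_mem] with y hy
  unfold conormalDeriv
  rw [fderivWithin_congr h (h (frontier_subset_closure hy))]

theorem boundaryPairing_sub_const_mul (bd : BoundaryDatum a O γ K) (hO : IsC1HolderDomain α O)
    {ψ ψ' : Sp d → ℝ} (hψ : ContDiffOn ℝ 1 ψ (closure O)) (hψ' : ContDiffOn ℝ 1 ψ' (closure O))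
    (r : ℝ) : boundaryPairing a O γ (fun y => ψ y - r * ψ' y)
      = boundaryPairing a O γ ψ - r * boundaryPairing a O γ ψ' := by
  unfold boundaryPairing
  rw [← integral_const_mul, ← integral_sub (bd.integrable_conormalDeriv hO hψ)
    ((bd.integrable_conormalDeriv hO hψ').const_mul r)]
  refine integral_congr_ae ?_
  filter_upwards [ae_surfaceMeasure_mem] with y hy
  have hy' := frontier_subset_closure hy
  have hu := uniqueDiffOn_closure hO y hy'
  have h1 := hψ.differentiableOn one_ne_zero y hy'
  have h2 := hψ'.differentiableOn one_ne_zero y hy'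
  unfold conormalDeriv
  rw [fderivWithin_fun_sub hu h1 (h2.const_mul r), fderivWithin_const_mul hu h2]
  simp only [sub_apply, smul_apply, smul_eq_mul]
  ring

theorem eqOn_closure_of_ae_eq (hO : IsOpen O) {ψ ψ' : Sp d → ℝ}
    (hψ : ContinuousOn ψ (closure O)) (hψ' : ContinuousOn ψ' (closure O))
    (h : ψ =ᵐ[volume.restrict O] ψ') : EqOn ψ ψ' (closure O) :=
  (Measure.eqOn_open_of_ae_eq h hO (hψ.mono subset_closure)
    (hψ'.mono subset_closure)).of_subset_closure hψ hψ' subset_closure le_rfl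

end Boundary

/-! ### The t^(-3/4) bound for the boundary functionals -/

theorem ofReal_integral_gauss_mul {t : ℝ} (ht : 0 < t) (f : L2 O) (y : Sp d) :
    ENNReal.ofReal (∫ x in O, gauss t (x - y) * |f x|)
      = ∫⁻ x in O, ENNReal.ofReal (gauss t (x - y)) * ‖f x‖ₑ := by
  have hg0 : ∀ x, 0 ≤ gauss t (x - y) := fun x => gauss_nonneg t ht.le _
  have hI : Integrable (fun x => gauss t (x - y) * |f x|) (volume.restrict O) :=
    (memLp_gauss_sub ht y).integrable_mul (Lp.memLp f).abs
  rw [ofReal_integral_eq_lintegral_ofReal hI (Eventually.of_forall fun x => mul_nonneg (hg0 x) (abs_nonneg _))]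
  refine lintegral_congr fun x => ?_
  rw [ENNReal.ofReal_mul (hg0 x), ← Real.norm_eq_abs, ofReal_norm]

/-- If Gaussian densities have `σ`-integrals of order `t ^ (-1/2)`, then Gaussian regularization maps
`L²(O)` to `L¹(σ)` with norm of order `t ^ (-1/4)`. -/
theorem sq_lintegral_gauss_mul_le (σ : Measure (Sp d)) [IsFiniteMeasure σ] {t : ℝ} (ht : 0 < t)
    {D : ℝ≥0∞} (hD : ∀ x, ∫⁻ y, ENNReal.ofReal (gauss t (x - y)) ∂σ ≤ D) (f : L2 O) :
    (∫⁻ y, ∫⁻ x in O, ENNReal.ofReal (gauss t (x - y)) * ‖f x‖ₑ ∂volume ∂σ) ^ 2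
      ≤ σ univ * (D * ENNReal.ofReal (‖f‖ ^ 2)) := by
  have hf := (Lp.stronglyMeasurable f).measurable
  have hgm := measurable_gauss_sub (d := d) t
  have hm2 : Measurable fun p : Sp d × Sp d =>
      ENNReal.ofReal (gauss t (p.1 - p.2)) * ‖f p.1‖ₑ ^ 2 :=
    hgm.mul ((hf.comp measurable_fst).enorm.pow_const 2)
  have hm1 : Measurable fun p : Sp d × Sp d =>
      ENNReal.ofReal (gauss t (p.1 - p.2)) * ‖f p.1‖ₑ :=
    hgm.mul (hf.comp measurable_fst).enorm
  have e1 : ∫⁻ y, ∫⁻ x in O, ENNReal.ofReal (gauss t (x - y)) * ‖f x‖ₑ ^ 2 ∂volume ∂σ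
      = ∫⁻ x in O, ∫⁻ y, ENNReal.ofReal (gauss t (x - y)) * ‖f x‖ₑ ^ 2 ∂σ :=
    lintegral_lintegral_swap (hm2.comp measurable_swap).aemeasurable
  have e2 : ∀ x, ∫⁻ y, ENNReal.ofReal (gauss t (x - y)) * ‖f x‖ₑ ^ 2 ∂σ ≤ D * ‖f x‖ₑ ^ 2 := by
    intro x
    have hmy : Measurable fun y => ENNReal.ofReal (gauss t (x - y)) := by fun_prop
    rw [lintegral_mul_const _ hmy]
    exact mul_le_mul_left (hD x) _
  refine (sq_lintegral_le σ hm1.lintegral_prod_left'.aemeasurable).trans ?_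
  refine mul_le_mul_right ?_ _
  calc ∫⁻ y, (∫⁻ x in O, ENNReal.ofReal (gauss t (x - y)) * ‖f x‖ₑ) ^ 2 ∂σ
      ≤ ∫⁻ y, ∫⁻ x in O, ENNReal.ofReal (gauss t (x - y)) * ‖f x‖ₑ ^ 2 ∂volume ∂σ :=
        lintegral_mono fun y => lintegral_gauss_mul_sq_le ht f y
    _ ≤ ∫⁻ x in O, D * ‖f x‖ₑ ^ 2 := by rw [e1]; exact lintegral_mono e2
    _ = _ := by
        rw [lintegral_const_mul _ (hf.enorm.pow_const 2), lintegral_enorm_sq_eq]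

/-- The exponent is 3/4 = 1/2 + 1/4: the gradient bound contributes 1/2, and the passage from L²(O)
to L¹ of the boundary contributes 1/4. It is less than 1, which makes the boundary orbit integrable
at time 0. -/
theorem exists_abs_boundaryPairing_kernelAdjoint_le {α : ℝ≥0} {K : Set (Sp d)}
    {a : Sp d → Matrix (Fin d) (Fin d) ℝ} {γ : Sp d → ℝ} {G : ℝ → Sp d → Sp d → ℝ} {C c : ℝ}
    (kb : KernelBounds O G C c) (bd : BoundaryDatum a O γ K) (hO : IsC1HolderDomain α O) :
    ∃ A : ℝ, 0 ≤ A ∧ ∀ t : ℝ, 0 < t → t ≤ 1 → ∀ f : L2 O,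
      |boundaryPairing a O γ (kernelAdjoint O G t f)| ≤ A * t ^ (-(3 / 4 : ℝ)) * ‖f‖ := by
  have hloc := isLocallyFiniteMeasure_surfaceMeasure hO
  have hC := kb.C_pos
  have hc := kb.c_pos
  set σ := (surfaceMeasure O).restrict K with hσ
  have hfin : IsFiniteMeasure σ := ⟨by simpa [hσ] using bd.compact.measure_lt_top⟩
  obtain ⟨D, hD⟩ := exists_lintegral_gauss_surfaceMeasure_le hO bd.compact
  obtain ⟨B, hB⟩ := (bd.compact.inter_right isClosed_frontier).exists_bound_of_continuousOn
    ((bd.datum.mul (continuousOn_conormal hO bd.coeff).norm).mono inter_subset_right)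
  set m : ℝ := (σ univ).toReal with hm
  -- The constants are collected in squared form because the Gaussian estimate bounds a square; the
  -- final constant is √Q.
  set Q : ℝ := |B| ^ 2 * C ^ 2 * m * D * (2 * Real.pi * c) ^ (-(1 / 2 : ℝ)) with hQ
  have hQ0 : 0 ≤ Q := by positivity
  refine ⟨Real.sqrt Q, Real.sqrt_nonneg _, fun t ht ht1 f => ?_⟩
  have hct : 0 < c * t := by positivity
  set I : Sp d → ℝ≥0∞ := fun y =>
    ∫⁻ x in O, ENNReal.ofReal (gauss (c * t) (x - y)) * ‖f x‖ₑ with hI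
  set P := boundaryPairing a O γ (kernelAdjoint O G t f) with hP
  have h1 : ‖P‖ₑ ≤ ENNReal.ofReal (|B| * (C / Real.sqrt t)) * ∫⁻ y, I y ∂σ := by
    rw [← lintegral_const_mul' _ _ ENNReal.ofReal_ne_top, hσ,
      ← lintegral_indicator bd.compact.measurableSet]
    refine (enorm_integral_le_lintegral_enorm _).trans (lintegral_mono_ae ?_)
    filter_upwards [ae_surfaceMeasure_mem] with y hy
    by_cases hyK : y ∈ K
    · rw [indicator_of_mem hyK]
      simp only [hI]
      rw [← ofReal_integral_gauss_mul hct,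
        ← ENNReal.ofReal_mul (by positivity), ← ofReal_norm]
      refine ENNReal.ofReal_le_ofReal ?_
      have h2 := (kb.contDiffOn_kernelAdjoint hO ht ht1 f).2 y (frontier_subset_closure hy)
      have h3 := hB y ⟨hyK, hy⟩
      rw [Pi.mul_apply, norm_mul, norm_norm] at h3
      have h4 := (fderivWithin ℝ (kernelAdjoint O G t f) (closure O) y).le_of_opNorm_le h2
        (conormal a O y)
      set J := ∫ x in O, gauss (c * t) (x - y) * |f x|
      have hJ : 0 ≤ J := integral_nonneg fun x =>
        mul_nonneg (gauss_nonneg _ hct.le _) (abs_nonneg _)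
      rw [norm_mul]
      calc ‖γ y‖ * ‖conormalDeriv a O (kernelAdjoint O G t f) y‖
          ≤ ‖γ y‖ * (C / Real.sqrt t * J * ‖conormal a O y‖) := by gcongr; exact h4
        _ = (‖γ y‖ * ‖conormal a O y‖) * (C / Real.sqrt t) * J := by ring
        _ ≤ |B| * (C / Real.sqrt t) * J := by
            gcongr
            exact h3.trans (le_abs_self B)
    · rw [bd.support y hy hyK, zero_mul, enorm_zero]
      exact zero_le
  have h2 := sq_lintegral_gauss_mul_le σ hct (fun x => hD (c * t) hct x) f
  have h3 : ENNReal.ofReal (P ^ 2) ≤ ENNReal.ofReal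
      ((|B| * (C / Real.sqrt t)) ^ 2 * (m * (D * (2 * Real.pi * (c * t)) ^ (-(1 / 2 : ℝ))
        * ‖f‖ ^ 2))) := by
    rw [← sq_abs, ← Real.norm_eq_abs, ENNReal.ofReal_pow (norm_nonneg _), ofReal_norm]
    refine (pow_le_pow_left' h1 2).trans ?_
    rw [mul_pow, ENNReal.ofReal_mul (p := (|B| * (C / Real.sqrt t)) ^ 2) (by positivity),
      ENNReal.ofReal_pow (by positivity), ENNReal.ofReal_mul (p := m) (by positivity), 
      ENNReal.ofReal_mul (p := (D : ℝ) * _) (by positivity),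
      ENNReal.ofReal_mul (p := (D : ℝ)) (by positivity), hm,
      ENNReal.ofReal_toReal (measure_ne_top _ _), ENNReal.ofReal_coe_nnreal]
    gcongr
  have h4 := (ENNReal.ofReal_le_ofReal_iff (by positivity)).1 h3
  have e1 : (t ^ (-(3 / 4 : ℝ))) ^ 2 = t⁻¹ * t ^ (-(1 / 2 : ℝ)) := by
    rw [← Real.rpow_natCast, ← Real.rpow_mul ht.le, ← Real.rpow_neg_one, ← Real.rpow_add ht]
    norm_num
  have h5 : P ^ 2 ≤ (Real.sqrt Q * t ^ (-(3 / 4 : ℝ)) * ‖f‖) ^ 2 := by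
    refine h4.trans_eq ?_
    rw [mul_pow (Real.sqrt Q * _), mul_pow (Real.sqrt Q), Real.sq_sqrt hQ0, e1, ← mul_assoc (2 * Real.pi),
      Real.mul_rpow (by positivity) ht.le, hQ, mul_pow |B|, div_pow, Real.sq_sqrt ht.le]
    field_simp
  exact abs_le_of_sq_le_sq h5 (by positivity)

/-! ### The boundary data propagated by the semigroup -/

section Family

variable {α : ℝ≥0} {K : Set (Sp d)} {a : Sp d → Matrix (Fin d) (Fin d) ℝ} {γ : Sp d → ℝ}
  {S : ℝ → L2 O →L[ℝ] L2 O} {G : ℝ → Sp d → Sp d → ℝ} {C c : ℝ}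

theorem IsC0Semigroup.adjoint_add_apply (hS : IsC0Semigroup S) {s t : ℝ} (hs : 0 ≤ s)
    (ht : 0 ≤ t) (f : L2 O) : ContinuousLinearMap.adjoint (S (s + t)) f
      = ContinuousLinearMap.adjoint (S t) (ContinuousLinearMap.adjoint (S s) f) := by
  rw [hS.add s t hs ht, ContinuousLinearMap.adjoint_comp]; rfl

/-- For every positive time, functions in the range of the adjoint semigroup are `C^1` up to the
boundary and vanish there. -/
theorem exists_contDiffOn_adjoint (kb : KernelBounds O G C c) (hO : IsC1HolderDomain α O)
    (hS : IsC0Semigroup S) (hG : IsGreenKernel O S G) {t : ℝ} (ht : 0 < t) :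
    ∃ A : ℝ, 0 ≤ A ∧ ∀ f : L2 O,
    ∃ ψ : Sp d → ℝ, ContDiffOn ℝ 1 ψ (closure O) ∧ (∀ y ∈ frontier O, ψ y = 0) ∧
      (∀ y ∈ closure O, |ψ y| ≤ A * ‖f‖) ∧
      ContinuousLinearMap.adjoint (S t) f =ᵐ[volume.restrict O] ψ := by
  -- The kernel bounds hold only up to time 1. The last min(t, 1) units of time are used for
  -- smoothing, and the rest is a bounded operator.
  have hs : 0 < min t 1 := lt_min ht one_pos
  obtain ⟨A, hA0, hA⟩ := kb.abs_kernelAdjoint_le hO.isOpen hs (min_le_right _ _)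
  refine ⟨A * ‖ContinuousLinearMap.adjoint (S (t - min t 1))‖, by positivity, fun f => ?_⟩
  set g := ContinuousLinearMap.adjoint (S (t - min t 1)) f
  refine ⟨kernelAdjoint O G (min t 1) g,
    (kb.contDiffOn_kernelAdjoint hO hs (min_le_right _ _) _).1, fun y hy =>
      kb.kernelAdjoint_eq_zero hO.isOpen hs (min_le_right _ _) _ hy, fun y hy => ?_, ?_⟩
  · refine (hA g y hy).trans ?_
    rw [mul_assoc]
    gcongr
    exact (ContinuousLinearMap.adjoint (S (t - min t 1))).le_opNorm f
  · have h := hS.adjoint_add_apply (sub_nonneg.2 (min_le_left t 1)) hs.le f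
    rw [sub_add_cancel] at h
    rw [h]
    exact kb.kernelAdjoint_ae_eq hO.isOpen hG hs (min_le_right _ _) g

theorem kernelAdjoint_add (kb : KernelBounds O G C c) (hO : IsOpen O) {t : ℝ} (ht : 0 < t)
    (ht1 : t ≤ 1) (f g : L2 O) {y : Sp d} (hy : y ∈ closure O) :
    kernelAdjoint O G t (f + g : L2 O) y = kernelAdjoint O G t f y + kernelAdjoint O G t g y := by
  unfold kernelAdjoint
  have hf : Integrable (fun x => G t x y * f x) (volume.restrict O) :=
    (kb.memLp_left hO ht ht1 hy).integrable_mul (Lp.memLp f)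
  have hg : Integrable (fun x => G t x y * g x) (volume.restrict O) :=
    (kb.memLp_left hO ht ht1 hy).integrable_mul (Lp.memLp g)
  rw [← integral_add hf hg]
  refine integral_congr_ae ?_
  filter_upwards [Lp.coeFn_add f g] with x hx
  rw [hx, Pi.add_apply, mul_add]

theorem kernelAdjoint_smul (r t : ℝ) (f : L2 O) (y : Sp d) :
    kernelAdjoint O G t (r • f : L2 O) y = r * kernelAdjoint O G t f y := by
  unfold kernelAdjoint
  rw [← integral_const_mul]
  refine integral_congr_ae ?_
  filter_upwards [Lp.coeFn_smul r f] with x hx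
  rw [hx, Pi.smul_apply, smul_eq_mul]; ring

/-- The family `H t` in `L²(O)`, `t > 0`, represents the functionals which map `f` to minus the
boundary integral of `γ` times the conormal derivative of `S^*(t) f`. -/
def IsBoundaryFamily (a : Sp d → Matrix (Fin d) (Fin d) ℝ) (O : Set (Sp d)) (γ : Sp d → ℝ)
    (S : ℝ → L2 O →L[ℝ] L2 O) (H : ℝ → L2 O) : Prop :=
  ∀ t, 0 < t → ∀ (f : L2 O) (ψ : Sp d → ℝ), ContDiffOn ℝ 1 ψ (closure O) →
    ContinuousLinearMap.adjoint (S t) f =ᵐ[volume.restrict O] ψ →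
    boundaryPairing a O γ ψ = -⟪H t, f⟫

/-- Riesz representation of the boundary functionals for t ≤ 1, prolonged to t > 1 by applying S(t -
1) to the value at time 1. -/
theorem exists_boundaryFamily (kb : KernelBounds O G C c) (bd : BoundaryDatum a O γ K)
    (hO : IsC1HolderDomain α O) (hS : IsC0Semigroup S) (hG : IsGreenKernel O S G) :
    ∃ H : ℝ → L2 O, IsBoundaryFamily a O γ S H ∧
      ∃ A : ℝ, ∀ t, 0 < t → t ≤ 1 → ‖H t‖ ≤ A * t ^ (-(3 / 4 : ℝ)) := by
  obtain ⟨A, hA0, hA⟩ := exists_abs_boundaryPairing_kernelAdjoint_le kb bd hO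
  have hex : ∀ t : ℝ, ∃ h : L2 O, 0 < t → t ≤ 1 → ∀ f : L2 O,
      ⟪h, f⟫ = -boundaryPairing a O γ (kernelAdjoint O G t f) := by
    intro t
    by_cases ht : 0 < t ∧ t ≤ 1
    · obtain ⟨ht, ht1⟩ := ht
      have hcd := fun f : L2 O => (kb.contDiffOn_kernelAdjoint hO ht ht1 f).1
      let ℓ : L2 O →L[ℝ] ℝ := LinearMap.mkContinuous
        { toFun := fun f => -boundaryPairing a O γ (kernelAdjoint O G t f)
          map_add' := fun f g => by
            -- Sums and multiples are written as ψ - r ψ', with r = -1 here and 1 - r below, so that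
            -- one linearity lemma covers both.
            have e : EqOn (kernelAdjoint O G t (f + g : L2 O))
                (fun y => kernelAdjoint O G t f y - (-1) * kernelAdjoint O G t g y)
                (closure O) := fun y hy => by
              simp only
              rw [kernelAdjoint_add kb hO.isOpen ht ht1 f g hy]; ring
            rw [boundaryPairing_congr e, boundaryPairing_sub_const_mul bd hO (hcd f) (hcd g)]
            ring
          map_smul' := fun r f => by
            have e : EqOn (kernelAdjoint O G t (r • f : L2 O))
                (fun y => kernelAdjoint O G t f y - (1 - r) * kernelAdjoint O G t f y)
                (closure O) := fun y hy => by
              simp only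
              rw [kernelAdjoint_smul r t f y]; ring
            rw [boundaryPairing_congr e, boundaryPairing_sub_const_mul bd hO (hcd f) (hcd f)]
            simp only [RingHom.id_apply, smul_eq_mul]
            ring } (A * t ^ (-(3 / 4 : ℝ))) (fun f => by
            simpa using hA t ht ht1 f)
      refine ⟨(InnerProductSpace.toDual ℝ (L2 O)).symm ℓ, fun _ _ f => ?_⟩
      rw [InnerProductSpace.toDual_symm_apply]
      rfl
    · exact ⟨0, fun h h' => absurd ⟨h, h'⟩ ht⟩
  choose h hh using hex
  refine ⟨fun t => S (t - min t 1) (h (min t 1)), fun t ht f ψ hψ hψf => ?_, A,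
    fun t ht ht1 => ?_⟩
  · have hs : 0 < min t 1 := lt_min ht one_pos
    have hs1 : min t 1 ≤ 1 := min_le_right _ _
    rw [← ContinuousLinearMap.adjoint_inner_right, hh _ hs hs1, neg_neg]
    set g := ContinuousLinearMap.adjoint (S (t - min t 1)) f
    refine boundaryPairing_congr (eqOn_closure_of_ae_eq hO.isOpen hψ.continuousOn
      (kb.contDiffOn_kernelAdjoint hO hs hs1 g).1.continuousOn ?_)
    have h := hS.adjoint_add_apply (sub_nonneg.2 (min_le_left t 1)) hs.le f
    rw [sub_add_cancel] at h
    rw [h] at hψf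
    exact hψf.symm.trans (kb.kernelAdjoint_ae_eq hO.isOpen hG hs hs1 g)
  · simp only [min_eq_left ht1, sub_self, hS.zero, ContinuousLinearMap.id_apply]
    -- Testing the functional on its own representative gives ‖h‖² ≤ A t^(-3/4) ‖h‖.
    have h1 := hh t ht ht1 (h t)
    rw [real_inner_self_eq_norm_sq] at h1
    have h2 := hA t ht ht1 (h t)
    have h3 := (neg_le_abs _).trans h2
    rw [← h1, sq] at h3
    rcases (norm_nonneg (h t)).eq_or_lt with h0 | h0
    · rw [← h0]; positivity
    · exact le_of_mul_le_mul_right h3 h0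

/-- Both sides represent the same functional, because S^*(r + t) f = S^*(t) S^*(r) f has a single
C^1 version. -/
theorem IsBoundaryFamily.map_eq {H : ℝ → L2 O} (hH : IsBoundaryFamily a O γ S H)
    (kb : KernelBounds O G C c) (hO : IsC1HolderDomain α O) (hS : IsC0Semigroup S)
    (hG : IsGreenKernel O S G) {r t : ℝ} (hr : 0 ≤ r) (ht : 0 < t) :
    S r (H t) = H (r + t) := by
  refine ext_inner_right ℝ fun f => ?_
  obtain ⟨A, -, hψ⟩ := exists_contDiffOn_adjoint kb hO hS hG ht
  obtain ⟨ψ, hψ1, -, -, hψ2⟩ := hψ (ContinuousLinearMap.adjoint (S r) f)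
  have h1 := hH t ht _ ψ hψ1 hψ2
  have h2 := hH (r + t) (by positivity) f ψ hψ1
    (by rw [hS.adjoint_add_apply hr ht.le]; exact hψ2)
  rw [← ContinuousLinearMap.adjoint_inner_right]
  linarith

end Family

/-! ### The adjoint semigroup and orbits that are singular at the initial time -/

namespace IsC0Semigroup

section Hilbert

variable {H : Type*} [NormedAddCommGroup H] [InnerProductSpace ℝ H] [CompleteSpace H]
  {S : ℝ → H →L[ℝ] H} {M ω lam : ℝ}

theorem norm_adjoint_le (hM : ∀ t : ℝ, 0 ≤ t → ‖S t‖ ≤ M * Real.exp (ω * t)) (t : ℝ)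
    (ht : 0 ≤ t) : ‖ContinuousLinearMap.adjoint (S t)‖ ≤ M * Real.exp (ω * t) := by
  rw [LinearIsometryEquiv.norm_map]; exact hM t ht

/-- The adjoint of a `C₀`-semigroup on a Hilbert space is a `C₀`-semigroup. -/
protected theorem adjoint (hS : IsC0Semigroup S)
    (hM : ∀ t : ℝ, 0 ≤ t → ‖S t‖ ≤ M * Real.exp (ω * t)) :
    IsC0Semigroup (fun t => ContinuousLinearMap.adjoint (S t)) := by
  have hM0 := bound_nonneg hM
  refine ⟨?_, fun s t hs ht => ?_, fun u => ?_⟩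
  · simp only [hS.zero]
    exact ContinuousLinearMap.adjoint_id
  · rw [add_comm, hS.add t s ht hs, ContinuousLinearMap.adjoint_comp]
  set L : ℝ := ω + 1 with hL
  have hωL : ω < L := by simp [hL]
  obtain ⟨R, hR⟩ := hS.exists_resolvent hωL hM
  -- The generator maps R h to L R h - h, so R h = 0 forces h = 0. Injectivity of R makes the range
  -- of its adjoint dense, and strong continuity need be checked only there.
  have hinj : ∀ h, R h = 0 → h = 0 := by
    intro h hh
    have h1 := hS.generatorEq_resolvent hωL hM hR h
    rw [hh] at h1
    have h2 : Tendsto (fun _ : ℝ => (0 : H)) (𝓝[>] 0) (𝓝 (L • (0 : H) - h)) := by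
      simpa [GeneratorEq] using h1
    have := tendsto_nhds_unique h2 tendsto_const_nhds
    simpa using this
  have hdense : DenseRange (ContinuousLinearMap.adjoint R) := by
    have h1 : (LinearMap.range (ContinuousLinearMap.adjoint R : H →ₗ[ℝ] H)).topologicalClosure = ⊤ := by
      rw [Submodule.topologicalClosure_eq_top_iff, Submodule.eq_bot_iff]
      intro h hh
      refine hinj h (ext_inner_right ℝ fun g => ?_)
      rw [inner_zero_left, ← ContinuousLinearMap.adjoint_inner_right, real_inner_comm]
      exact (Submodule.mem_orthogonal _ _).1 hh _ ⟨g, rfl⟩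
    rw [DenseRange]
    exact Submodule.dense_iff_topologicalClosure_eq_top.2 h1
  set B : ℝ := M * Real.exp |ω| with hB
  have hB0 : 0 ≤ B := by positivity
  have hSB : ∀ t, 0 ≤ t → t ≤ 1 → ‖S t‖ ≤ B := by
    intro t ht ht1
    refine (hM t ht).trans ?_
    rw [hB]
    gcongr
    calc ω * t ≤ |ω| * t := by gcongr; exact le_abs_self ω
      _ ≤ |ω| := mul_le_of_le_one_right (abs_nonneg _) ht1
  -- the convergence on the range of the adjoint of the resolvent
  have hrange : ∀ g, Tendsto (fun t => ContinuousLinearMap.adjoint (S t)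
      (ContinuousLinearMap.adjoint R g)) (𝓝[>] 0) (𝓝 (ContinuousLinearMap.adjoint R g)) := by
    intro g
    rw [tendsto_iff_norm_sub_tendsto_zero]
    have hlim : Tendsto (fun τ : ℝ => ‖g‖ * (|Real.exp (L * τ) - 1| * ‖R‖
        + Real.exp (L * τ) * (Real.exp |L| * B * |τ - 0|))) (𝓝[>] 0) (𝓝 0) := by
      have : ContinuousAt (fun τ : ℝ => ‖g‖ * (|Real.exp (L * τ) - 1| * ‖R‖
        + Real.exp (L * τ) * (Real.exp |L| * B * |τ - 0|))) 0 := by fun_prop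
      simpa using this.tendsto.mono_left nhdsWithin_le_nhds
    refine squeeze_zero' (Eventually.of_forall fun _ => norm_nonneg _) ?_ hlim
    filter_upwards [Ioc_mem_nhdsGT one_pos] with τ hτ
    have hτ0 : 0 < τ := hτ.1
    -- The operators R S(τ) - R tend to 0 in norm; by duality so do their adjoints S^*(τ) R^* - R^*,
    -- which gives convergence on the range of R^*.
    have key : ∀ κ : H, ‖R (S τ κ) - R κ‖ ≤ (|Real.exp (L * τ) - 1| * ‖R‖
        + Real.exp (L * τ) * (Real.exp |L| * B * |τ - 0|)) * ‖κ‖ := by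
      intro κ
      have e : R (S τ κ) = S τ (R κ) := by rw [hR, hR, hS.map_resolvent hωL hM κ hτ0.le]
      have e2 : R (S τ κ) - R κ = (Real.exp (L * τ) - 1) • R κ - Real.exp (L * τ) •
          ∫ t in (0 : ℝ)..τ, Real.exp (-(L * t)) • S (max t 0) κ := by
        rw [e, hS.apply_resolvent_eq hωL hM hR κ hτ0]; module
      have e3 : ‖∫ t in (0 : ℝ)..τ, Real.exp (-(L * t)) • S (max t 0) κ‖
          ≤ (Real.exp |L| * (B * ‖κ‖)) * |τ - 0| := by
        refine intervalIntegral.norm_integral_le_of_norm_le_const fun t ht => ?_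
        rw [uIoc_of_le hτ0.le] at ht
        rw [norm_smul, Real.norm_of_nonneg (Real.exp_pos _).le, max_eq_left ht.1.le]
        gcongr
        · refine (neg_le_abs _).trans ?_
          rw [abs_mul, abs_of_pos ht.1]
          exact mul_le_of_le_one_right (abs_nonneg _) (ht.2.trans hτ.2)
        · exact (S t).le_of_opNorm_le (hSB t ht.1.le (ht.2.trans hτ.2)) _
      rw [e2]
      refine (norm_sub_le _ _).trans ?_
      rw [norm_smul, norm_smul, Real.norm_of_nonneg (Real.exp_pos (L * τ)).le, Real.norm_eq_abs]
      calc |Real.exp (L * τ) - 1| * ‖R κ‖ + Real.exp (L * τ) *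
            ‖∫ t in (0 : ℝ)..τ, Real.exp (-(L * t)) • S (max t 0) κ‖
          ≤ |Real.exp (L * τ) - 1| * (‖R‖ * ‖κ‖) + Real.exp (L * τ) *
            ((Real.exp |L| * (B * ‖κ‖)) * |τ - 0|) := by
            gcongr
            exact R.le_opNorm κ
        _ = _ := by ring
    have hpos : 0 ≤ ‖g‖ * (|Real.exp (L * τ) - 1| * ‖R‖
        + Real.exp (L * τ) * (Real.exp |L| * B * |τ - 0|)) := by positivity
    set z := ContinuousLinearMap.adjoint (S τ) (ContinuousLinearMap.adjoint R g)
      - ContinuousLinearMap.adjoint R g with hz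
    have h1 : ‖z‖ * ‖z‖ ≤ (‖g‖ * (|Real.exp (L * τ) - 1| * ‖R‖
        + Real.exp (L * τ) * (Real.exp |L| * B * |τ - 0|))) * ‖z‖ := by
      rw [← real_inner_self_eq_norm_mul_norm]
      have : ⟪z, z⟫ = ⟪g, R (S τ z) - R z⟫ := by
        conv_lhs => rw [hz]
        rw [inner_sub_left, ContinuousLinearMap.adjoint_inner_left,
          ContinuousLinearMap.adjoint_inner_left, ContinuousLinearMap.adjoint_inner_left,
          inner_sub_right]
      rw [this]
      refine (real_inner_le_norm _ _).trans ?_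
      rw [mul_assoc]
      gcongr
      exact key z
    rcases (norm_nonneg z).eq_or_lt with h0 | h0
    · rw [← h0]; exact hpos
    · exact le_of_mul_le_mul_right h1 h0
  rw [tendsto_iff_norm_sub_tendsto_zero, Metric.tendsto_nhds]
  intro ε hε
  obtain ⟨g, hg⟩ := hdense.exists_dist_lt u (ε := ε / (2 * (B + 1))) (by positivity)
  rw [dist_eq_norm] at hg
  have h2 := (Metric.tendsto_nhds.1 (hrange g)) (ε / 2) (by positivity)
  filter_upwards [h2, Ioc_mem_nhdsGT one_pos] with τ hτ hτ1
  rw [dist_eq_norm] at hτ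
  rw [Real.dist_0_eq_abs, abs_of_nonneg (norm_nonneg _)]
  set r := ContinuousLinearMap.adjoint R g
  have e : ContinuousLinearMap.adjoint (S τ) u - u
      = ContinuousLinearMap.adjoint (S τ) (u - r) + (ContinuousLinearMap.adjoint (S τ) r - r)
        - (u - r) := by rw [map_sub]; abel
  have h3 : ‖ContinuousLinearMap.adjoint (S τ) (u - r)‖ ≤ B * ‖u - r‖ := by
    refine ContinuousLinearMap.le_of_opNorm_le _ ?_ _
    rw [LinearIsometryEquiv.norm_map]; exact hSB τ hτ1.1.le hτ1.2
  rw [e]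
  have h4 : (B + 1) * ‖u - r‖ < ε / 2 := by
    rw [lt_div_iff₀ (by positivity)] at hg
    linarith
  calc _ ≤ ‖ContinuousLinearMap.adjoint (S τ) (u - r)‖
        + ‖ContinuousLinearMap.adjoint (S τ) r - r‖ + ‖u - r‖ :=
        (norm_sub_le _ _).trans (by gcongr; exact norm_add_le _ _)
    _ < ε := by linarith

end Hilbert

section Orbit

variable {H : Type*} [NormedAddCommGroup H] [NormedSpace ℝ H]
  {S : ℝ → H →L[ℝ] H} {M ω lam : ℝ}

/-- An orbit of the semigroup that blows up like `t ^ (-3/4)` at the initial time has a Laplace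
transform. -/
theorem integrableOn_orbit (hS : IsC0Semigroup S) (hω : ω < lam)
    (hM : ∀ t : ℝ, 0 ≤ t → ‖S t‖ ≤ M * Real.exp (ω * t)) {h : ℝ → H}
    (hh : ∀ r t, 0 ≤ r → 0 < t → S r (h t) = h (r + t)) {A : ℝ}
    (hA : ∀ t, 0 < t → t ≤ 1 → ‖h t‖ ≤ A * t ^ (-(3 / 4 : ℝ))) :
    IntegrableOn (fun t => Real.exp (-(lam * t)) • h t) (Ioi 0) := by
  have hcont : ContinuousOn h (Ioi 0) := by
    intro t ht
    have ht : 0 < t := ht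
    have h1 : ContinuousAt (fun s => S (max (s - t / 2) 0) (h (t / 2))) t :=
      ((hS.continuous_max hM (h (t / 2))).comp (by fun_prop : Continuous fun s => s - t / 2)).continuousAt
    refine (h1.congr ?_).continuousWithinAt
    filter_upwards [Ioi_mem_nhds (show t / 2 < t by linarith)] with s hs
    have hs : t / 2 < s := hs
    rw [max_eq_left (by linarith), hh _ _ (by linarith) (by positivity), sub_add_cancel]
  rw [← Ioc_union_Ioi_eq_Ioi zero_le_one]
  refine IntegrableOn.union ?_ ?_
  · have h1 : IntegrableOn (fun t : ℝ => Real.exp |lam| * (A * t ^ (-(3 / 4 : ℝ)))) (Ioc 0 1) := by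
      have := (intervalIntegral.intervalIntegrable_rpow' (a := 0) (b := 1)
        (show -1 < -(3 / 4 : ℝ) by norm_num))
      rw [intervalIntegrable_iff_integrableOn_Ioc_of_le zero_le_one] at this
      exact (this.const_mul A).const_mul _
    refine Integrable.mono' h1 ?_ ?_
    · refine ContinuousOn.aestronglyMeasurable ?_ measurableSet_Ioc
      exact (Continuous.continuousOn (by fun_prop)).smul (hcont.mono fun t ht => ht.1)
    · refine (ae_restrict_iff' measurableSet_Ioc).2 (Eventually.of_forall fun t ht => ?_)
      rw [norm_smul, Real.norm_of_nonneg (Real.exp_pos _).le]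
      refine mul_le_mul (Real.exp_le_exp.2 ?_) (hA t ht.1 ht.2) (norm_nonneg _) (Real.exp_pos _).le
      refine (neg_le_abs _).trans ?_
      rw [abs_mul, abs_of_pos ht.1]
      exact mul_le_of_le_one_right (abs_nonneg _) ht.2
  · rw [← integrableOn_Ioi_comp_add_right]
    refine IntegrableOn.congr_fun ((hS.integrableOn hω hM (h 1)).smul (Real.exp (-lam)))
      (fun t ht => ?_) measurableSet_Ioi
    have ht : 0 < t := ht
    simp only [Pi.smul_apply]
    rw [hh _ _ ht.le one_pos, smul_smul, ← Real.exp_add]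
    congr 2; ring

/-- Since S(τ) h(t) = h(τ + t) = S(t) h(τ), applying S(τ) to the Laplace transform of the singular
orbit gives the resolvent at h(τ). This is the identity S(ε) u₀ = R H(ε). -/
theorem apply_integral_orbit [CompleteSpace H] (hS : IsC0Semigroup S) (hω : ω < lam)
    (hM : ∀ t : ℝ, 0 ≤ t → ‖S t‖ ≤ M * Real.exp (ω * t)) {h : ℝ → H}
    (hh : ∀ r t, 0 ≤ r → 0 < t → S r (h t) = h (r + t)) {A : ℝ}
    (hA : ∀ t, 0 < t → t ≤ 1 → ‖h t‖ ≤ A * t ^ (-(3 / 4 : ℝ))) {τ : ℝ} (hτ : 0 < τ) :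
    S τ (∫ t in Ioi 0, Real.exp (-(lam * t)) • h t)
      = ∫ t in Ioi 0, Real.exp (-(lam * t)) • S t (h τ) := by
  rw [← ContinuousLinearMap.integral_comp_comm _ (hS.integrableOn_orbit hω hM hh hA)]
  refine setIntegral_congr_fun measurableSet_Ioi fun t ht => ?_
  have ht : 0 < t := ht
  simp only [map_smul]
  rw [hh _ _ hτ.le ht, hh _ _ ht.le hτ, add_comm]

end Orbit

end IsC0Semigroup

/-! ### Uniqueness of the Dirichlet map -/

section Uniqueness

variable {α : ℝ≥0} {a : Sp d → Matrix (Fin d) (Fin d) ℝ} {γ : Sp d → ℝ}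
  {S : ℝ → L2 O →L[ℝ] L2 O} {G : ℝ → Sp d → Sp d → ℝ} {C c M ω lam : ℝ}

theorem IsDirichletMapValue.unique (kb : KernelBounds O G C c) (hO : IsC1HolderDomain α O)
    (hS : IsC0Semigroup S) (hG : IsGreenKernel O S G) (hω : ω < lam)
    (hM : ∀ t : ℝ, 0 ≤ t → ‖S t‖ ≤ M * Real.exp (ω * t)) {u v : L2 O}
    (hu : IsDirichletMapValue a O S lam γ u) (hv : IsDirichletMapValue a O S lam γ v) : u = v := by
  have hS' := hS.adjoint hM
  have hM' := IsC0Semigroup.norm_adjoint_le hM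
  obtain ⟨R, hR⟩ := hS'.exists_resolvent hω hM'
  have key : ∀ ε, 0 < ε → S ε (u - v) = 0 := by
    intro ε hε
    refine ext_inner_right ℝ fun f => ?_
    obtain ⟨A, hA0, hψ⟩ := exists_contDiffOn_adjoint kb hO hS hG hε
    set g := ContinuousLinearMap.adjoint (S ε) f with hg
    have hp : R g = ContinuousLinearMap.adjoint (S ε) (R f) := by
      rw [hR, hR]; exact (hS'.map_resolvent hω hM' f hε.le).symm
    obtain ⟨ψ, hψ1, hψ2, -, hψ3⟩ := hψ (R f)
    obtain ⟨φ, hφ1, -, hφ2, hφ3⟩ := hψ f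
    -- Here ψ is a C^1 version of R g, where R is the resolvent of A^*, so (A^* - lam) R g = -g. The
    -- regularity of ψ uses R g = S^*(ε) R f, and the boundedness of g uses g = S^*(ε) f.
    have htest : IsTestFunction O S lam ψ (-g) := by
      refine ⟨hψ1, hψ2, ?_, R g, lam • R g - g, hp ▸ hψ3,
        hS'.generatorEq_resolvent hω hM' hR g, by abel⟩
      refine memLp_top_of_bound (Lp.aestronglyMeasurable _) (A * ‖f‖) ?_
      filter_upwards [Lp.coeFn_neg g, hφ3, ae_restrict_mem hO.isOpen.measurableSet]
        with x hx hx2 hxO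
      rw [hx, Pi.neg_apply, norm_neg, hg, hx2]
      exact hφ2 x (subset_closure hxO)
    have h1 := hu ψ (-g) htest
    have h2 := hv ψ (-g) htest
    rw [← inner_L2_eq] at h1 h2
    rw [inner_zero_left, ← ContinuousLinearMap.adjoint_inner_right, inner_sub_left]
    rw [← hg]
    rw [inner_neg_right] at h1 h2
    linarith
  have h0 := hS.tendsto (u - v)
  have h1 : Tendsto (fun t => S t (u - v)) (𝓝[>] 0) (𝓝 0) := by
    refine tendsto_const_nhds.congr' ?_
    filter_upwards [self_mem_nhdsWithin] with t ht using (key t ht).symm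
  exact sub_eq_zero.1 (tendsto_nhds_unique h0 h1)

end Uniqueness

/-! ### Averages over small balls -/

theorem measure_restrict_ball_ne_top (O : Set (Sp d)) (y : Sp d) (δ : ℝ) :
    volume.restrict O (Metric.ball y δ) ≠ ∞ :=
  ((Measure.restrict_apply_le _ _).trans_lt measure_ball_lt_top).ne

/-- The indicator function of a ball, as an element of `L²(O)`. -/
def ballIndicator (O : Set (Sp d)) (y : Sp d) (δ : ℝ) : L2 O :=
  indicatorConstLp 2 (measurableSet_ball (x := y) (ε := δ)) (measure_restrict_ball_ne_top O y δ) 1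

theorem inner_ballIndicator {f : L2 O} {F : Sp d → ℝ} (h : f =ᵐ[volume.restrict O] F) {y : Sp d}
    {δ : ℝ} (hB : Metric.ball y δ ⊆ O) :
    ⟪ballIndicator O y δ, f⟫ = ∫ z in Metric.ball y δ, F z := by
  rw [ballIndicator, L2.inner_indicatorConstLp_one, Measure.restrict_restrict measurableSet_ball,
    inter_eq_left.2 hB]
  exact integral_congr_ae (ae_restrict_of_ae_restrict_of_subset hB h)

/-- Averages over small balls converge to the value at a point of continuity. Arbitrarily small
radii suffice, so the bound may be known only along a sequence. -/
theorem abs_le_of_frequently_setIntegral_ball {F : Sp d → ℝ} {U : Set (Sp d)} {y : Sp d}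
    (hU : U ∈ 𝓝 y) (hF : ContinuousOn F U) {N : ℝ}
    (h : ∃ᶠ δ in 𝓝[>] (0 : ℝ), |∫ z in Metric.ball y δ, F z|
      ≤ N * volume.real (Metric.ball y δ)) : |F y| ≤ N := by
  refine le_of_forall_pos_le_add fun e he => ?_
  have h1 : {z | |F z - F y| < e} ∩ U ∈ 𝓝 y := by
    refine inter_mem ?_ hU
    have := (Metric.tendsto_nhds.1 (hF.continuousAt hU)) e he
    simp only [Real.dist_eq] at this
    exact this
  obtain ⟨r, hr, hrU⟩ := Metric.nhds_basis_closedBall.mem_iff.1 h1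
  obtain ⟨δ, hδ, hδr⟩ := (h.and_eventually (Ioc_mem_nhdsGT hr)).exists
  have hsub : Metric.ball y δ ⊆ Metric.closedBall y r :=
    Metric.ball_subset_closedBall.trans (Metric.closedBall_subset_closedBall hδr.2)
  have hint : IntegrableOn F (Metric.ball y δ) :=
    ((hF.mono fun z hz => (hrU hz).2).integrableOn_compact (isCompact_closedBall y r)).mono_set hsub
  have hV : 0 < volume.real (Metric.ball y δ) :=
    ENNReal.toReal_pos (Metric.measure_ball_pos volume y hδr.1).ne' measure_ball_lt_top.ne
  have hconst : IntegrableOn (fun _ : Sp d => F y) (Metric.ball y δ) :=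
    integrableOn_const measure_ball_lt_top.ne
  have h2 : |∫ z in Metric.ball y δ, (F z - F y)| ≤ e * volume.real (Metric.ball y δ) := by
    rw [← Real.norm_eq_abs]
    exact norm_setIntegral_le_of_norm_le_const measure_ball_lt_top
      fun z hz => (hrU (hsub hz)).1.le
  rw [integral_sub hint hconst, setIntegral_const, smul_eq_mul] at h2
  have h3 : |F y| * volume.real (Metric.ball y δ)
      ≤ (N + e) * volume.real (Metric.ball y δ) := by
    have : |F y| * volume.real (Metric.ball y δ) = |volume.real (Metric.ball y δ) * F y| := by
      rw [abs_mul, abs_of_pos hV, mul_comm]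
    rw [this, add_mul]
    have h4 := abs_sub_abs_le_abs_sub (volume.real (Metric.ball y δ) * F y)
      (∫ z in Metric.ball y δ, F z)
    rw [abs_sub_comm] at h4
    linarith
  exact le_of_mul_le_mul_right h3 hV

theorem setIntegral_ball_translate (F : Sp d → ℝ) (y y' : Sp d) (δ : ℝ) :
    ∫ z in Metric.ball y' δ, F z = ∫ z in Metric.ball y δ, F (z + (y' - y)) := by
  have := (measurePreserving_add_right (volume : Measure (Sp d)) (y' - y)).setIntegral_preimage_emb
    (measurableEmbedding_addRight _) F (Metric.ball y' δ)
  rw [← this]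
  congr 2
  ext z
  simp only [mem_preimage, Metric.mem_ball, dist_eq_norm]
  congr! 2
  abel

/-! ### Existence of the Dirichlet map -/

section Existence

variable {α : ℝ≥0} {K : Set (Sp d)} {a : Sp d → Matrix (Fin d) (Fin d) ℝ} {γ : Sp d → ℝ}
  {S : ℝ → L2 O →L[ℝ] L2 O} {G : ℝ → Sp d → Sp d → ℝ} {C c M ω lam : ℝ}

/-- If `(A^* - lam) p` is bounded, then `p - exp (-lam * ε) S^*(ε) p` is small in `C^1`. -/
theorem norm_fderivWithin_sub_kernelAdjoint_le (kb : KernelBounds O G C c)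
    (hO : IsC1HolderDomain α O) (hS : IsC0Semigroup S) (hG : IsGreenKernel O S G)
    (hM : ∀ t : ℝ, 0 ≤ t → ‖S t‖ ≤ M * Real.exp (ω * t)) {p q : L2 O}
    (hp : GeneratorEq (adjointSemigroup S) p q) {B : ℝ}
    (hB : ∀ᵐ x ∂(volume.restrict O), |(q - lam • p : L2 O) x| ≤ B) {ψ : Sp d → ℝ}
    (hψ : ContDiffOn ℝ 1 ψ (closure O)) (hpψ : p =ᵐ[volume.restrict O] ψ) {ε : ℝ} (hε : 0 < ε)
    (hε1 : ε ≤ 1) {y : Sp d} (hy : y ∈ closure O) :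
    ‖fderivWithin ℝ (fun y => ψ y - Real.exp (-(lam * ε)) * kernelAdjoint O G ε p y)
      (closure O) y‖ ≤ 2 * Real.exp |lam| * (C * B) * Real.sqrt ε := by
  have hC := kb.C_pos
  set η : Sp d → ℝ := fun y => ψ y - Real.exp (-(lam * ε)) * kernelAdjoint O G ε p y with hη
  have hK := (kb.contDiffOn_kernelAdjoint hO hε hε1 p).1
  have hη1 : ContDiffOn ℝ 1 η (closure O) := hψ.sub (contDiffOn_const.mul hK)
  have hB0 : 0 ≤ B := by
    have h1 := (norm_nonneg _).trans
      (kb.fderivWithin_kernelAdjoint_le_of_bounded hO one_pos le_rfl _ hB hy)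
    rw [Real.sqrt_one, div_one] at h1
    exact nonneg_of_mul_nonneg_right h1 hC
  set N := 2 * Real.exp |lam| * (C * B) * Real.sqrt ε with hN
  have hN0 : 0 ≤ N := by positivity
  suffices hint : ∀ y ∈ O, ‖fderivWithin ℝ η (closure O) y‖ ≤ N from
    le_on_closure (hη1.continuousOn_fderivWithin (uniqueDiffOn_closure hO) le_rfl).norm
      continuous_const hint y hy
  intro y hyO
  rw [fderivWithin_closure_eq hO.isOpen hyO]
  have hcl : closure O ∈ 𝓝 y := mem_of_superset (hO.isOpen.mem_nhds hyO) subset_closure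
  -- The gradient bound is reduced to a Lipschitz bound for η near y, and that in turn to averages
  -- of increments of η, which are L² pairings. The identity for p - exp(-lam ε) S^*(ε) p is then
  -- needed only weakly, with no differentiation of a time integral.
  refine ((hη1.contDiffAt hcl).differentiableAt one_ne_zero).hasFDerivAt.le_of_lip' hN0 ?_
  obtain ⟨r, hr, hrO⟩ := Metric.isOpen_iff.1 hO.isOpen y hyO
  filter_upwards [Metric.ball_mem_nhds y hr] with y' hy'
  have hyr : y ∈ Metric.ball y r := Metric.mem_ball_self hr
  -- the bound for averages
  have hshift : ContinuousOn (fun z => η (z + (y' - y))) (Metric.ball y (r - ‖y' - y‖)) := by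
    refine (hη1.continuousOn.mono subset_closure).comp (by fun_prop) fun z hz => hrO ?_
    rw [Metric.mem_ball, dist_eq_norm] at hz ⊢
    have : z + (y' - y) - y = (z - y) + (y' - y) := by abel
    rw [this]
    exact (norm_add_le _ _).trans_lt (by linarith)
  have hy'r : ‖y' - y‖ < r := by rwa [← dist_eq_norm]
  set ρ := r - ‖y' - y‖ with hρ
  have hρ0 : 0 < ρ := by simp only [hρ]; linarith
  have hρr : ρ ≤ r := by simp only [hρ]; linarith [norm_nonneg (y' - y)]
  have hηc : ContinuousOn η (Metric.ball y ρ) :=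
    hη1.continuousOn.mono (((Metric.ball_subset_ball hρr).trans hrO).trans subset_closure)
  have hgoal := abs_le_of_frequently_setIntegral_ball (Metric.ball_mem_nhds y hρ0)
    (hshift.sub hηc) (N := N * ‖y' - y‖) (Eventually.frequently ?_)
  · simpa using hgoal
  filter_upwards [Ioo_mem_nhdsGT hρ0] with δ hδ
  have hb1 : Metric.ball y δ ⊆ Metric.ball y r := Metric.ball_subset_ball (by linarith [hδ.2])
  have hb2 : Metric.ball y' δ ⊆ Metric.ball y r := by
    refine Metric.ball_subset_ball' ?_
    rw [dist_eq_norm]; linarith [hδ.2]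
  set V := volume.real (Metric.ball y δ)
  have hV : 0 ≤ V := measureReal_nonneg
  -- Pairing with κ integrates the increments F(z + (y' - y)) - F(z) over a small ball. For F =
  -- S^*(t)(q - lam p) they are at most C B t^(-1/2) ‖y' - y‖, and integration in t gives √ε.
  set κ : L2 O := ballIndicator O y' δ - ballIndicator O y δ with hκ
  have hpair : ∀ (g : L2 O) (F : Sp d → ℝ), g =ᵐ[volume.restrict O] F →
      ContinuousOn F (closure O) →
      ⟪κ, g⟫ = ∫ z in Metric.ball y δ, (F (z + (y' - y)) - F z) := by
    intro g F hgF hF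
    have hcb : Metric.closedBall y δ ⊆ Metric.ball y r :=
      Metric.closedBall_subset_ball (by linarith [hδ.2])
    have hi2 : IntegrableOn F (Metric.ball y δ) :=
      ((hF.mono ((hcb.trans hrO).trans subset_closure)).integrableOn_compact
        (isCompact_closedBall y δ)).mono_set Metric.ball_subset_closedBall
    have hi1 : IntegrableOn (fun z => F (z + (y' - y))) (Metric.ball y δ) := by
      have hc : ContinuousOn (fun z => F (z + (y' - y))) (Metric.closedBall y δ) := by
        refine hF.comp (by fun_prop) fun z hz => subset_closure (hrO ?_)
        rw [Metric.mem_closedBall, dist_eq_norm] at hz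
        rw [Metric.mem_ball, dist_eq_norm]
        have : z + (y' - y) - y = (z - y) + (y' - y) := by abel
        rw [this]
        exact (norm_add_le _ _).trans_lt (by linarith [hδ.2])
      exact (hc.integrableOn_compact (isCompact_closedBall y δ)).mono_set
        Metric.ball_subset_closedBall
    rw [integral_sub hi1 hi2, ← setIntegral_ball_translate, hκ, inner_sub_left,
      inner_ballIndicator hgF (hb2.trans hrO), inner_ballIndicator hgF (hb1.trans hrO)]
  have hN1 : ∀ t, 0 < t → t ≤ ε → |⟪q - lam • p, S t κ⟫|
      ≤ (C * B * ‖y' - y‖ * V) / Real.sqrt t := by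
    intro t ht hte
    have ht1 := hte.trans hε1
    have hKt := (kb.contDiffOn_kernelAdjoint hO ht ht1 (q - lam • p)).1
    rw [← ContinuousLinearMap.adjoint_inner_left, real_inner_comm,
      hpair _ _ (kb.kernelAdjoint_ae_eq hO.isOpen hG ht ht1 _) hKt.continuousOn,
      ← Real.norm_eq_abs]
    have e : C * B * ‖y' - y‖ * V / Real.sqrt t = (C * B / Real.sqrt t * ‖y' - y‖) * V := by ring
    rw [e]
    refine norm_setIntegral_le_of_norm_le_const measure_ball_lt_top fun z hz => ?_
    have hz1 := hb1 hz
    have hz2 : z + (y' - y) ∈ Metric.ball y r := by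
      apply hb2
      rw [Metric.mem_ball, dist_eq_norm] at hz ⊢
      convert hz using 2; abel
    have := (convex_ball y r).norm_image_sub_le_of_norm_fderiv_le (𝕜 := ℝ)
      (f := kernelAdjoint O G t (q - lam • p : L2 O)) (C := C * B / Real.sqrt t) (fun w hw =>
        (hKt.contDiffAt (mem_of_superset (hO.isOpen.mem_nhds (hrO hw))
          subset_closure)).differentiableAt one_ne_zero) (fun w hw => by
        rw [← fderivWithin_closure_eq hO.isOpen (hrO hw)]
        exact kb.fderivWithin_kernelAdjoint_le_of_bounded hO ht ht1 _ hB
          (subset_closure (hrO hw))) hz1 hz2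
    simpa using this
  have hmain := hS.abs_inner_sub_le hM (κ := κ) hp hε hε1 hN1
  have e1 : ⟪p, κ⟫ - Real.exp (-(lam * ε)) * ⟪p, S ε κ⟫
      = ∫ z in Metric.ball y δ, (η (z + (y' - y)) - η z) := by
    rw [← hpair (p - Real.exp (-(lam * ε)) • ContinuousLinearMap.adjoint (S ε) p) η ?_
      hη1.continuousOn, inner_sub_right κ, inner_smul_right, ContinuousLinearMap.adjoint_inner_right,
      real_inner_comm p, real_inner_comm p]
    · filter_upwards [Lp.coeFn_sub p (Real.exp (-(lam * ε)) • ContinuousLinearMap.adjoint (S ε) p),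
        Lp.coeFn_smul (Real.exp (-(lam * ε))) (ContinuousLinearMap.adjoint (S ε) p), hpψ,
        kb.kernelAdjoint_ae_eq hO.isOpen hG hε hε1 p] with x h1 h2 h3 h4
      rw [h1, Pi.sub_apply, h2, Pi.smul_apply, h3, h4, smul_eq_mul]
  rw [e1] at hmain
  refine hmain.trans (le_of_eq ?_)
  simp only [hN]; ring

/-- The Laplace transform of the boundary family is the solution of the Poisson problem. -/
theorem isDirichletMapValue_of_apply_eq (kb : KernelBounds O G C c) (bd : BoundaryDatum a O γ K)
    (hO : IsC1HolderDomain α O) (hS : IsC0Semigroup S) (hG : IsGreenKernel O S G) (hω : ω < lam)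
    (hM : ∀ t : ℝ, 0 ≤ t → ‖S t‖ ≤ M * Real.exp (ω * t)) {R : L2 O →L[ℝ] L2 O}
    (hR : ∀ h, R h = ∫ t in Ioi 0, Real.exp (-(lam * t)) • S t h) {H : ℝ → L2 O}
    (hH : IsBoundaryFamily a O γ S H) {u : L2 O} (hu : ∀ ε, 0 < ε → S ε u = R (H ε)) :
    IsDirichletMapValue a O S lam γ u := by
  intro ψ f ⟨hψ, hψ0, hf, p, q, hpψ, hpq, hfpq⟩
  rw [← inner_L2_eq]
  obtain ⟨B, hB⟩ : ∃ B : ℝ, ∀ᵐ x ∂(volume.restrict O), |(q - lam • p : L2 O) x| ≤ B := by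
    refine ⟨(eLpNorm f ∞ (volume.restrict O)).toReal, ?_⟩
    rw [← hfpq]
    have h1 := enorm_ae_le_eLpNormEssSup f (volume.restrict O)
    filter_upwards [h1] with x hx
    rw [eLpNorm_exponent_top, ← Real.norm_eq_abs, ← toReal_enorm]
    refine ENNReal.toReal_mono ?_ hx
    rw [← eLpNorm_exponent_top]; exact hf.2.ne
  obtain ⟨A, hA0, hA⟩ := bd.exists_abs_boundaryPairing_le hO
  -- Since (A - lam) R H(ε) = -H(ε), duality gives ⟪R H(ε), f⟫ = -⟪H(ε), p⟫, which is the boundary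
  -- pairing with S^*(ε) p.
  have hpair : ∀ ε, 0 < ε → ε ≤ 1 → boundaryPairing a O γ (kernelAdjoint O G ε p)
      = ⟪S ε u, f⟫ := by
    intro ε hε hε1
    have h1 := IsC0Semigroup.inner_generator_eq (hS.generatorEq_resolvent hω hM hR (H ε)) hpq
    have h2 := hH ε hε p _ (kb.contDiffOn_kernelAdjoint hO hε hε1 p).1
      (kb.kernelAdjoint_ae_eq hO.isOpen hG hε hε1 p)
    rw [h2, hu ε hε, hfpq, inner_sub_right, ← h1, inner_sub_left, inner_smul_left,
      inner_smul_right]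
    simp
  have hlim1 : Tendsto (fun ε => boundaryPairing a O γ ψ
      - Real.exp (-(lam * ε)) * ⟪S ε u, f⟫) (𝓝[>] 0) (𝓝 (boundaryPairing a O γ ψ - 1 * ⟪u, f⟫)) := by
    refine tendsto_const_nhds.sub (Tendsto.mul ?_ ((hS.tendsto u).inner tendsto_const_nhds))
    have : ContinuousAt (fun ε : ℝ => Real.exp (-(lam * ε))) 0 := by fun_prop
    simpa using this.tendsto.mono_left nhdsWithin_le_nhds
  have hlim2 : Tendsto (fun ε => boundaryPairing a O γ ψ
      - Real.exp (-(lam * ε)) * ⟪S ε u, f⟫) (𝓝[>] 0) (𝓝 0) := by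
    have h0 : Tendsto (fun ε : ℝ => A * (2 * Real.exp |lam| * (C * B) * Real.sqrt ε)) (𝓝[>] 0)
        (𝓝 0) := by
      have : ContinuousAt (fun ε : ℝ => A * (2 * Real.exp |lam| * (C * B) * Real.sqrt ε)) 0 := by
        fun_prop
      simpa using this.tendsto.mono_left nhdsWithin_le_nhds
    refine squeeze_zero_norm' ?_ h0
    filter_upwards [Ioc_mem_nhdsGT one_pos] with ε hε
    rw [← hpair ε hε.1 hε.2, ← boundaryPairing_sub_const_mul bd hO hψ
      (kb.contDiffOn_kernelAdjoint hO hε.1 hε.2 p).1]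
    exact hA _ _ fun y hy => norm_fderivWithin_sub_kernelAdjoint_le kb hO hS hG hM hpq hB hψ hpψ
      hε.1 hε.2 (frontier_subset_closure hy)
  have := tendsto_nhds_unique hlim1 hlim2
  change _ = boundaryPairing a O γ ψ
  linarith

end Existence

/-! ### The kernel as an orbit of the adjoint semigroup -/

open Classical in
/-- The function `G s x ·`, for `x ∈ O`, as an element of `L²(O)`. -/
def kernelSlice (O : Set (Sp d)) (G : ℝ → Sp d → Sp d → ℝ) (s : ℝ) (x : Sp d) : L2 O :=
  if h : x ∈ O ∧ MemLp (fun y => G s x y) 2 (volume.restrict O) then h.2.toLp _ else 0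

section Kernel

variable {α : ℝ≥0} {K : Set (Sp d)} {a : Sp d → Matrix (Fin d) (Fin d) ℝ} {γ : Sp d → ℝ}
  {S : ℝ → L2 O →L[ℝ] L2 O} {G : ℝ → Sp d → Sp d → ℝ} {C c : ℝ}

theorem inner_kernelSlice (kb : KernelBounds O G C c) (hO : IsOpen O) {s : ℝ} (hs : 0 < s)
    (hs1 : s ≤ 1) {x : Sp d} (hx : x ∈ O) (g : L2 O) :
    ⟪kernelSlice O G s x, g⟫ = ∫ y in O, G s x y * g y := by
  have h := kb.memLp_right hO hs hs1 hx
  rw [inner_L2_eq]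
  refine integral_congr_ae ?_
  have h1 : kernelSlice O G s x =ᵐ[volume.restrict O] fun y => G s x y := by
    rw [kernelSlice, dif_pos ⟨hx, h⟩]; exact h.coeFn_toLp
  filter_upwards [h1] with y hy
  rw [hy]

theorem apply_ae_eq_inner_kernelSlice (kb : KernelBounds O G C c) (hO : IsOpen O)
    (hG : IsGreenKernel O S G) {s : ℝ} (hs : 0 < s) (hs1 : s ≤ 1) (g : L2 O) :
    ∀ᵐ x ∂(volume.restrict O), S s g x = ⟪kernelSlice O G s x, g⟫ := by
  filter_upwards [hG.apply_eq s hs g, ae_restrict_mem hO.measurableSet] with x hx hxO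
  rw [hx.2, inner_kernelSlice kb hO hs hs1 hxO]

theorem stronglyMeasurable_inner_kernelSlice (kb : KernelBounds O G C c) (hO : IsOpen O) {s : ℝ}
    (hs : 0 < s) (hs1 : s ≤ 1) (g : L2 O) :
    StronglyMeasurable fun x => ⟪kernelSlice O G s x, g⟫ := by
  have h1 : (fun x => ⟪kernelSlice O G s x, g⟫)
      = O.indicator fun x => ∫ y in O, G s x y * g y := by
    ext x
    by_cases hx : x ∈ O
    · rw [indicator_of_mem hx, inner_kernelSlice kb hO hs hs1 hx]
    · rw [indicator_of_notMem hx, kernelSlice, dif_neg fun h => hx h.1, inner_zero_left]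
  rw [h1]
  refine StronglyMeasurable.indicator ?_ hO.measurableSet
  refine StronglyMeasurable.integral_prod_right (f := fun x y => G s x y * g y) ?_
  refine StronglyMeasurable.mul ?_ ((Lp.stronglyMeasurable g).comp_measurable measurable_snd)
  exact (kb.measurable.comp (measurable_const.prodMk measurable_id)).stronglyMeasurable

/-- For almost all `x`, the function `G (s + r) x ·` is the image of `G s x ·` under `S^*(r)`. -/
theorem kernel_add_ae_eq (kb : KernelBounds O G C c) (hO : IsC1HolderDomain α O)
    (hS : IsC0Semigroup S) (hG : IsGreenKernel O S G) {s r : ℝ} (hs : 0 < s) (hs1 : s ≤ 1)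
    (hr : 0 < r) : ∀ᵐ x ∂(volume.restrict O),
      ContinuousLinearMap.adjoint (S r) (kernelSlice O G s x) =ᵐ[volume.restrict O]
        fun y => G (s + r) x y := by
  set D := TopologicalSpace.denseSeq (Sp d)
  -- The exceptional null set depends on the test function, so only countably many are used:
  -- indicators of balls with centres in a dense sequence and radii 1/(n+1). Shrinking radii
  -- identify the two continuous functions at the centres lying in O, and density does the rest.
  have hall : ∀ᵐ x ∂(volume.restrict O), ∀ i n : ℕ,
      S (s + r) (ballIndicator O (D i) (1 / ((n : ℝ) + 1))) x
        = ∫ y in O, G (s + r) x y * ballIndicator O (D i) (1 / ((n : ℝ) + 1)) y ∧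
      S s (S r (ballIndicator O (D i) (1 / ((n : ℝ) + 1)))) x
        = ⟪kernelSlice O G s x, S r (ballIndicator O (D i) (1 / ((n : ℝ) + 1)))⟫ := by
    refine ae_all_iff.2 fun i => ae_all_iff.2 fun n => ?_
    filter_upwards [hG.apply_eq (s + r) (by positivity) (ballIndicator O (D i) (1 / ((n : ℝ) + 1))),
      apply_ae_eq_inner_kernelSlice kb hO.isOpen hG hs hs1
        (S r (ballIndicator O (D i) (1 / ((n : ℝ) + 1))))] with x h1 h2
    exact ⟨h1.2, h2⟩
  obtain ⟨A, -, hψ⟩ := exists_contDiffOn_adjoint kb hO hS hG hr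
  filter_upwards [hall, ae_restrict_mem hO.isOpen.measurableSet] with x hx hxO
  obtain ⟨ψ, hψ1, -, -, hψ2⟩ := hψ (kernelSlice O G s x)
  have hG1 := (hG.contDiffOn (s + r) (by positivity) x hxO).continuousOn
  refine hψ2.trans ?_
  have hDO : EqOn ψ (G (s + r) x) (O ∩ range D) := by
    rintro _ ⟨hi, i, rfl⟩
    refine sub_eq_zero.1 (abs_nonpos_iff.1 ?_)
    refine abs_le_of_frequently_setIntegral_ball (F := fun y => ψ y - G (s + r) x y)
      (hO.isOpen.mem_nhds hi)
      ((hψ1.continuousOn.sub hG1).mono subset_closure) ?_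
    obtain ⟨ρ, hρ, hρO⟩ := Metric.isOpen_iff.1 hO.isOpen _ hi
    have hseq : Tendsto (fun n : ℕ => 1 / ((n : ℝ) + 1)) atTop (𝓝[>] 0) :=
      tendsto_nhdsWithin_iff.2 ⟨tendsto_one_div_add_atTop_nhds_zero_nat,
        Eventually.of_forall fun n => mem_Ioi.2 (by positivity)⟩
    refine hseq.frequently (Eventually.frequently ?_)
    filter_upwards [hseq.eventually (Ioo_mem_nhdsGT hρ)] with n hn
    have hcb : Metric.closedBall (D i) (1 / ((n : ℝ) + 1)) ⊆ O :=
      (Metric.closedBall_subset_ball hn.2).trans hρO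
    have hb : Metric.ball (D i) (1 / ((n : ℝ) + 1)) ⊆ O := Metric.ball_subset_closedBall.trans hcb
    have hint : ∀ F : Sp d → ℝ, ContinuousOn F (closure O) →
        IntegrableOn F (Metric.ball (D i) (1 / ((n : ℝ) + 1))) := fun F hF =>
      ((hF.mono (hcb.trans subset_closure)).integrableOn_compact
        (isCompact_closedBall _ _)).mono_set Metric.ball_subset_closedBall
    obtain ⟨h1, h2⟩ := hx i n
    have h3 : ∫ y in O, G (s + r) x y * ballIndicator O (D i) (1 / ((n : ℝ) + 1)) y
        = ∫ y in Metric.ball (D i) (1 / ((n : ℝ) + 1)), G (s + r) x y := by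
      have e : ∫ y in O, G (s + r) x y * ballIndicator O (D i) (1 / ((n : ℝ) + 1)) y
          = ∫ y in O, (Metric.ball (D i) (1 / ((n : ℝ) + 1))).indicator (G (s + r) x) y := by
        refine integral_congr_ae ?_
        filter_upwards [indicatorConstLp_coeFn (p := 2)
          (hs := measurableSet_ball (x := D i) (ε := 1 / ((n : ℝ) + 1)))
          (hμs := measure_restrict_ball_ne_top O (D i) (1 / ((n : ℝ) + 1))) (c := (1 : ℝ))]
          with y hy
        rw [ballIndicator, hy]
        by_cases h : y ∈ Metric.ball (D i) (1 / ((n : ℝ) + 1))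
        · rw [indicator_of_mem h, indicator_of_mem h, mul_one]
        · rw [indicator_of_notMem h, indicator_of_notMem h, mul_zero]
      rw [e, integral_indicator measurableSet_ball, Measure.restrict_restrict measurableSet_ball,
        inter_eq_left.2 hb]
    rw [integral_sub (hint _ hψ1.continuousOn) (hint _ hG1), ← inner_ballIndicator hψ2 hb, ← h3,
      ← h1, hS.add_apply hs.le hr.le, h2, ContinuousLinearMap.adjoint_inner_right,
      real_inner_comm, sub_self]
    simp
  have hEq : EqOn ψ (G (s + r) x) O :=
    hDO.of_subset_closure (hψ1.continuousOn.mono subset_closure) (hG1.mono subset_closure)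
      inter_subset_left ((TopologicalSpace.denseRange_denseSeq (Sp d)).open_subset_closure_inter
        hO.isOpen)
  exact (ae_restrict_iff' hO.isOpen.measurableSet).2 (Eventually.of_forall fun y hy => hEq hy)

/-- The values of the boundary family are boundary integrals against the conormal derivative of
the kernel. -/
theorem boundaryFamily_ae_eq (kb : KernelBounds O G C c) (bd : BoundaryDatum a O γ K)
    (hO : IsC1HolderDomain α O) (hS : IsC0Semigroup S) (hG : IsGreenKernel O S G)
    {H : ℝ → L2 O} (hH : IsBoundaryFamily a O γ S H) {t : ℝ} (ht : 0 < t) :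
    ∀ᵐ x ∂(volume.restrict O),
      Integrable (fun y => γ y * conormalDeriv a O (G t x) y) (surfaceMeasure O) ∧
      H t x = -boundaryPairing a O γ (G t x) := by
  -- Any s ≤ 1 with 0 < s < t works: the kernel bounds apply at time s, and a positive time t - s
  -- remains for smoothing.
  set s := min t 1 / 2 with hs
  have hs0 : 0 < s := by have := lt_min ht one_pos; positivity
  have hs1 : s ≤ 1 := by have := min_le_right t 1; linarith
  have hst : s < t := by have := min_le_left t 1; linarith
  have e : s + (t - s) = t := by ring
  have h1 := kernel_add_ae_eq kb hO hS hG hs0 hs1 (sub_pos.2 hst)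
  have h2 := apply_ae_eq_inner_kernelSlice kb hO.isOpen hG hs0 hs1 (H (t - s))
  rw [hH.map_eq kb hO hS hG hs0.le (sub_pos.2 hst), e] at h2
  rw [e] at h1
  filter_upwards [h1, h2, ae_restrict_mem hO.isOpen.measurableSet] with x h1 h2 hxO
  have hG1 := hG.contDiffOn t ht x hxO
  refine ⟨bd.integrable_conormalDeriv hO hG1, ?_⟩
  rw [hH (t - s) (sub_pos.2 hst) _ _ hG1 h1, h2, neg_neg, real_inner_comm]

end Kernel

/-! ### The Laplace transform of the kernel away from the initial time -/

section Tail

variable {α : ℝ≥0} {K : Set (Sp d)} {a : Sp d → Matrix (Fin d) (Fin d) ℝ} {γ : Sp d → ℝ}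
  {S : ℝ → L2 O →L[ℝ] L2 O} {G : ℝ → Sp d → Sp d → ℝ} {C c M ω lam : ℝ}

theorem KernelBounds.kernelAdjoint_eq_inner (kb : KernelBounds O G C c) (hO : IsOpen O) {s : ℝ}
    (hs : 0 < s) (hs1 : s ≤ 1) {y : Sp d} (hy : y ∈ closure O) (g : L2 O) :
    kernelAdjoint O G s g y = ⟪(kb.memLp_left hO hs hs1 hy).toLp _, g⟫ := by
  rw [inner_L2_eq]
  refine integral_congr_ae ?_
  filter_upwards [(kb.memLp_left hO hs hs1 hy).coeFn_toLp] with x hx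
  rw [hx]

/-- For almost all `x`, for almost all later times, the kernel `G t x ·` is the image of `G s x ·`
under the adjoint semigroup, at all points of the closure. -/
theorem kernel_eqOn_kernelAdjoint (kb : KernelBounds O G C c) (hO : IsC1HolderDomain α O)
    (hS : IsC0Semigroup S) (hG : IsGreenKernel O S G)
    (hM : ∀ t : ℝ, 0 ≤ t → ‖S t‖ ≤ M * Real.exp (ω * t)) {s : ℝ} (hs : 0 < s) (hs1 : s ≤ 1) :
    ∀ᵐ x ∂(volume.restrict O), ∀ᵐ t ∂(volume.restrict (Ioi (2 * s))), ∀ y ∈ closure O,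
      G t x y = kernelAdjoint O G s
        (ContinuousLinearMap.adjoint (S (t - 2 * s)) (kernelSlice O G s x)) y := by
  set D := TopologicalSpace.denseSeq (Sp d)
  have hfix : ∀ t, 2 * s < t → ∀ᵐ x ∂(volume.restrict O), EqOn (G t x) (kernelAdjoint O G s
      (ContinuousLinearMap.adjoint (S (t - 2 * s)) (kernelSlice O G s x))) (closure O) := by
    intro t ht
    have h1 := kernel_add_ae_eq kb hO hS hG hs hs1 (r := t - s) (by linarith)
    filter_upwards [h1, ae_restrict_mem hO.isOpen.measurableSet] with x h1 hxO
    refine eqOn_closure_of_ae_eq hO.isOpen (hG.contDiffOn t (by linarith) x hxO).continuousOn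
      (kb.contDiffOn_kernelAdjoint hO hs hs1 _).1.continuousOn ?_
    have e : t - s = (t - 2 * s) + s := by ring
    have e' : s + (t - s) = t := by ring
    rw [e'] at h1
    rw [e, hS.adjoint_add_apply (by linarith) hs.le] at h1
    exact h1.symm.trans (kb.kernelAdjoint_ae_eq hO.isOpen hG hs hs1 _)
  -- The identity is known for each t and almost every x. Fubini exchanges the quantifiers, for one
  -- point y at a time from a countable dense set. The joint measurability it needs follows from
  -- continuity in t and measurability in x. The remaining y are reached by continuity.
  have hD : ∀ᵐ x ∂(volume.restrict O), ∀ i, D i ∈ closure O →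
      ∀ᵐ t ∂(volume.restrict (Ioi (2 * s))), G t x (D i) = kernelAdjoint O G s
        (ContinuousLinearMap.adjoint (S (t - 2 * s)) (kernelSlice O G s x)) (D i) := by
    refine ae_all_iff.2 fun i => ?_
    by_cases hi : D i ∈ closure O
    swap
    · exact Eventually.of_forall fun x h => absurd h hi
    set m := (kb.memLp_left hO.isOpen hs hs1 hi).toLp _
    have hmeas : MeasurableSet {p : Sp d × ℝ | G p.2 p.1 (D i)
        = ⟪kernelSlice O G s p.1, S (max (p.2 - 2 * s) 0) m⟫} := by
      refine measurableSet_eq_fun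
        (kb.measurable.comp (measurable_snd.prodMk (measurable_fst.prodMk measurable_const))) ?_
      have h := stronglyMeasurable_uncurry_of_continuous_of_stronglyMeasurable
        (u := fun (t : ℝ) x => ⟪kernelSlice O G s x, S (max (t - 2 * s) 0) m⟫)
        (fun x => continuous_const.inner ((hS.continuous_max hM m).comp
          (by fun_prop : Continuous fun t : ℝ => t - 2 * s)))
        (fun t => stronglyMeasurable_inner_kernelSlice kb hO.isOpen hs hs1 _)
      exact h.measurable.comp measurable_swap
    have h1 : ∀ᵐ t ∂(volume.restrict (Ioi (2 * s))), ∀ᵐ x ∂(volume.restrict O),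
        G t x (D i) = ⟪kernelSlice O G s x, S (max (t - 2 * s) 0) m⟫ := by
      refine (ae_restrict_iff' measurableSet_Ioi).2 (Eventually.of_forall fun t ht => ?_)
      have ht : 2 * s < t := ht
      filter_upwards [hfix t ht] with x hx
      rw [hx hi, kb.kernelAdjoint_eq_inner hO.isOpen hs hs1 hi, max_eq_left (by linarith),
        ContinuousLinearMap.adjoint_inner_right, real_inner_comm]
    filter_upwards [(Measure.ae_ae_comm hmeas).2 h1] with x hx _
    filter_upwards [hx, ae_restrict_mem measurableSet_Ioi] with t ht ht2
    have ht2 : 2 * s < t := ht2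
    rw [ht, kb.kernelAdjoint_eq_inner hO.isOpen hs hs1 hi, max_eq_left (by linarith),
        ContinuousLinearMap.adjoint_inner_right, real_inner_comm]
  filter_upwards [hD, ae_restrict_mem hO.isOpen.measurableSet] with x hx hxO
  have hx' : ∀ᵐ t ∂(volume.restrict (Ioi (2 * s))), ∀ i, D i ∈ closure O →
      G t x (D i) = kernelAdjoint O G s
        (ContinuousLinearMap.adjoint (S (t - 2 * s)) (kernelSlice O G s x)) (D i) := by
    refine ae_all_iff.2 fun i => ?_
    by_cases hi : D i ∈ closure O
    · filter_upwards [hx i hi] with t ht _ using ht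
    · exact Eventually.of_forall fun t h => absurd h hi
  filter_upwards [hx', ae_restrict_mem measurableSet_Ioi] with t ht ht2
  have ht2 : 2 * s < t := ht2
  have hE : EqOn (G t x) (kernelAdjoint O G s
        (ContinuousLinearMap.adjoint (S (t - 2 * s)) (kernelSlice O G s x))) (O ∩ range D) := by
    rintro _ ⟨hi, i, rfl⟩
    exact ht i (subset_closure hi)
  exact hE.of_subset_closure (hG.contDiffOn t (by linarith) x hxO).continuousOn
    (kb.contDiffOn_kernelAdjoint hO hs hs1 _).1.continuousOn
    (inter_subset_left.trans subset_closure) (closure_minimal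
      ((TopologicalSpace.denseRange_denseSeq (Sp d)).open_subset_closure_inter hO.isOpen)
      isClosed_closure)

theorem inner_resolvent_adjoint (hS : IsC0Semigroup S) (hω : ω < lam)
    (hM : ∀ t : ℝ, 0 ≤ t → ‖S t‖ ≤ M * Real.exp (ω * t)) {R R' : L2 O →L[ℝ] L2 O}
    (hR : ∀ h, R h = ∫ t in Ioi 0, Real.exp (-(lam * t)) • S t h)
    (hR' : ∀ h, R' h = ∫ t in Ioi 0, Real.exp (-(lam * t)) • ContinuousLinearMap.adjoint (S t) h)
    (f g : L2 O) : ⟪f, R' g⟫ = ⟪R f, g⟫ := by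
  rw [hR, hR', real_inner_comm, real_inner_comm g, ← integral_inner (hS.integrableOn hω hM f),
    real_inner_comm, ← integral_inner ((hS.adjoint hM).integrableOn hω
      (IsC0Semigroup.norm_adjoint_le hM) g)]
  refine integral_congr_ae (Eventually.of_forall fun t => ?_)
  simp only [inner_smul_right]
  rw [ContinuousLinearMap.adjoint_inner_right, real_inner_comm]

/-- The part of the Laplace transform of the kernel which comes from the times `t > ε`. -/
def laplaceTail (G : ℝ → Sp d → Sp d → ℝ) (lam ε : ℝ) (x y : Sp d) : ℝ :=
  ∫ t in Ioi ε, Real.exp (-(lam * t)) * G t x y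

/-- Here ε = 2s is spent in two halves: one makes G(s,x,·) an element k of L²(O), the other smooths
in y. The tail is exp(-lam ε) S^*(s) R^* k. Its boundary pairing is -exp(-lam ε) ⟪R H(s), k⟫, where
R H(s) = S(s) u and pairing with k evaluates S(s) at x, giving S(ε) u(x). -/
theorem laplaceTail_properties (kb : KernelBounds O G C c) (bd : BoundaryDatum a O γ K)
    (hO : IsC1HolderDomain α O) (hS : IsC0Semigroup S) (hG : IsGreenKernel O S G) (hω : ω < lam)
    (hM : ∀ t : ℝ, 0 ≤ t → ‖S t‖ ≤ M * Real.exp (ω * t)) {R : L2 O →L[ℝ] L2 O}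
    (hR : ∀ h, R h = ∫ t in Ioi 0, Real.exp (-(lam * t)) • S t h) {H : ℝ → L2 O}
    (hH : IsBoundaryFamily a O γ S H) {u : L2 O} (hu : ∀ ε, 0 < ε → S ε u = R (H ε)) {ε : ℝ}
    (hε : 0 < ε) (hε1 : ε ≤ 1) : ∀ᵐ x ∂(volume.restrict O),
      (∀ y ∈ closure O, IntegrableOn (fun t => Real.exp (-(lam * t)) * G t x y) (Ioi ε)) ∧
      ContDiffOn ℝ 1 (laplaceTail G lam ε x) (closure O) ∧
      boundaryPairing a O γ (laplaceTail G lam ε x) = -(Real.exp (-(lam * ε)) * S ε u x) := by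
  set s := ε / 2 with hs
  have hs0 : 0 < s := by positivity
  have hs1 : s ≤ 1 := by linarith
  have hεs : ε = 2 * s := by ring
  have hS' := hS.adjoint hM
  have hM' := IsC0Semigroup.norm_adjoint_le hM
  obtain ⟨R', hR'⟩ := hS'.exists_resolvent hω hM'
  have h1 := apply_ae_eq_inner_kernelSlice kb hO.isOpen hG hs0 hs1 (S s u)
  rw [← hS.add_apply hs0.le hs0.le, ← two_mul, ← hεs] at h1
  have h2 := kernel_eqOn_kernelAdjoint kb hO hS hG hM hs0 hs1
  rw [← hεs] at h2
  filter_upwards [h1, h2] with x h1 h2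
  set k := kernelSlice O G s x
  have hint := hS'.integrableOn hω hM' k
  have hcong : ∀ y (hy : y ∈ closure O), (fun t => Real.exp (-(lam * t)) * G t x y)
      =ᵐ[volume.restrict (Ioi ε)] fun t => Real.exp (-(lam * ε)) *
        ⟪(kb.memLp_left hO.isOpen hs0 hs1 hy).toLp _, Real.exp (-(lam * (t - ε))) •
          ContinuousLinearMap.adjoint (S (t - ε)) k⟫ := by
    intro y hy
    filter_upwards [h2] with t ht
    rw [ht y hy, kb.kernelAdjoint_eq_inner hO.isOpen hs0 hs1 hy, inner_smul_right, ← mul_assoc,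
      ← Real.exp_add]
    congr 2; ring
  have hI : ∀ y (hy : y ∈ closure O), IntegrableOn (fun t => Real.exp (-(lam * ε)) *
        ⟪(kb.memLp_left hO.isOpen hs0 hs1 hy).toLp _, Real.exp (-(lam * (t - ε))) •
          ContinuousLinearMap.adjoint (S (t - ε)) k⟫) (Ioi ε) := by
    intro y hy
    rw [← integrableOn_Ioi_comp_add_right]
    simp only [add_sub_cancel_right]
    exact (hint.const_inner _).const_mul _
  have htail : EqOn (laplaceTail G lam ε x)
      (fun y => 0 - (-Real.exp (-(lam * ε))) * kernelAdjoint O G s (R' k) y) (closure O) := by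
    intro y hy
    simp only [laplaceTail]
    rw [integral_congr_ae (hcong y hy), ← setIntegral_Ioi_comp_add_right,
      kb.kernelAdjoint_eq_inner hO.isOpen hs0 hs1 hy, hR']
    simp only [add_sub_cancel_right]
    rw [integral_const_mul, integral_inner hint]
    ring
  have hK := kb.contDiffOn_kernelAdjoint hO hs0 hs1 (R' k)
  refine ⟨fun y hy => (hI y hy).congr (hcong y hy).symm, ?_, ?_⟩
  · exact (contDiffOn_const.sub (contDiffOn_const.mul hK.1)).congr htail
  · have h0 : boundaryPairing a O γ (fun _ => 0) = 0 := by
      simp [boundaryPairing, conormalDeriv]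
    rw [boundaryPairing_congr htail, boundaryPairing_sub_const_mul bd hO contDiffOn_const hK.1, h0,
      hH s hs0 _ _ hK.1 (kb.kernelAdjoint_ae_eq hO.isOpen hG hs0 hs1 _),
      inner_resolvent_adjoint hS hω hM hR hR', ← hu s hs0, h1, real_inner_comm]
    ring

end Tail

/-! ### The Laplace transform of the kernel near the initial time -/

section Near

variable {α : ℝ≥0} {K : Set (Sp d)} {a : Sp d → Matrix (Fin d) (Fin d) ℝ} {γ : Sp d → ℝ}
  {S : ℝ → L2 O →L[ℝ] L2 O} {G : ℝ → Sp d → Sp d → ℝ} {C c M ω lam : ℝ}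

theorem KernelBounds.exp_mul_abs_le (kb : KernelBounds O G C c)
    (hO : IsC1HolderDomain α O) (lam : ℝ) {ρ : ℝ} (hρ : 0 < ρ) :
    ∃ B : ℝ, 0 < B ∧ ∀ t, 0 < t → t ≤ 1 → ∀ x ∈ O, ∀ y ∈ closure O, ρ ≤ ‖x - y‖ →
      |Real.exp (-(lam * t)) * G t x y| ≤ B ∧
      ‖fderivWithin ℝ (fun y => Real.exp (-(lam * t)) * G t x y) (closure O) y‖ ≤ B := by
  have hC := kb.C_pos
  obtain ⟨A, hA, hg⟩ := gauss_div_sqrt_le (d := d) kb.c_pos hρ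
  refine ⟨Real.exp |lam| * (C * A), by positivity, fun t ht ht1 x hx y hy hxy => ?_⟩
  have hst : 0 < Real.sqrt t := Real.sqrt_pos.2 ht
  have h1 := hg t ht ht1 (x - y) hxy
  have he : Real.exp (-(lam * t)) ≤ Real.exp |lam| := by
    refine Real.exp_le_exp.2 ((neg_le_abs _).trans ?_)
    rw [abs_mul, abs_of_pos ht]
    exact mul_le_of_le_one_right (abs_nonneg _) ht1
  have h2 : C / Real.sqrt t * gauss (c * t) (x - y) ≤ C * A := by
    calc C / Real.sqrt t * gauss (c * t) (x - y)
        = C * (gauss (c * t) (x - y) / Real.sqrt t) := by ring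
      _ ≤ _ := by gcongr
  have hg0 : 0 ≤ gauss (c * t) (x - y) := gauss_nonneg _ (mul_pos kb.c_pos ht).le _
  have h3 : C * gauss (c * t) (x - y) ≤ C * A := by
    gcongr
    refine le_trans ?_ h1
    rw [le_div_iff₀ hst]
    exact mul_le_of_le_one_right hg0 (Real.sqrt_le_one.2 ht1)
  constructor
  · rw [abs_mul, abs_of_pos (Real.exp_pos _)]
    gcongr
    exact (kb.abs_le t ht ht1 x hx y hy).trans h3
  · have h4 : fderivWithin ℝ (fun y => Real.exp (-(lam * t)) * G t x y) (closure O) y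
        = Real.exp (-(lam * t)) • fderivWithin ℝ (G t x) (closure O) y :=
      fderivWithin_const_mul (uniqueDiffOn_closure hO y hy)
        ((kb.contDiffOn t ht x hx).differentiableOn one_ne_zero y hy) _
    rw [h4, norm_smul, Real.norm_of_nonneg (Real.exp_pos _).le]
    gcongr
    exact (kb.norm_fderivWithin_le t ht ht1 x hx y hy).trans h2

theorem KernelBounds.integrableOn_exp_mul (kb : KernelBounds O G C c)
    (hO : IsC1HolderDomain α O) {x y : Sp d} (hx : x ∈ O)
    (hy : y ∈ closure O) (hyx : y ≠ x) (lam : ℝ) {ε : ℝ} (hε1 : ε ≤ 1) :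
    IntegrableOn (fun t => Real.exp (-(lam * t)) * G t x y) (Ioc 0 ε) := by
  obtain ⟨B, -, hB⟩ := kb.exp_mul_abs_le hO lam (ρ := ‖x - y‖) (norm_pos_iff.2 (sub_ne_zero.2 hyx.symm))
  refine Integrable.mono' (integrableOn_const (C := B) measure_Ioc_lt_top.ne) ?_ ?_
  · exact ((by fun_prop : Measurable fun t : ℝ => Real.exp (-(lam * t))).mul
      (kb.measurable_time x y)).aestronglyMeasurable
  · exact (ae_restrict_iff' measurableSet_Ioc).2 (Eventually.of_forall fun t ht =>
      (hB t ht.1 (ht.2.trans hε1) x hx y hy le_rfl).1)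

/-- Points within r/2 of the frontier are at distance at least r/2 from x, where r is the radius of
a ball about x inside O. There the gradient of the integrand is bounded uniformly in t ≤ 1, so
integrating over (0, ε] costs only ε. -/
theorem KernelBounds.exists_hasFDerivWithinAt_near (kb : KernelBounds O G C c)
    (hO : IsC1HolderDomain α O) {x : Sp d} (hx : x ∈ O) (lam : ℝ) :
    ∃ B : ℝ, 0 ≤ B ∧ ∀ ε, 0 < ε → ε ≤ 1 → ∀ z ∈ frontier O, ∃ L : Sp d →L[ℝ] ℝ, ‖L‖ ≤ B * ε ∧
      HasFDerivWithinAt (fun y => ∫ t in Ioc 0 ε, Real.exp (-(lam * t)) * G t x y) L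
        (closure O) z := by
  obtain ⟨r, hr, hrO⟩ := Metric.isOpen_iff.1 hO.isOpen x hx
  obtain ⟨B, hB0, hB⟩ := kb.exp_mul_abs_le hO lam (ρ := r / 2) (by positivity)
  refine ⟨B, hB0.le, fun ε hε hε1 z hz => ?_⟩
  have hzc := frontier_subset_closure hz
  have hxz : r ≤ ‖x - z‖ := by
    by_contra! h
    rw [hO.isOpen.frontier_eq] at hz
    refine hz.2 (hrO ?_)
    rwa [Metric.mem_ball, dist_comm, dist_eq_norm]
  have hfar : ∀ y ∈ Metric.ball z (r / 2), r / 2 ≤ ‖x - y‖ := by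
    intro y hy
    rw [Metric.mem_ball, dist_eq_norm] at hy
    have := norm_add_le (x - y) (y - z)
    rw [sub_add_sub_cancel] at this
    linarith
  obtain ⟨δ, hδ, hδr, A, hA0, hlip⟩ := exists_lipschitz_of_fderiv_bound hO hzc
    (R := r / 2) (by positivity)
  have hcd : ∀ t, 0 < t → ContDiffOn ℝ 1 (fun y => Real.exp (-(lam * t)) * G t x y) (closure O) :=
    fun t ht => contDiffOn_const.mul (kb.contDiffOn t ht x hx)
  have h := hasFDerivWithinAt_integral (ν := volume.restrict (Ioc 0 ε))
    (F := fun t y => Real.exp (-(lam * t)) * G t x y)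
    (F' := fun t => fderivWithin ℝ (fun y => Real.exp (-(lam * t)) * G t x y) (closure O) z)
    (b := fun _ => (A + 1) * B) (uniqueDiffOn_closure hO z hzc) hzc
    (fun y _ => ((by fun_prop : Measurable fun t : ℝ => Real.exp (-(lam * t))).mul
      (kb.measurable_time x y)).aestronglyMeasurable)
    (kb.integrableOn_exp_mul hO hx hzc (fun e => by
      rw [hO.isOpen.frontier_eq] at hz; exact hz.2 (e ▸ hx)) lam hε1)
    ((ae_restrict_iff' measurableSet_Ioc).2 (Eventually.of_forall fun t ht =>
      ((hcd t ht.1).differentiableOn one_ne_zero z hzc).hasFDerivWithinAt))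
    (integrableOn_const measure_Ioc_lt_top.ne)
    ((ae_restrict_iff' measurableSet_Ioc).2 (Eventually.of_forall fun t ht => by
      refine (hB t ht.1 (ht.2.trans hε1) x hx z hzc (by linarith)).2.trans ?_
      nlinarith)) hδ
    ((ae_restrict_iff' measurableSet_Ioc).2 (Eventually.of_forall fun t ht y hy => by
      have h1 := hlip _ (hcd t ht.1).continuousOn
        (((hcd t ht.1).differentiableOn one_ne_zero).mono subset_closure) B (fun w hw => by
          rw [← fderivWithin_closure_eq hO.isOpen hw.1]
          exact (hB t ht.1 (ht.2.trans hε1) x hx w (subset_closure hw.1) (hfar w hw.2)).2)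
        y hy z ⟨hzc, Metric.mem_ball_self hδ⟩
      refine h1.trans ?_
      gcongr
      linarith))
  refine ⟨_, ?_, h.2⟩
  have h2 := norm_setIntegral_le_of_norm_le_const (μ := (volume : Measure ℝ)) (s := Ioc 0 ε)
    (f := fun t => fderivWithin ℝ (fun y => Real.exp (-(lam * t)) * G t x y) (closure O) z)
    (C := B) measure_Ioc_lt_top fun t ht =>
      (hB t ht.1 (ht.2.trans hε1) x hx z hzc (by linarith)).2
  simpa [hε.le] using h2

end Near

/-! ### The representation of the solution -/

section Representation

variable {α : ℝ≥0} {K : Set (Sp d)} {a : Sp d → Matrix (Fin d) (Fin d) ℝ} {γ : Sp d → ℝ}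
  {S : ℝ → L2 O →L[ℝ] L2 O} {G : ℝ → Sp d → Sp d → ℝ} {C c M ω lam : ℝ}

/-- The boundary integral against the conormal derivative of the Laplace transform of the kernel is
the limit of those against its parts coming from the times `t > ε n`, as `ε n → 0`. -/
theorem laplaceKernel_properties (kb : KernelBounds O G C c) (bd : BoundaryDatum a O γ K)
    (hO : IsC1HolderDomain α O) {x : Sp d} (hx : x ∈ O) {ε : ℕ → ℝ} (hε : ∀ n, 0 < ε n)
    (hε1 : ∀ n, ε n ≤ 1) (hlim : Tendsto ε atTop (𝓝 0))
    (hI : ∀ n, ∀ y ∈ closure O, IntegrableOn (fun t => Real.exp (-(lam * t)) * G t x y) (Ioi (ε n)))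
    (hT : ∀ n, ContDiffOn ℝ 1 (laplaceTail G lam (ε n) x) (closure O)) :
    (∀ y ∈ closure O, y ≠ x →
      IntegrableOn (fun t : ℝ => Real.exp (-(lam * t)) * G t x y) (Ioi 0)) ∧
    (∀ y ∈ frontier O, DifferentiableWithinAt ℝ (laplaceKernel G lam x) (closure O) y) ∧
    Integrable (fun y => γ y * conormalDeriv a O (laplaceKernel G lam x) y) (surfaceMeasure O) ∧
    Tendsto (fun n => boundaryPairing a O γ (laplaceTail G lam (ε n) x)) atTop
      (𝓝 (boundaryPairing a O γ (laplaceKernel G lam x))) := by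
  obtain ⟨B, hB0, hnear⟩ := kb.exists_hasFDerivWithinAt_near hO hx lam
  have hint : ∀ y ∈ closure O, y ≠ x →
      IntegrableOn (fun t : ℝ => Real.exp (-(lam * t)) * G t x y) (Ioi 0) := by
    intro y hy hyx
    rw [← Ioc_union_Ioi_eq_Ioi (hε 0).le]
    exact (kb.integrableOn_exp_mul hO hx hy hyx lam (hε1 0)).union (hI 0 y hy)
  have hne : ∀ z ∈ frontier O, z ≠ x := by
    intro z hz e
    rw [hO.isOpen.frontier_eq] at hz; exact hz.2 (e ▸ hx)
  have hsplit : ∀ n, ∀ y ∈ closure O, y ≠ x → laplaceKernel G lam x y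
      = (∫ t in Ioc 0 (ε n), Real.exp (-(lam * t)) * G t x y) + laplaceTail G lam (ε n) x y := by
    intro n y hy hyx
    rw [laplaceKernel, laplaceTail, ← setIntegral_union (Ioc_disjoint_Ioi le_rfl) measurableSet_Ioi
      (kb.integrableOn_exp_mul hO hx hy hyx lam (hε1 n)) (hI n y hy), Ioc_union_Ioi_eq_Ioi (hε n).le]
  have hderiv : ∀ n, ∀ z ∈ frontier O, ∃ L : Sp d →L[ℝ] ℝ, ‖L‖ ≤ B * ε n ∧
      HasFDerivWithinAt (laplaceKernel G lam x)
        (L + fderivWithin ℝ (laplaceTail G lam (ε n) x) (closure O) z) (closure O) z := by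
    intro n z hz
    have hzc := frontier_subset_closure hz
    obtain ⟨L, hL, hd⟩ := hnear (ε n) (hε n) (hε1 n) z hz
    refine ⟨L, hL, ((hd.add (((hT n).differentiableOn one_ne_zero z hzc).hasFDerivWithinAt)
      ).congr_of_eventuallyEq ?_ (hsplit n z hzc (hne z hz)))⟩
    filter_upwards [self_mem_nhdsWithin,
      mem_nhdsWithin_of_mem_nhds (isOpen_ne.mem_nhds (hne z hz))] with y hy hyx
    exact hsplit n y hy hyx
  have hdiff : ∀ n, ∀ z ∈ frontier O,
      ‖γ z * conormalDeriv a O (laplaceKernel G lam x) z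
        - γ z * conormalDeriv a O (laplaceTail G lam (ε n) x) z‖
      ≤ |γ z| * ‖conormal a O z‖ * (B * ε n) := by
    intro n z hz
    obtain ⟨L, hL, hd⟩ := hderiv n z hz
    have e : conormalDeriv a O (laplaceKernel G lam x) z
        - conormalDeriv a O (laplaceTail G lam (ε n) x) z = L (conormal a O z) := by
      rw [conormalDeriv, conormalDeriv,
        hd.fderivWithin (uniqueDiffOn_closure hO z (frontier_subset_closure hz))]
      simp
    rw [← mul_sub, e, norm_mul, Real.norm_eq_abs, mul_assoc]
    gcongr
    rw [mul_comm]
    exact L.le_of_opNorm_le hL _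
  have hBlim : Tendsto (fun n => B * ε n) atTop (𝓝 0) := by simpa using hlim.const_mul B
  have hTI := fun n => bd.integrable_conormalDeriv hO (hT n)
  -- No continuity of the derivative of the Laplace kernel along the boundary is at hand.
  -- Measurability is inherited from the tails, whose conormal derivatives converge pointwise.
  have hmeas : AEStronglyMeasurable
      (fun y => γ y * conormalDeriv a O (laplaceKernel G lam x) y) (surfaceMeasure O) := by
    refine aestronglyMeasurable_of_tendsto_ae atTop (fun n => (hTI n).aestronglyMeasurable) ?_
    filter_upwards [ae_surfaceMeasure_mem] with z hz
    rw [tendsto_iff_norm_sub_tendsto_zero]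
    refine squeeze_zero (fun _ => norm_nonneg _) (fun n => ?_)
      (by simpa using hBlim.const_mul (|γ z| * ‖conormal a O z‖))
    rw [norm_sub_rev]
    exact hdiff n z hz
  have hKI : Integrable (fun y => γ y * conormalDeriv a O (laplaceKernel G lam x) y)
      (surfaceMeasure O) := by
    have h1 : Integrable (fun y => γ y * conormalDeriv a O (laplaceKernel G lam x) y
        - γ y * conormalDeriv a O (laplaceTail G lam (ε 0) x) y) (surfaceMeasure O) := by
      refine Integrable.mono' ((bd.integrable_norm hO).mul_const (B * ε 0))
        (hmeas.sub (hTI 0).aestronglyMeasurable) ?_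
      filter_upwards [ae_surfaceMeasure_mem] with z hz using hdiff 0 z hz
    exact (h1.add (hTI 0)).congr (Eventually.of_forall fun y => sub_add_cancel _ _)
  refine ⟨hint, fun z hz => ?_, hKI, ?_⟩
  · obtain ⟨L, -, hd⟩ := hderiv 0 z hz
    exact hd.differentiableWithinAt
  · rw [tendsto_iff_norm_sub_tendsto_zero]
    refine squeeze_zero (fun _ => norm_nonneg _) (fun n => ?_)
      (by simpa using hBlim.const_mul (∫ y, |γ y| * ‖conormal a O y‖ ∂(surfaceMeasure O)))
    rw [norm_sub_rev, boundaryPairing, boundaryPairing, ← integral_sub hKI (hTI n),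
      ← integral_mul_const]
    refine norm_integral_le_of_norm_le ((bd.integrable_norm hO).mul_const _) ?_
    filter_upwards [ae_surfaceMeasure_mem] with z hz using hdiff n z hz

/-- Values of a semigroup at almost every point, along a subsequence of times tending to zero. -/
theorem IsC0Semigroup.exists_seq_tendsto_ae (hS : IsC0Semigroup S) (u : L2 O) {ε : ℕ → ℝ}
    (hε : ∀ n, 0 < ε n) (hlim : Tendsto ε atTop (𝓝 0)) : ∃ φ : ℕ → ℕ, StrictMono φ ∧
      ∀ᵐ x ∂(volume.restrict O), Tendsto (fun n => S (ε (φ n)) u x) atTop (𝓝 (u x)) := by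
  have h1 : Tendsto (fun n => S (ε n) u) atTop (𝓝 u) :=
    (hS.tendsto u).comp (tendsto_nhdsWithin_iff.2 ⟨hlim, Eventually.of_forall hε⟩)
  exact (tendstoInMeasure_of_tendsto_Lp h1).exists_seq_tendsto_ae

end Representation

end BoundaryNoise

end

/-! ### The theorem: the solution is the Laplace transform of the boundary orbit -/

theorem theorem5p3 {d : ℕ} {α : ℝ≥0} (hα₀ : 0 < α) (hα₁ : α < 1)
    (O : Set (BoundaryNoise.Sp d)) (hO : BoundaryNoise.IsC1HolderDomain α O)
    (a : BoundaryNoise.Sp d → Matrix (Fin d) (Fin d) ℝ)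
    (μ : BoundaryNoise.Sp d → BoundaryNoise.Sp d)
    (haμ : BoundaryNoise.CoefficientAssumption a μ O)
    (S : ℝ → BoundaryNoise.L2 O →L[ℝ] BoundaryNoise.L2 O)
    (hS : BoundaryNoise.IsC0Semigroup S)
    (hA : BoundaryNoise.IsDirichletRealization a μ O S)
    (G : ℝ → BoundaryNoise.Sp d → BoundaryNoise.Sp d → ℝ)
    (hG : BoundaryNoise.IsGreenKernel O S G)
    (hG₁ : BoundaryNoise.GreenBounds O G)
    (hG₂ : BoundaryNoise.GreenGradientBound O G)
    (lam : ℝ)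
    (hlam : ∃ M ω : ℝ, ω < lam ∧ ∀ t : ℝ, 0 ≤ t → ‖S t‖ ≤ M * Real.exp (ω * t))
    (γ : BoundaryNoise.Sp d → ℝ) (hγ : ContinuousOn γ (frontier O))
    (hγK : ∃ K : Set (BoundaryNoise.Sp d), IsCompact K ∧ ∀ y ∈ frontier O, y ∉ K → γ y = 0) :
    (∃! u : BoundaryNoise.L2 O, BoundaryNoise.IsDirichletMapValue a O S lam γ u) ∧
    ∀ u : BoundaryNoise.L2 O, BoundaryNoise.IsDirichletMapValue a O S lam γ u →
      (∀ᵐ x ∂(volume.restrict O),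
        (∀ y ∈ closure O, y ≠ x →
          IntegrableOn (fun t : ℝ => Real.exp (-(lam * t)) * G t x y) (Ioi 0)) ∧
        (∀ y ∈ frontier O,
          DifferentiableWithinAt ℝ (BoundaryNoise.laplaceKernel G lam x) (closure O) y) ∧
        Integrable (fun y => γ y *
          BoundaryNoise.conormalDeriv a O (BoundaryNoise.laplaceKernel G lam x) y)
          (BoundaryNoise.surfaceMeasure O) ∧
        u x = -∫ y, γ y *
          BoundaryNoise.conormalDeriv a O (BoundaryNoise.laplaceKernel G lam x) y
          ∂(BoundaryNoise.surfaceMeasure O)) ∧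
      ∀ t : ℝ, 0 < t → ∃ v : BoundaryNoise.L2 O, BoundaryNoise.GeneratorEq S (S t u) v ∧
        ∀ᵐ x ∂(volume.restrict O),
          Integrable (fun y => γ y * BoundaryNoise.conormalDeriv a O (G t x) y)
            (BoundaryNoise.surfaceMeasure O) ∧
          lam * S t u x - v x = -∫ y, γ y * BoundaryNoise.conormalDeriv a O (G t x) y
            ∂(BoundaryNoise.surfaceMeasure O) := by
  obtain ⟨M, ω, hω, hM⟩ := hlam
  obtain ⟨K, hK, hγ0⟩ := hγK
  obtain ⟨C, c, kb⟩ := BoundaryNoise.exists_kernelBounds hO hG hG₁ hG₂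
  have bd : BoundaryNoise.BoundaryDatum a O γ K := ⟨haμ.continuousOn, hγ, hK, hγ0⟩
  obtain ⟨R, hR⟩ := hS.exists_resolvent hω hM
  obtain ⟨H, hH, A, hHA⟩ := BoundaryNoise.exists_boundaryFamily kb bd hO hS hG
  set u₀ : BoundaryNoise.L2 O := ∫ t in Ioi 0, Real.exp (-(lam * t)) • H t
  have hu₀ : ∀ ε, 0 < ε → S ε u₀ = R (H ε) := fun ε hε => by
    rw [hR]
    exact hS.apply_integral_orbit hω hM (fun r t hr ht => hH.map_eq kb hO hS hG hr ht) hHA hε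
  have hval := BoundaryNoise.isDirichletMapValue_of_apply_eq kb bd hO hS hG hω hM hR hH hu₀
  refine ⟨⟨u₀, hval, fun v hv => hv.unique kb hO hS hG hω hM hval⟩, fun u hu => ?_⟩
  obtain rfl : u = u₀ := hu.unique kb hO hS hG hω hM hval
  refine ⟨?_, fun t ht => ⟨lam • R (H t) - H t, ?_, ?_⟩⟩
  · set ε : ℕ → ℝ := fun n => 1 / ((n : ℝ) + 1)
    have hε : ∀ n, 0 < ε n := fun n => by positivity
    have hε1 : ∀ n, ε n ≤ 1 := fun n => by
      rw [div_le_one (by positivity)]; linarith [n.cast_nonneg (α := ℝ)]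
    have hεlim : Tendsto ε atTop (𝓝 0) := tendsto_one_div_add_atTop_nhds_zero_nat
    obtain ⟨φ, hφ, hφlim⟩ := hS.exists_seq_tendsto_ae u₀ hε hεlim
    have htail := ae_all_iff.2 fun n => BoundaryNoise.laplaceTail_properties kb bd hO hS hG hω hM
      hR hH hu₀ (hε n) (hε1 n)
    filter_upwards [htail, hφlim, ae_restrict_mem hO.isOpen.measurableSet] with x hx hxφ hxO
    obtain ⟨h1, h2, h3, h4⟩ := BoundaryNoise.laplaceKernel_properties kb bd hO hxO hε hε1 hεlim
      (fun n => (hx n).1) (fun n => (hx n).2.1)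
    refine ⟨h1, h2, h3, ?_⟩
    -- The pairings with the tails equal -exp(-lam ε) S(ε) u₀(x), which converges to -u₀(x) along
    -- the subsequence. They also converge to the pairing with the full Laplace kernel, and the two
    -- limits agree.
    have h5 : Tendsto (fun n => BoundaryNoise.boundaryPairing a O γ
        (BoundaryNoise.laplaceTail G lam (ε (φ n)) x)) atTop (𝓝 (-(1 * u₀ x))) := by
      simp only [fun n => (hx n).2.2]
      refine (Tendsto.mul ?_ hxφ).neg
      have hc : ContinuousAt (fun s : ℝ => Real.exp (-(lam * s))) 0 := by fun_prop
      have := hc.tendsto.comp (hεlim.comp hφ.tendsto_atTop)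
      simpa using! this
    have h6 := tendsto_nhds_unique h5 (h4.comp hφ.tendsto_atTop)
    rw [one_mul, BoundaryNoise.boundaryPairing] at h6
    rw [← h6, neg_neg]
  · rw [hu₀ t ht]
    exact hS.generatorEq_resolvent hω hM hR (H t)
  · rw [hu₀ t ht]
    filter_upwards [BoundaryNoise.boundaryFamily_ae_eq kb bd hO hS hG hH ht,
      Lp.coeFn_sub (lam • R (H t)) (H t), Lp.coeFn_smul lam (R (H t))] with x h1 h2 h3
    refine ⟨h1.1, ?_⟩
    rw [h2, Pi.sub_apply, h3, Pi.smul_apply, smul_eq_mul, sub_sub_cancel, h1.2]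
    rfl
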